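/- **Setting (infinite-armed bandit with noisy rewards).** The arms are indexed by $\mathbb N$. The mean rewards $\theta=(\theta_a)_{a}$ are i.i.d. with a common prior law on $[0,1]$, and $R^*$ is the supremum of the support of this law. The disturbances $W_0,W_1,\dots$ are i.i.d. and independent of $\theta$, and $\xi$ is a random variable independent of $(\theta,(W_t)_t)$. A policy $\psi$ chooses $A_t=\psi_t(\mathcal H_{t-1},\xi)$, where $\mathcal H_{t-1}=(A_0,R_0,\dots,A_{t-1},R_{t-1})$, and the agent then observes only the reward $R_t=g(A_t,\theta_{A_t},W_t)$. For every arm $a$ the reward $g(a,\theta_a,W_t)$ lies in $[0,1]$ almost surely and $\mathbb E[g(a,\theta_a,W_t)\mid\theta]=\theta_a$ almost surely. Let $D\ge 0$ and let $\delta=\mathbb P(\theta_a\ge R^*-D)$ (the same for all $a$); assume $\delta>0$, which is automatic if $D>0$. Let $0\le\alpha<1$. The satisficing action is $\tilde A=\min\{a:\theta_a\ge R^*-D\}$. Let $\mathcal A_t=\{A_0,\dots,A_{t-1}\}$ be the set of arms played before period $t$. The policy $\psi$ is *satisficing Thompson sampling* (STS) with respect to $\tilde A$ if it has one of the following two forms: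 * (probability matching) almost surely $\mathbb P(A_t=a\mid\mathcal H_{t-1})=\mathbb P(\tilde A=a\mid\mathcal H_{t-1})$ for all $t$ and $a$; or * (sequential implementation) almost surely $\mathbb P(A_t=a\mid\mathcal H_{t-1})=\mathbb P(\tilde A=a\mid\mathcal H_{t-1})$ for all $t$ and all $a\in\mathcal A_t$, and whenever $A_t\notin\mathcal A_t$, the arm $A_t$ is the smallest arm not in $\mathcal A_t$. (Hence $\mathbb P(A_t\notin\mathcal A_t\mid\mathcal H_{t-1})=\mathbb P(\tilde A\notin\mathcal A_t\mid\mathcal H_{t-1})$.) Mutual information $I$ is in nats, $\log$ is the natural logarithm, and $$\Gamma(\tilde A,\psi)=(1-\alpha^2)\sum_{t=0}^\infty\alpha^{2t}\,\frac{\big(\mathbb E[\theta_{\tilde A}-R_t]\big)^2}{I\big(\tilde A;(A_t,R_t)\mid\mathcal H_{t-1}\big)},\qquad \mathrm{SRegret}(\alpha,\psi,D)=\mathbb E\Big[\sum_{t=0}^\infty\alpha^t\,(R^*-D-R_t)\Big],$$ with $0/0=0$ and $x/0=\infty$ for $x>0$. **Theorem.** If $\psi$ is STS with respect to $\tilde A$,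 then $$I(\tilde A;\theta)\le 1+\log(1/\delta),\qquad \Gamma(\tilde A,\psi)\le 6+\frac4\delta+\frac2\delta\log\Big(\frac1{1-\alpha^2}\Big),$$ $$\mathrm{SRegret}(\alpha,\psi,D)\le M:=\min\left\{\sqrt{\frac{\big(6+4/\delta+(2/\delta)\log\frac{1}{1-\alpha^2}\big)\big(1+\log(1/\delta)\big)}{1-\alpha^2}},\ \frac1{1-\alpha}\right\}.$$ Moreover $M=\tilde O(\rho)$ with $\rho=\min\Big\{\sqrt{\frac{1/\delta}{1-\alpha}},\ \frac1{1-\alpha}\Big\}$; that is, there are universal constants $C>0$ and $k\in\mathbb N$, not depending on the bandit, the policy, $D$ or $\alpha$, such that $M\le C\,\rho\,(1+\log\rho)^k$ (note $\rho\ge1$). Consequently $\mathrm{SRegret}(\alpha,\psi,D)=\tilde O(\rho)$. -/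

import Mathlib

open MeasureTheory ProbabilityTheory
open scoped ENNReal

universe u v w

noncomputable section

/-- Mutual information `I(X; Z)` in nats: the Kullback-Leibler divergence of the joint law from the
product of the marginal laws. -/
def mutualInfo {Ω : Type*} [MeasurableSpace Ω] {S T : Type*} [MeasurableSpace S]
    [MeasurableSpace T] (P : Measure Ω) (X : Ω → S) (Z : Ω → T) : ℝ≥0∞ :=
  InformationTheory.klDiv (P.map (fun ω => (X ω, Z ω))) ((P.map X).prod (P.map Z))

/-- Conditional mutual information `I(X; Z | H)`: the average over the law of `H` of the mutual
information of `X` and `Z` under the regular conditional distribution given `H = h`. -/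
def condMutualInfo {Ω : Type*} [MeasurableSpace Ω] {S T U : Type*} [MeasurableSpace S]
    [StandardBorelSpace S] [Nonempty S] [MeasurableSpace T] [StandardBorelSpace T] [Nonempty T]
    [MeasurableSpace U] (P : Measure Ω) [IsFiniteMeasure P]
    (X : Ω → S) (Z : Ω → T) (H : Ω → U) : ℝ≥0∞ :=
  ∫⁻ h, InformationTheory.klDiv (condDistrib (fun ω => (X ω, Z ω)) H P h)
    ((condDistrib X H P h).prod (condDistrib Z H P h)) ∂(P.map H)

/-- The infinite-armed bandit with noisy rewards. The arms are indexed by `ℕ`. The mean rewards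
`θ a` are i.i.d. with law `prior` on `[0, 1]`; playing arm `a` in period `t` yields the observed
reward `g a (θ a) (W t)` in `[0, 1]`, whose conditional mean given `θ` is `θ a`. The disturbances
`W t` are i.i.d. and independent of `θ`; the random variable `ξ`, which policies may use to
randomize, is independent of `θ` and of the disturbances. -/
structure NoisyBandit (Ω : Type u) (𝒲 : Type v) (Ξ : Type w) [MeasurableSpace Ω]
    [MeasurableSpace 𝒲] [MeasurableSpace Ξ] (P : Measure Ω) where
  /-- common prior law of the mean rewards -/
  prior : Measure ℝ
  /-- mean rewards -/
  θ : ℕ → Ω → ℝ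
  /-- disturbances -/
  W : ℕ → Ω → 𝒲
  /-- exogenous randomness of the policy -/
  ξ : Ω → Ξ
  /-- system function: arm, mean reward of that arm, disturbance -/
  g : ℕ → ℝ → 𝒲 → ℝ
  measurable_θ : ∀ a, Measurable (θ a)
  measurable_W : ∀ t, Measurable (W t)
  measurable_ξ : Measurable ξ
  measurable_g : ∀ a, Measurable (fun p : ℝ × 𝒲 => g a p.1 p.2)
  prior_mem : ∀ᵐ x ∂prior, x ∈ Set.Icc (0 : ℝ) 1
  law_θ : ∀ a, P.map (θ a) = prior
  indep_θ : iIndepFun θ P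
  law_W : ∀ t, P.map (W t) = P.map (W 0)
  indep_W : iIndepFun W P
  indep_θ_W : IndepFun (fun ω a => θ a ω) (fun ω t => W t ω) P
  indep_ξ : IndepFun ξ (fun ω => ((fun a => θ a ω), (fun t => W t ω))) P
  reward_mem : ∀ a t, ∀ᵐ ω ∂P, g a (θ a ω) (W t ω) ∈ Set.Icc (0 : ℝ) 1
  reward_mean : ∀ a t,
    P[fun ω => g a (θ a ω) (W t ω) | MeasurableSpace.comap (fun ω a => θ a ω) inferInstance]
      =ᵐ[P] θ a

/-- A policy maps the history `(A₀, Y₀), …, (Aₜ₋₁, Yₜ₋₁)` and the exogenous variable to an arm. -/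
structure Policy (Ξ : Type w) [MeasurableSpace Ξ] where
  act : (t : ℕ) → (Fin t → ℕ × ℝ) → Ξ → ℕ
  measurable_act : ∀ t, Measurable (fun p : (Fin t → ℕ × ℝ) × Ξ => act t p.1 p.2)

namespace NoisyBandit

variable {Ω : Type u} {𝒲 : Type v} {Ξ : Type w} [MeasurableSpace Ω]
  [MeasurableSpace 𝒲] [MeasurableSpace Ξ] {P : Measure Ω}

/-- `R*`: the supremal value in the support of the prior of an arm. -/
def Rstar (B : NoisyBandit Ω 𝒲 Ξ P) : ℝ := sSup B.prior.support

/-- `δ = P(θ_a ≥ R* - D)`, which is the same for every arm. -/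
def delta (B : NoisyBandit Ω 𝒲 Ξ P) (D : ℝ) : ℝ := B.prior.real (Set.Ici (B.Rstar - D))

/-- The satisficing action `Ã`: the first arm with `θ_a ≥ R* - D`
(and arm `0` if there is none, an event of probability zero when `δ > 0`). -/
def satAction (B : NoisyBandit Ω 𝒲 Ξ P) (D : ℝ) (ω : Ω) : ℕ :=
  sInf {a : ℕ | B.Rstar - D ≤ B.θ a ω}

/-- `B.history ψ t` is the sequence of the first `t` pairs (action, observed reward) under `ψ`. -/
def history (B : NoisyBandit Ω 𝒲 Ξ P) (ψ : Policy Ξ) : (t : ℕ) → Ω → (Fin t → ℕ × ℝ)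
  | 0, _ => Fin.elim0
  | t + 1, ω =>
    let h := history B ψ t ω
    let a := ψ.act t h (B.ξ ω)
    Fin.snoc (α := fun _ => ℕ × ℝ) h (a, B.g a (B.θ a ω) (B.W t ω))

/-- The action `A_t`. -/
def action (B : NoisyBandit Ω 𝒲 Ξ P) (ψ : Policy Ξ) (t : ℕ) (ω : Ω) : ℕ :=
  ψ.act t (B.history ψ t ω) (B.ξ ω)

/-- The observed reward `R_t = Y_t`. -/
def reward (B : NoisyBandit Ω 𝒲 Ξ P) (ψ : Policy Ξ) (t : ℕ) (ω : Ω) : ℝ :=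
  B.g (B.action ψ t ω) (B.θ (B.action ψ t ω) ω) (B.W t ω)

/-- The set of arms played before period `t`. -/
def tested (B : NoisyBandit Ω 𝒲 Ξ P) (ψ : Policy Ξ) (t : ℕ) (ω : Ω) : Set ℕ :=
  {a | ∃ s < t, B.action ψ s ω = a}

/-- The σ-algebra generated by the history before period `t`. -/
abbrev histSigma (B : NoisyBandit Ω 𝒲 Ξ P) (ψ : Policy Ξ) (t : ℕ) : MeasurableSpace Ω :=
  MeasurableSpace.comap (B.history ψ t) inferInstance

/-- Probability matching with respect to `Ã`: given the history, `A_t` has the same conditional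
distribution as `Ã`. -/
def IsProbabilityMatching (B : NoisyBandit Ω 𝒲 Ξ P) (ψ : Policy Ξ) (D : ℝ) : Prop :=
  ∀ t a, P⟦{ω | B.action ψ t ω = a} | B.histSigma ψ t⟧
    =ᵐ[P] P⟦{ω | B.satAction D ω = a} | B.histSigma ψ t⟧

/-- The sequential implementation: each tested arm is played with the conditional probability
that it is `Ã`, and otherwise the first untested arm is played (hence an untested arm is played
with the conditional probability that `Ã` is untested). -/
def IsSequentialMatching (B : NoisyBandit Ω 𝒲 Ξ P) (ψ : Policy Ξ) (D : ℝ) : Prop :=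
  (∀ t a, P⟦{ω | B.action ψ t ω = a ∧ a ∈ B.tested ψ t ω} | B.histSigma ψ t⟧
    =ᵐ[P] P⟦{ω | B.satAction D ω = a ∧ a ∈ B.tested ψ t ω} | B.histSigma ψ t⟧) ∧
  (∀ t, ∀ᵐ ω ∂P, B.action ψ t ω ∉ B.tested ψ t ω →
    B.action ψ t ω = sInf {a : ℕ | a ∉ B.tested ψ t ω})

/-- Satisficing Thompson sampling with respect to `Ã`, in either of its two forms, which differ
only in how the probability of playing an untested arm is spread over the untested arms. -/
def IsSTS (B : NoisyBandit Ω 𝒲 Ξ P) (ψ : Policy Ξ) (D : ℝ) : Prop :=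
  B.IsProbabilityMatching ψ D ∨ B.IsSequentialMatching ψ D

/-- Expected discounted satisficing regret at level `D`. -/
def sRegret (B : NoisyBandit Ω 𝒲 Ξ P) (α : ℝ) (ψ : Policy Ξ) (D : ℝ) : ℝ :=
  ∫ ω, ∑' t : ℕ, α ^ t * (B.Rstar - D - B.reward ψ t ω) ∂P

/-- The discounted information ratio
`Γ(Ã, ψ) = (1 - α²) ∑ₜ α²ᵗ (E[R̃ - R_t])² / I(Ã; (A_t, Y_t) | H_{t-1})`, where `R̃ = θ_Ã`.
A ratio with positive numerator and zero denominator counts as `∞`, and `0 / 0 = 0`. -/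
def infoRatio [IsProbabilityMeasure P] (B : NoisyBandit Ω 𝒲 Ξ P) (α : ℝ) (ψ : Policy Ξ)
    (D : ℝ) : ℝ≥0∞ :=
  ENNReal.ofReal (1 - α ^ 2) * ∑' t : ℕ, ENNReal.ofReal (α ^ (2 * t)) *
    (ENNReal.ofReal ((∫ ω, (B.θ (B.satAction D ω) ω - B.reward ψ t ω) ∂P) ^ 2) /
      condMutualInfo P (B.satAction D) (fun ω => (B.action ψ t ω, B.reward ψ t ω))
        (B.history ψ t))

end NoisyBandit

/-- The bound on the discounted information ratio. -/
def infoRatioBound (δ α : ℝ) : ℝ := 6 + 4 / δ + (2 / δ) * Real.log (1 / (1 - α ^ 2))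

/-- The explicit bound on satisficing regret. -/
def regretBound (δ α : ℝ) : ℝ :=
  min (Real.sqrt (infoRatioBound δ α * (1 + Real.log (1 / δ)) / (1 - α ^ 2))) (1 / (1 - α))

/-- The simplified rate `min {√((1/δ)/(1-α)), 1/(1-α)}`. -/
def regretRate (δ α : ℝ) : ℝ := min (Real.sqrt ((1 / δ) / (1 - α))) (1 / (1 - α))

end

/-! Condition on a history before period `t`. Let `T` be the set of tested arms, `p a` the
conditional probability that the satisficing action is `a`, and `π a` that of playing `a`. As `ξ` is
independent of the bandit, the action is conditionally independent of the mean rewards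
(`exists_action_probability`). The mean of an untested arm keeps its prior law and is independent of
the other means (`ae_untested`), so that off `T` the atom `p a` is the fraction `δ` of the tail of
`p` from `a` on.

Put `Z = ∑ p a` and `V = ∑ π a * p a`, both over untested arms. The conditional one-step regret is
the difference of the integrals of one test function under the joint law of the satisficing action
and the observation, and under the product of their marginals. The function lives where the arm
played is the satisficing one; there it is the centred reward times `1 / p a` for tested `a` and
times `Z / V` for untested `a`. On `T` the identity `π a = p a` makes each arm contribute its own
regret; off `T` all arms are alike, so only the total has to be right. A Hellinger-type inequality
(`sq_integral_sub_integral_le_klDiv`) bounds the squared difference by the divergence times second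
moments, and these are at most `(|T| + Z² / V) / 4`. Both forms of STS satisfy `V ≥ δ Z² / 2`. Thus
the squared regret is at most `|T| + 2 / δ` times the information (`sq_le_mul_klDiv_of_matching`).

The same `V` is the conditional probability of playing the satisficing action while it is untested.
So the probability `e t` that it is untested drops by at least `δ (e t)² / 2` per period, whence `e
t ≤ 1 / (1 + δ t / 2)`. Matching on `T` also makes `e t` the probability of trying a new arm; hence
the expected size of `T` is at most a harmonic sum, whose `α²`-discounted total yields the logarithm
in the information ratio.

The information gains sum to at most the entropy of the satisficing action
(`tsum_condMutualInfo_le`), which is geometric with parameter `δ`. Cauchy-Schwarz over periods then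
bounds the regret; the alternative `1 / (1 - α)` needs only `R* ≤ 1` and nonnegative rewards. -/

noncomputable section

/-! ### Divergence and differences of means -/

/-- The Cauchy-Schwarz inequality for real integrals. -/
lemma sq_integral_mul_le {X : Type*} [MeasurableSpace X] {μ : Measure X} {f g : X → ℝ}
    (hf : Integrable (fun x => f x ^ 2) μ) (hg : Integrable (fun x => g x ^ 2) μ)
    (hfg : Integrable (fun x => f x * g x) μ) :
    (∫ x, f x * g x ∂μ) ^ 2 ≤ (∫ x, f x ^ 2 ∂μ) * ∫ x, g x ^ 2 ∂μ := by
  -- This quadratic in `s` is the integral of `(s f + g)²`; its discriminant is therefore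
  -- nonpositive.
  have h : ∀ s : ℝ, 0 ≤ (∫ x, f x ^ 2 ∂μ) * (s * s) + (2 * ∫ x, f x * g x ∂μ) * s
      + ∫ x, g x ^ 2 ∂μ := by
    intro s
    have h1 : 0 ≤ ∫ x, (s * f x + g x) ^ 2 ∂μ := integral_nonneg fun x => sq_nonneg _
    have h2 : ∀ x, (s * f x + g x) ^ 2
        = (s * s) * f x ^ 2 + (2 * s) * (f x * g x) + g x ^ 2 := fun x => by ring
    simp_rw [h2] at h1
    have h3 : Integrable (fun x => (s * s) * f x ^ 2 + (2 * s) * (f x * g x)) μ :=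
      (hf.const_mul _).add (hfg.const_mul _)
    rw [integral_add h3 hg,
      integral_add (hf.const_mul _) (hfg.const_mul _), integral_const_mul,
      integral_const_mul] at h1
    linarith
  have := discrim_le_zero h
  rw [discrim] at this
  nlinarith

-- With `s = √x`, the right side minus the left side is `2 s * klFun s`, which is nonnegative.
-- Integrated, this says that the divergence dominates the squared Hellinger distance.
open InformationTheory in
lemma sq_sqrt_sub_one_le_klFun {x : ℝ} (hx : 0 ≤ x) : (√x - 1) ^ 2 ≤ klFun x := by
  have h1 := klFun_nonneg (Real.sqrt_nonneg x)
  have h2 := Real.sq_sqrt hx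
  rw [klFun_apply] at h1 ⊢
  rcases hx.eq_or_lt with rfl | hx
  · simp
  · have h3 : Real.log x = 2 * Real.log √x := by
      rw [Real.log_sqrt hx.le]; ring
    have := mul_nonneg (Real.sqrt_nonneg x) h1
    rw [h3]
    set s := √x
    rw [← h2]
    nlinarith

open InformationTheory in
/-- The difference of the means of a bounded function under two probability measures is controlled
by the Kullback-Leibler divergence and the second moments. -/
lemma sq_integral_sub_integral_le_klDiv {X : Type*} [MeasurableSpace X] {μ ν : Measure X}
    [IsProbabilityMeasure μ] [IsProbabilityMeasure ν] {f : X → ℝ} (hf : Measurable f) {C : ℝ}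
    (hC : ∀ x, |f x| ≤ C) (hfin : klDiv μ ν ≠ ∞) :
    (∫ x, f x ∂μ - ∫ x, f x ∂ν) ^ 2
      ≤ 2 * (klDiv μ ν).toReal * (∫ x, f x ^ 2 ∂μ + ∫ x, f x ^ 2 ∂ν) := by
  obtain ⟨hac, hint⟩ := klDiv_ne_top_iff.1 hfin
  have hkl : (klDiv μ ν).toReal = ∫ x, klFun (μ.rnDeriv ν x).toReal ∂ν :=
    toReal_klDiv_eq_integral_klFun hac
  have hkli : Integrable (fun x => klFun (μ.rnDeriv ν x).toReal) ν :=
    (integrable_klFun_rnDeriv_iff hac).2 hint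
  set l : X → ℝ := fun x => (μ.rnDeriv ν x).toReal with hl
  have hlm : Measurable l := (Measure.measurable_rnDeriv μ ν).ennreal_toReal
  have hl0 : ∀ x, 0 ≤ l x := fun x => ENNReal.toReal_nonneg
  have hli : Integrable l ν := Measure.integrable_toReal_rnDeriv
  have hmul : ∀ h : X → ℝ, ∫ x, l x * h x ∂ν = ∫ x, h x ∂μ := fun h => by
    simpa [smul_eq_mul] using integral_rnDeriv_smul (f := h) hac
  have hfs : ∀ x, ‖f x‖ ≤ C := fun x => by rw [Real.norm_eq_abs]; exact hC x
  have hf2s : ∀ x, ‖f x ^ 2‖ ≤ C ^ 2 := fun x => by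
    rw [Real.norm_eq_abs, abs_pow]
    exact pow_le_pow_left₀ (abs_nonneg _) (hC x) 2
  have hflm : Integrable (fun x => l x * f x) ν := by
    simpa [mul_comm] using hli.bdd_mul hf.aestronglyMeasurable (Filter.Eventually.of_forall hfs)
  have hf2lm : Integrable (fun x => l x * f x ^ 2) ν := by
    simpa [mul_comm] using
      hli.bdd_mul (hf.pow_const 2).aestronglyMeasurable (Filter.Eventually.of_forall hf2s)
  have hfi : Integrable f ν :=
    Integrable.of_bound hf.aestronglyMeasurable C (Filter.Eventually.of_forall hfs)
  have hf2i : Integrable (fun x => f x ^ 2) ν :=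
    Integrable.of_bound (hf.pow_const 2).aestronglyMeasurable (C ^ 2)
      (Filter.Eventually.of_forall hf2s)
  have hs : ∀ x, √(l x) ^ 2 = l x := fun x => Real.sq_sqrt (hl0 x)
  have hU : Integrable (fun x => 2 * (l x * f x ^ 2) + 2 * f x ^ 2) ν :=
    (hf2lm.const_mul 2).add (hf2i.const_mul 2)
  -- Factor `(l - 1) f = f (√l + 1) * (√l - 1)` and apply Cauchy-Schwarz: the first factor costs
  -- second moments through `(√l + 1)² ≤ 2 l + 2`, the second costs the divergence.
  have hu_le : ∀ x, (f x * (√(l x) + 1)) ^ 2 ≤ 2 * (l x * f x ^ 2) + 2 * f x ^ 2 := fun x => by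
    have h1 := hs x
    have h2 : 0 ≤ f x ^ 2 * (√(l x) - 1) ^ 2 := by positivity
    nlinarith
  have hu : Integrable (fun x => (f x * (√(l x) + 1)) ^ 2) ν := by
    refine hU.mono' (by fun_prop) (Filter.Eventually.of_forall fun x => ?_)
    rw [Real.norm_of_nonneg (sq_nonneg _)]
    exact hu_le x
  have hv : Integrable (fun x => (√(l x) - 1) ^ 2) ν := by
    refine hkli.mono' (by fun_prop) (Filter.Eventually.of_forall fun x => ?_)
    rw [Real.norm_of_nonneg (sq_nonneg _)]
    exact sq_sqrt_sub_one_le_klFun (hl0 x)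
  have huv : ∀ x, (f x * (√(l x) + 1)) * (√(l x) - 1) = l x * f x - f x := fun x => by
    have h1 := hs x
    linear_combination f x * h1
  have hcs := sq_integral_mul_le hu hv (by simp_rw [huv]; exact hflm.sub hfi)
  simp_rw [huv] at hcs
  rw [integral_sub hflm hfi, hmul] at hcs
  have hu' : ∫ x, (f x * (√(l x) + 1)) ^ 2 ∂ν ≤ 2 * (∫ x, f x ^ 2 ∂μ + ∫ x, f x ^ 2 ∂ν) := by
    refine (integral_mono hu hU hu_le).trans_eq ?_
    rw [integral_add (hf2lm.const_mul 2) (hf2i.const_mul 2), integral_const_mul,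
      integral_const_mul, hmul (fun x => f x ^ 2)]
    ring
  have hv' : ∫ x, (√(l x) - 1) ^ 2 ∂ν ≤ (klDiv μ ν).toReal := by
    rw [hkl]
    exact integral_mono hv hkli fun x => sq_sqrt_sub_one_le_klFun (hl0 x)
  have h0 : 0 ≤ ∫ x, f x ^ 2 ∂μ := integral_nonneg fun x => sq_nonneg _
  have h0' : 0 ≤ ∫ x, f x ^ 2 ∂ν := integral_nonneg fun x => sq_nonneg _
  calc _ ≤ _ := hcs
    _ ≤ (2 * (∫ x, f x ^ 2 ∂μ + ∫ x, f x ^ 2 ∂ν)) * (klDiv μ ν).toReal :=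
      mul_le_mul hu' hv' (integral_nonneg fun x => sq_nonneg _) (by positivity)
    _ = _ := by ring

/-! ### Entropy of discrete laws -/

/-- The entropy of a law on `ℕ`. -/
def massEntropy (ν : Measure ℕ) : ℝ≥0∞ := ∑' a, ENNReal.ofReal (Real.negMulLog (ν.real {a}))

lemma measurable_massEntropy_kernel {T : Type*} [MeasurableSpace T] (k : Kernel T ℕ) :
    Measurable fun z => massEntropy (k z) := by
  refine Measurable.tsum fun a => ?_
  have : Measurable fun z => (k z).real {a} :=
    (k.measurable_coe (measurableSet_singleton a)).ennreal_toReal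
  exact (Real.continuous_negMulLog.measurable.comp this).ennreal_ofReal

/-- Because the second coordinate is discrete, the density can be read off atom by atom. An atom
that is null for the mixture is null for almost every member, so the value `0 / 0 = 0` does no harm.
-/
lemma compProd_eq_withDensity_atoms {T : Type*} [MeasurableSpace T] (μ : Measure T)
    [IsProbabilityMeasure μ] (k : Kernel T ℕ) [IsMarkovKernel k] :
    μ ⊗ₘ k = (μ.prod (k ∘ₘ μ)).withDensity fun p => k p.1 {p.2} / (k ∘ₘ μ) {p.2} := by
  have hkm : Measurable fun p : T × ℕ => k p.1 {p.2} :=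
    measurable_from_prod_countable_left fun a => k.measurable_coe (measurableSet_singleton a)
  have hm : Measurable fun p : T × ℕ => k p.1 {p.2} / (k ∘ₘ μ) {p.2} :=
    hkm.div ((measurable_of_countable fun a => (k ∘ₘ μ) {a}).comp measurable_snd)
  have hb : ∀ a, (k ∘ₘ μ) {a} = ∫⁻ z, k z {a} ∂μ := fun a =>
    Measure.bind_apply (measurableSet_singleton a) k.aemeasurable
  have hz : ∀ᵐ z ∂μ, ∀ a, k z {a} / (k ∘ₘ μ) {a} * (k ∘ₘ μ) {a} = k z {a} := by
    rw [ae_all_iff]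
    intro a
    by_cases h0 : (k ∘ₘ μ) {a} = 0
    · have := h0
      rw [hb, lintegral_eq_zero_iff (k.measurable_coe (measurableSet_singleton a))] at this
      filter_upwards [this] with z hz
      simp only [Pi.zero_apply] at hz
      simp [h0, hz]
    · exact Filter.Eventually.of_forall fun z => ENNReal.div_mul_cancel h0 (measure_ne_top _ _)
  ext s hs
  rw [Measure.compProd_apply hs, withDensity_apply _ hs, ← lintegral_indicator hs,
    lintegral_prod _ (hm.indicator hs).aemeasurable]
  refine lintegral_congr_ae ?_
  filter_upwards [hz] with z hz
  rw [lintegral_countable', ← Measure.tsum_indicator_apply_singleton _ _ (measurable_prodMk_left hs)]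
  refine tsum_congr fun a => ?_
  by_cases ha : (z, a) ∈ s
  · rw [Set.indicator_of_mem (by exact ha), Set.indicator_of_mem (by exact ha), hz]
  · rw [Set.indicator_of_notMem (by exact ha), Set.indicator_of_notMem (by exact ha), zero_mul]

-- Write `y` for the mass of the atom under `k z` and `x` for its mass under the mixture. The
-- integrand collapses to `y * (-log x) + (x - y)`, and `y` averages to `x`. Working with one atom
-- at a time avoids any finiteness assumption on the entropy.
open InformationTheory in
lemma lintegral_klFun_atom_add_le {T : Type*} [MeasurableSpace T]
    (μ : Measure T) [IsProbabilityMeasure μ] (k : Kernel T ℕ) [IsMarkovKernel k] (a : ℕ) :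
    ∫⁻ z, (ENNReal.ofReal (klFun (k z {a} / (k ∘ₘ μ) {a}).toReal) * (k ∘ₘ μ) {a}
      + ENNReal.ofReal (Real.negMulLog ((k z).real {a}))) ∂μ
      ≤ ENNReal.ofReal (Real.negMulLog ((k ∘ₘ μ).real {a})) := by
  have hkr : Measurable fun z => (k z).real {a} :=
    (k.measurable_coe (measurableSet_singleton a)).ennreal_toReal
  set x : ℝ := (k ∘ₘ μ).real {a} with hx
  have hx0 : 0 ≤ x := measureReal_nonneg
  have hx1 : x ≤ 1 := measureReal_le_one
  have hxi : ∫ z, (k z).real {a} ∂μ = x := by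
    rw [hx, measureReal_def, Measure.bind_apply (measurableSet_singleton a) k.aemeasurable]
    exact integral_toReal (k.measurable_coe (measurableSet_singleton a)).aemeasurable
      (Filter.Eventually.of_forall fun z => measure_lt_top _ _)
  have hki : Integrable (fun z => (k z).real {a}) μ :=
    Integrable.of_bound hkr.aestronglyMeasurable 1 (Filter.Eventually.of_forall fun z => by
      rw [Real.norm_of_nonneg measureReal_nonneg]; exact measureReal_le_one)
  rcases hx0.eq_or_lt with h0 | hpos
  · have hk0 : (fun z => (k z).real {a}) =ᵐ[μ] 0 := by
      rw [← integral_eq_zero_iff_of_nonneg (fun z => measureReal_nonneg) hki, hxi, h0]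
    have : (k ∘ₘ μ) {a} = 0 := by
      rw [hx, measureReal_def] at h0
      exact ((ENNReal.toReal_eq_zero_iff _).1 h0.symm).resolve_right (measure_ne_top _ _)
    rw [this, lintegral_congr_ae (g := fun _ => 0)]
    · simp
    · filter_upwards [hk0] with z hz
      simp only [Pi.zero_apply] at hz
      simp [hz]
  have hae : ∀ z, ENNReal.ofReal (klFun (k z {a} / (k ∘ₘ μ) {a}).toReal) * (k ∘ₘ μ) {a}
      + ENNReal.ofReal (Real.negMulLog ((k z).real {a}))
      = ENNReal.ofReal ((k z).real {a} * (- Real.log x) + (x - (k z).real {a})) := by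
    intro z
    set y := (k z).real {a} with hy
    have hy0 : 0 ≤ y := measureReal_nonneg
    have hy1 : y ≤ 1 := measureReal_le_one
    have e1 : (k ∘ₘ μ) {a} = ENNReal.ofReal x := (ofReal_measureReal (measure_ne_top _ _)).symm
    rw [ENNReal.toReal_div, ← measureReal_def, ← measureReal_def, ← hx, ← hy, e1,
      ← ENNReal.ofReal_mul (klFun_nonneg (by positivity)),
      ← ENNReal.ofReal_add (mul_nonneg (klFun_nonneg (by positivity)) hx0)
        (Real.negMulLog_nonneg hy0 hy1)]
    congr 1
    rw [klFun_apply, Real.negMulLog]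
    rcases hy0.eq_or_lt with h | hypos
    · rw [← h]; simp
    · rw [Real.log_div hypos.ne' hpos.ne']
      field_simp
      ring
  simp_rw [hae]
  -- Since `-log x ≥ 1 - x`, the expression is at least `x * (1 - y)`.
  have hF : ∀ z, 0 ≤ (k z).real {a} * (- Real.log x) + (x - (k z).real {a}) := by
    intro z
    have hy0 : 0 ≤ (k z).real {a} := measureReal_nonneg
    have hlog : 1 - x ≤ - Real.log x := by linarith [Real.log_le_sub_one_of_pos hpos]
    have hy1 : (k z).real {a} ≤ 1 := measureReal_le_one
    nlinarith
  have hFi : Integrable (fun z => (k z).real {a} * (- Real.log x) + (x - (k z).real {a})) μ :=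
    (hki.mul_const _).add ((integrable_const x).sub hki)
  rw [← ofReal_integral_eq_lintegral_ofReal hFi (Filter.Eventually.of_forall hF)]
  refine ENNReal.ofReal_le_ofReal ?_
  rw [integral_add (hki.mul_const _) (by exact (integrable_const x).sub hki), integral_mul_const,
    integral_sub (integrable_const x) hki, hxi, Real.negMulLog]
  simp

open InformationTheory in
/-- Conditioning lowers the entropy of a discrete law by the mutual information. -/
lemma klDiv_compProd_prod_add_lintegral_massEntropy_le {T : Type*} [MeasurableSpace T]
    (μ : Measure T) [IsProbabilityMeasure μ] (k : Kernel T ℕ) [IsMarkovKernel k] :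
    klDiv (μ ⊗ₘ k) (μ.prod (k ∘ₘ μ)) + ∫⁻ z, massEntropy (k z) ∂μ ≤ massEntropy (k ∘ₘ μ) := by
  have hkm : Measurable fun p : T × ℕ => k p.1 {p.2} :=
    measurable_from_prod_countable_left fun a => k.measurable_coe (measurableSet_singleton a)
  have hm : Measurable fun p : T × ℕ => k p.1 {p.2} / (k ∘ₘ μ) {p.2} :=
    hkm.div ((measurable_of_countable fun a => (k ∘ₘ μ) {a}).comp measurable_snd)
  have hd := compProd_eq_withDensity_atoms μ k
  have hac : μ ⊗ₘ k ≪ μ.prod (k ∘ₘ μ) := by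
    rw [hd]; exact withDensity_absolutelyContinuous _ _
  have hrn : (μ ⊗ₘ k).rnDeriv (μ.prod (k ∘ₘ μ)) =ᵐ[μ.prod (k ∘ₘ μ)]
      fun p => k p.1 {p.2} / (k ∘ₘ μ) {p.2} := by
    have := Measure.rnDeriv_withDensity (μ.prod (k ∘ₘ μ)) hm
    rwa [← hd] at this
  have hkr : ∀ a, Measurable fun z => (k z).real {a} := fun a =>
    (k.measurable_coe (measurableSet_singleton a)).ennreal_toReal
  have hent : ∀ a, Measurable fun z => ENNReal.ofReal (Real.negMulLog ((k z).real {a})) :=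
    fun a => (Real.continuous_negMulLog.measurable.comp (hkr a)).ennreal_ofReal
  obtain ⟨G, hGdef⟩ : ∃ G : T → ℕ → ℝ≥0∞, ∀ z a,
      G z a = ENNReal.ofReal (klFun (k z {a} / (k ∘ₘ μ) {a}).toReal) := ⟨_, fun _ _ => rfl⟩
  have hG : Measurable fun p : T × ℕ => G p.1 p.2 := by
    simp only [hGdef]
    exact (measurable_klFun.comp hm.ennreal_toReal).ennreal_ofReal
  have hGa : ∀ a, Measurable fun z => G z a := fun a => hG.comp measurable_prodMk_right
  have h1 : klDiv (μ ⊗ₘ k) (μ.prod (k ∘ₘ μ)) = ∫⁻ p, G p.1 p.2 ∂(μ.prod (k ∘ₘ μ)) := by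
    rw [klDiv_eq_lintegral_klFun_of_ac hac]
    exact lintegral_congr_ae (hrn.mono fun p hp => by simp only [hp, hGdef])
  have h2 : klDiv (μ ⊗ₘ k) (μ.prod (k ∘ₘ μ)) = ∑' a, ∫⁻ z, G z a * (k ∘ₘ μ) {a} ∂μ := by
    rw [h1, lintegral_prod _ hG.aemeasurable, ← lintegral_tsum
      fun a => ((hGa a).mul_const _).aemeasurable]
    exact lintegral_congr fun z => lintegral_countable' _
  have h3 : ∫⁻ z, massEntropy (k z) ∂μ
      = ∑' a, ∫⁻ z, ENNReal.ofReal (Real.negMulLog ((k z).real {a})) ∂μ := by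
    rw [← lintegral_tsum fun a => (hent a).aemeasurable]
    rfl
  rw [h2, h3, ← ENNReal.tsum_add]
  refine ENNReal.tsum_le_tsum fun a => ?_
  rw [← lintegral_add_left ((hGa a).mul_const _)]
  simp only [hGdef]
  exact lintegral_klFun_atom_add_le μ k a

/-! ### Conditional entropy and the chain of information gains -/

section ConditionalEntropy

variable {Ω : Type*} [MeasurableSpace Ω] {T U : Type*} [MeasurableSpace T]
  [MeasurableSpace U]

/-- The conditional entropy of a discrete random variable. -/
def condMassEntropy (P : Measure Ω) [IsFiniteMeasure P] (X : Ω → ℕ) (H : Ω → U) : ℝ≥0∞ :=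
  ∫⁻ h, massEntropy (condDistrib X H P h) ∂(P.map H)

open InformationTheory in
lemma klDiv_map_swap_le {S T : Type*} [MeasurableSpace S] [MeasurableSpace T]
    (ρ : Measure (T × S)) [IsProbabilityMeasure ρ] (μ : Measure T) (ν : Measure S)
    [IsProbabilityMeasure μ] [IsProbabilityMeasure ν] :
    klDiv (ρ.map Prod.swap) (ν.prod μ) ≤ klDiv ρ (μ.prod ν) := by
  rw [← Measure.prod_swap]
  exact klDiv_map_le _ _ measurable_swap

lemma condMassEntropy_eq_tsum {P : Measure Ω} [IsProbabilityMeasure P] {X : Ω → ℕ} {H : Ω → U}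
    (hX : Measurable X) (hH : Measurable H) :
    condMassEntropy P X H = ∑' a, ∫⁻ ω, ENNReal.ofReal
      (Real.negMulLog ((P⟦X ⁻¹' {a} | MeasurableSpace.comap H inferInstance⟧) ω)) ∂P := by
  rw [condMassEntropy, lintegral_map (measurable_massEntropy_kernel _) hH]
  simp only [massEntropy]
  rw [lintegral_tsum]
  · refine tsum_congr fun a => lintegral_congr_ae ?_
    filter_upwards [condDistrib_ae_eq_condExp (μ := P) hH hX (measurableSet_singleton a)]
      with ω hω
    simp only [← hω]
  · intro a
    have : Measurable fun ω => (condDistrib X H P (H ω)).real {a} :=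
      (((condDistrib X H P).measurable_coe (measurableSet_singleton a)).comp hH).ennreal_toReal
    exact ((Real.continuous_negMulLog.measurable.comp this).ennreal_ofReal).aemeasurable

/-- Conditional probabilities depend on the condition only through its σ-algebra. This identifies
conditioning on the history of length `t + 1` with conditioning on the pair (history of length `t`,
new observation), although the two take values in different types. -/
lemma condMassEntropy_congr {V : Type*} [MeasurableSpace V] {P : Measure Ω}
    [IsProbabilityMeasure P] {X : Ω → ℕ} {H : Ω → U} {H' : Ω → V} (hX : Measurable X)
    (hH : Measurable H) (hH' : Measurable H')
    (h : MeasurableSpace.comap H inferInstance = MeasurableSpace.comap H' inferInstance) :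
    condMassEntropy P X H = condMassEntropy P X H' := by
  rw [condMassEntropy_eq_tsum hX hH, condMassEntropy_eq_tsum hX hH', h]

lemma condMassEntropy_le {P : Measure Ω} [IsProbabilityMeasure P] {X : Ω → ℕ} {H : Ω → U}
    (hX : Measurable X) (hH : Measurable H) :
    condMassEntropy P X H ≤ massEntropy (P.map X) := by
  have : IsProbabilityMeasure (P.map H) := Measure.isProbabilityMeasure_map hH.aemeasurable
  have h := klDiv_compProd_prod_add_lintegral_massEntropy_le (P.map H) (condDistrib X H P)
  rw [condDistrib_comp_map hH.aemeasurable hX.aemeasurable] at h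
  exact le_add_self.trans h

lemma mutualInfo_le_massEntropy {P : Measure Ω} [IsProbabilityMeasure P] {X : Ω → ℕ} {H : Ω → U}
    (hX : Measurable X) (hH : Measurable H) :
    mutualInfo P X H ≤ massEntropy (P.map X) := by
  have : IsProbabilityMeasure (P.map H) := Measure.isProbabilityMeasure_map hH.aemeasurable
  have : IsProbabilityMeasure (P.map X) := Measure.isProbabilityMeasure_map hX.aemeasurable
  have h := klDiv_compProd_prod_add_lintegral_massEntropy_le (P.map H) (condDistrib X H P)
  rw [condDistrib_comp_map hH.aemeasurable hX.aemeasurable] at h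
  refine le_trans ?_ (le_self_add.trans h)
  have e : P.map (fun ω => (X ω, H ω)) = (P.map H ⊗ₘ condDistrib X H P).map Prod.swap := by
    rw [compProd_map_condDistrib hX.aemeasurable, Measure.map_map measurable_swap (hH.prodMk hX)]
    rfl
  rw [mutualInfo, e]
  exact klDiv_map_swap_le _ _ _

/-- Further conditioning lowers the conditional entropy by at least the conditional mutual
information. -/
lemma condMutualInfo_add_condMassEntropy_le [StandardBorelSpace T] [Nonempty T] {P : Measure Ω}
    [IsProbabilityMeasure P] {X : Ω → ℕ} {Z : Ω → T} {H : Ω → U} (hX : Measurable X)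
    (hZ : Measurable Z) (hH : Measurable H) :
    condMutualInfo P X Z H + condMassEntropy P X (fun ω => (H ω, Z ω))
      ≤ condMassEntropy P X H := by
  have : IsProbabilityMeasure (P.map H) := Measure.isProbabilityMeasure_map hH.aemeasurable
  set ν := condDistrib Z H P with hν
  set k := condDistrib X (fun ω => (H ω, Z ω)) P with hk
  -- Given `H`, draw `Z` and then `X` from its law given both. For fixed `h` this reduces the claim
  -- to the unconditional inequality applied to the section of `k` at `h`.
  have hjoint : condDistrib (fun ω => (Z ω, X ω)) H P =ᵐ[P.map H] ν ⊗ₖ k := by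
    refine condDistrib_ae_eq_of_measure_eq_compProd H (hZ.prodMk hX).aemeasurable ?_
    rw [← Measure.compProd_assoc', compProd_map_condDistrib hZ.aemeasurable,
      compProd_map_condDistrib hX.aemeasurable,
      Measure.map_map MeasurableEquiv.prodAssoc.measurable ((hH.prodMk hZ).prodMk hX)]
    rfl
  have hswap : condDistrib (fun ω => (X ω, Z ω)) H P =ᵐ[P.map H]
      (condDistrib (fun ω => (Z ω, X ω)) H P).map Prod.swap :=
    condDistrib_comp H (hZ.prodMk hX).aemeasurable measurable_swap
  have hsnd : condDistrib X H P =ᵐ[P.map H]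
      (condDistrib (fun ω => (Z ω, X ω)) H P).map Prod.snd :=
    condDistrib_comp H (hZ.prodMk hX).aemeasurable measurable_snd
  have hle : ∀ᵐ h ∂(P.map H), InformationTheory.klDiv (condDistrib (fun ω => (X ω, Z ω)) H P h)
      ((condDistrib X H P h).prod (condDistrib Z H P h)) + ∫⁻ z, massEntropy (k (h, z)) ∂(ν h)
      ≤ massEntropy (condDistrib X H P h) := by
    filter_upwards [hjoint, hswap, hsnd] with h h1 h2 h3
    rw [h2, h3, Kernel.map_apply _ measurable_swap, Kernel.map_apply _ measurable_snd, h1,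
      Kernel.compProd_apply_eq_compProd_sectR, ← hν]
    have h4 : (ν h ⊗ₘ k.sectR h).map Prod.snd = k.sectR h ∘ₘ ν h := Measure.snd_compProd _ _
    rw [h4]
    refine le_trans (add_le_add_left (klDiv_map_swap_le _ _ _) _) ?_
    exact klDiv_compProd_prod_add_lintegral_massEntropy_le (ν h) (k.sectR h)
  have h5 := lintegral_mono_ae hle
  have h6 : condMassEntropy P X (fun ω => (H ω, Z ω))
      = ∫⁻ h, ∫⁻ z, massEntropy (k (h, z)) ∂(ν h) ∂(P.map H) := by
    rw [condMassEntropy, ← compProd_map_condDistrib hZ.aemeasurable,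
      Measure.lintegral_compProd (measurable_massEntropy_kernel _)]
  rw [lintegral_add_right] at h5
  · rw [h6]; exact h5
  · exact (measurable_massEntropy_kernel k).lintegral_kernel_prod_right'

/-- The total information that a sequence of observations gives about a discrete random variable
is at most its entropy. -/
lemma tsum_condMutualInfo_le [StandardBorelSpace T] [Nonempty T] {P : Measure Ω}
    [IsProbabilityMeasure P] {X : Ω → ℕ} {V : ℕ → Type*} [∀ t, MeasurableSpace (V t)]
    {Z : ℕ → Ω → T} {H : (t : ℕ) → Ω → V t} (hX : Measurable X) (hZ : ∀ t, Measurable (Z t))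
    (hH : ∀ t, Measurable (H t))
    (h : ∀ t, MeasurableSpace.comap (H (t + 1)) inferInstance
      = MeasurableSpace.comap (fun ω => (H t ω, Z t ω)) inferInstance) :
    ∑' t, condMutualInfo P X (Z t) (H t) ≤ massEntropy (P.map X) := by
  refine ENNReal.tsum_le_of_sum_range_le fun n => ?_
  -- The remaining conditional entropy is kept on the left so that the induction telescopes; it is
  -- dropped only at the end.
  have key : ∑ t ∈ Finset.range n, condMutualInfo P X (Z t) (H t) + condMassEntropy P X (H n)
      ≤ massEntropy (P.map X) := by
    induction n with
    | zero => simpa using condMassEntropy_le hX (hH 0)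
    | succ n ih =>
      rw [Finset.sum_range_succ, condMassEntropy_congr hX (hH _) ((hH n).prodMk (hZ n)) (h n),
        add_assoc]
      exact (add_le_add_right (condMutualInfo_add_condMassEntropy_le hX (hZ n) (hH n)) _).trans ih
  exact le_self_add.trans key

end ConditionalEntropy

/-! ### Independence of the primitives -/

section Independence

variable {Ω : Type*} [MeasurableSpace Ω] {P : Measure Ω}

lemma indepFun_prodMk_of_indepFun [IsProbabilityMeasure P] {S T U : Type*} [MeasurableSpace S] [MeasurableSpace T]
    [MeasurableSpace U] {X : Ω → S} {Y : Ω → T} {Z : Ω → U} (hX : Measurable X)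
    (hY : Measurable Y) (hZ : Measurable Z) (h : IndepFun X (fun ω => (Y ω, Z ω)) P)
    (hYZ : IndepFun Y Z P) : IndepFun (fun ω => (X ω, Y ω)) Z P := by
  have : IsProbabilityMeasure (P.map X) := Measure.isProbabilityMeasure_map hX.aemeasurable
  have : IsProbabilityMeasure (P.map Y) := Measure.isProbabilityMeasure_map hY.aemeasurable
  have : IsProbabilityMeasure (P.map Z) := Measure.isProbabilityMeasure_map hZ.aemeasurable
  have hXY : IndepFun X Y P := h.comp measurable_id measurable_fst
  rw [indepFun_iff_map_prod_eq_prod_map_map (by fun_prop) (by fun_prop)] at *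
  rw [hXY]
  refine MeasurableEquiv.prodAssoc.map_measurableEquiv_injective ?_
  rw [Measure.prodAssoc_prod, ← hYZ, ← h,
    Measure.map_map MeasurableEquiv.prodAssoc.measurable ((hX.prodMk hY).prodMk hZ)]
  rfl

/-- Overwriting coordinate `i` by a constant encodes "all the other coordinates" without leaving the
type `ℕ → S`, so that functions of the full sequence can still be applied. -/
lemma indepFun_update {S : Type*} [MeasurableSpace S] {X : ℕ → Ω → S}
    (hX : ∀ i, Measurable (X i)) (h : iIndepFun X P) (i : ℕ) (c : S) :
    IndepFun (fun ω => Function.update (fun j => X j ω) i c) (X i) P := by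
  have h1 := indep_iSup_of_disjoint (fun j => (hX j).comap_le) h
    (S := {i}ᶜ) (T := {i}) (disjoint_compl_left)
  rw [IndepFun_iff_Indep]
  refine indep_of_indep_of_le_left (indep_of_indep_of_le_right h1 ?_) ?_
  · exact le_iSup₂_of_le i rfl le_rfl
  · simp only [MeasurableSpace.pi, MeasurableSpace.comap_iSup, MeasurableSpace.comap_comp]
    refine iSup_le fun j => ?_
    by_cases hj : j = i
    · subst hj
      have : (fun b : ℕ → S => b j) ∘ (fun ω => Function.update (fun l => X l ω) j c)
          = fun _ => c := by
        funext ω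
        simp
      rw [this, MeasurableSpace.comap_const]
      exact bot_le
    · have : (fun b : ℕ → S => b j) ∘ (fun ω => Function.update (fun l => X l ω) i c) = X j := by
        funext ω
        simp [hj]
      rw [this]
      exact le_iSup₂_of_le j hj le_rfl

lemma lintegral_comp_prodMk_of_indepFun [IsProbabilityMeasure P] {S T : Type*} [MeasurableSpace S] [MeasurableSpace T]
    {X : Ω → S} {Y : Ω → T} (hX : Measurable X) (hY : Measurable Y) (h : IndepFun X Y P)
    {f : S × T → ℝ≥0∞} (hf : Measurable f) :
    ∫⁻ ω, f (X ω, Y ω) ∂P = ∫⁻ ω, ∫⁻ x, f (x, Y ω) ∂(P.map X) ∂P := by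
  have : IsProbabilityMeasure (P.map X) := Measure.isProbabilityMeasure_map hX.aemeasurable
  have : IsProbabilityMeasure (P.map Y) := Measure.isProbabilityMeasure_map hY.aemeasurable
  rw [← lintegral_map hf (hX.prodMk hY),
    (indepFun_iff_map_prod_eq_prod_map_map hX.aemeasurable hY.aemeasurable).1 h,
    lintegral_prod_symm' _ hf, lintegral_map hf.lintegral_prod_left' hY]

end Independence

/-! ### Histories as functions of means, disturbances and exogenous variable -/

/-- The arms played in a history. -/
def histArms {t : ℕ} (h : Fin t → ℕ × ℝ) : Finset ℕ := Finset.univ.image fun i => (h i).1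

lemma mem_histArms {t : ℕ} {h : Fin t → ℕ × ℝ} {a : ℕ} : a ∈ histArms h ↔ ∃ i, (h i).1 = a := by
  simp [histArms]

lemma histArms_snoc {t : ℕ} (h : Fin t → ℕ × ℝ) (y : ℕ × ℝ) :
    histArms (Fin.snoc (α := fun _ => ℕ × ℝ) h y) = insert y.1 (histArms h) := by
  ext a
  simp only [mem_histArms, Finset.mem_insert]
  constructor
  · rintro ⟨i, hi⟩
    refine Fin.lastCases (fun hi => ?_) (fun i hi => ?_) i hi
    · left; simpa using hi.symm
    · right; exact ⟨i, by simpa using hi⟩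
  · rintro (rfl | ⟨i, rfl⟩)
    · exact ⟨Fin.last t, by simp⟩
    · exact ⟨i.castSucc, by simp⟩

/-- The set of arms depends on the history only through the finite sequence of actions, which
together with `S` ranges over a countable space in which every set is measurable. -/
lemma measurableSet_histArms {t : ℕ} {S : Type*} [MeasurableSpace S] [Countable S]
    [MeasurableSingletonClass S] (Q : Finset ℕ → S → Prop) :
    MeasurableSet {p : (Fin t → ℕ × ℝ) × S | Q (histArms p.1) p.2} := by
  have h : Measurable fun p : (Fin t → ℕ × ℝ) × S => ((fun i => (p.1 i).1 : Fin t → ℕ), p.2) := by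
    fun_prop
  exact h (Set.to_countable
    {q : (Fin t → ℕ) × S | Q (Finset.univ.image q.1) q.2}).measurableSet

lemma measurableSet_histArms' {t : ℕ} (Q : Finset ℕ → Prop) :
    MeasurableSet {h : Fin t → ℕ × ℝ | Q (histArms h)} := by
  have h : Measurable fun h : Fin t → ℕ × ℝ => (fun i => (h i).1 : Fin t → ℕ) := by fun_prop
  exact h (Set.to_countable {q : Fin t → ℕ | Q (Finset.univ.image q)}).measurableSet

/-- The exogenous variable is consistent with the actions recorded in a history. -/
def Policy.Consistent {Ξ : Type*} [MeasurableSpace Ξ] (ψ : Policy Ξ) {t : ℕ}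
    (h : Fin t → ℕ × ℝ) (z : Ξ) : Prop :=
  ∀ i : Fin t, ψ.act i (fun j : Fin i => h (Fin.castLE i.2.le j)) z = (h i).1

lemma Policy.measurableSet_consistent {Ξ : Type*} [MeasurableSpace Ξ] (ψ : Policy Ξ) {t : ℕ} :
    MeasurableSet {p : (Fin t → ℕ × ℝ) × Ξ | ψ.Consistent p.1 p.2} := by
  simp only [Policy.Consistent, Set.ofPred_forall]
  refine MeasurableSet.iInter fun i => measurableSet_eq_fun ?_ (by fun_prop)
  exact (ψ.measurable_act i).comp (by fun_prop :
    Measurable fun p : (Fin t → ℕ × ℝ) × Ξ => ((fun j : Fin i => p.1 (Fin.castLE i.2.le j)), p.2))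

namespace NoisyBandit

variable {Ω : Type u} {𝒲 : Type v} {Ξ : Type w} [MeasurableSpace Ω]
  [MeasurableSpace 𝒲] [MeasurableSpace Ξ] {P : Measure Ω}

/-- The vector of mean rewards. -/
def means (B : NoisyBandit Ω 𝒲 Ξ P) (ω : Ω) : ℕ → ℝ := fun a => B.θ a ω

/-- The sequence of disturbances. -/
def noise (B : NoisyBandit Ω 𝒲 Ξ P) (ω : Ω) : ℕ → 𝒲 := fun t => B.W t ω

lemma measurable_means (B : NoisyBandit Ω 𝒲 Ξ P) : Measurable B.means :=
  measurable_pi_iff.2 B.measurable_θ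

lemma measurable_noise (B : NoisyBandit Ω 𝒲 Ξ P) : Measurable B.noise :=
  measurable_pi_iff.2 B.measurable_W

/-- The history as a function of the mean rewards, the disturbances and the exogenous variable. -/
def histFun (B : NoisyBandit Ω 𝒲 Ξ P) (ψ : Policy Ξ) :
    (t : ℕ) → (ℕ → ℝ) → (ℕ → 𝒲) → Ξ → (Fin t → ℕ × ℝ)
  | 0, _, _, _ => Fin.elim0
  | t + 1, x, w, z =>
    Fin.snoc (α := fun _ => ℕ × ℝ) (histFun B ψ t x w z)
      (ψ.act t (histFun B ψ t x w z) z, B.g (ψ.act t (histFun B ψ t x w z) z)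
        (x (ψ.act t (histFun B ψ t x w z) z)) (w t))

variable (B : NoisyBandit Ω 𝒲 Ξ P) (ψ : Policy Ξ)

lemma history_eq_histFun (t : ℕ) (ω : Ω) :
    B.history ψ t ω = B.histFun ψ t (B.means ω) (B.noise ω) (B.ξ ω) := by
  induction t with
  | zero => rfl
  | succ t ih => simp only [history, histFun, ih, means, noise]

lemma history_succ (t : ℕ) (ω : Ω) : B.history ψ (t + 1) ω =
    Fin.snoc (α := fun _ => ℕ × ℝ) (B.history ψ t ω) (B.action ψ t ω, B.reward ψ t ω) := rfl

lemma measurable_playReward (t : ℕ) : Measurable fun q : ℕ × ((ℕ → ℝ) × (ℕ → 𝒲)) =>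
    B.g q.1 (q.2.1 q.1) (q.2.2 t) := by
  refine measurable_from_prod_countable_right fun a => ?_
  exact (B.measurable_g a).comp
    (by fun_prop : Measurable fun q : (ℕ → ℝ) × (ℕ → 𝒲) => (q.1 a, q.2 t))

lemma measurable_snoc (t : ℕ) : Measurable fun p : (Fin t → ℕ × ℝ) × (ℕ × ℝ) =>
    (Fin.snoc (α := fun _ => ℕ × ℝ) p.1 p.2 : Fin (t + 1) → ℕ × ℝ) := by
  refine measurable_pi_iff.2 fun i => ?_
  refine Fin.lastCases ?_ (fun i => ?_) i
  · simpa using measurable_snd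
  · simp only [Fin.snoc_castSucc]
    fun_prop

lemma measurable_histFun (t : ℕ) : Measurable fun p : ((ℕ → ℝ) × (ℕ → 𝒲)) × Ξ =>
    B.histFun ψ t p.1.1 p.1.2 p.2 := by
  induction t with
  | zero => exact measurable_const
  | succ t ih =>
    have ha : Measurable fun p : ((ℕ → ℝ) × (ℕ → 𝒲)) × Ξ =>
        ψ.act t (B.histFun ψ t p.1.1 p.1.2 p.2) p.2 :=
      (ψ.measurable_act t).comp (ih.prodMk measurable_snd)
    exact (measurable_snoc t).comp (ih.prodMk (ha.prodMk
      ((B.measurable_playReward t).comp (ha.prodMk measurable_fst))))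

lemma measurable_history (t : ℕ) : Measurable (B.history ψ t) := by
  have : B.history ψ t = fun ω => B.histFun ψ t (B.means ω) (B.noise ω) (B.ξ ω) :=
    funext (B.history_eq_histFun ψ t)
  rw [this]
  exact (B.measurable_histFun ψ t).comp
    ((B.measurable_means.prodMk B.measurable_noise).prodMk B.measurable_ξ)

lemma measurable_action (t : ℕ) : Measurable (B.action ψ t) :=
  (ψ.measurable_act t).comp ((B.measurable_history ψ t).prodMk B.measurable_ξ)

lemma measurable_reward (t : ℕ) : Measurable (B.reward ψ t) :=
  (B.measurable_playReward t).comp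
    ((B.measurable_action ψ t).prodMk (B.measurable_means.prodMk B.measurable_noise))

lemma histArms_history_succ (t : ℕ) (ω : Ω) : histArms (B.history ψ (t + 1) ω)
    = insert (B.action ψ t ω) (histArms (B.history ψ t ω)) := by
  rw [history_succ, histArms_snoc]

lemma mem_tested_iff (t : ℕ) (ω : Ω) (a : ℕ) :
    a ∈ B.tested ψ t ω ↔ a ∈ histArms (B.history ψ t ω) := by
  induction t with
  | zero => simp [tested, histArms]
  | succ t ih =>
    rw [histArms_history_succ, Finset.mem_insert, ← ih]
    simp only [tested, Set.mem_ofPred_eq, Nat.lt_succ_iff_lt_or_eq]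
    constructor
    · rintro ⟨s, hs | rfl, rfl⟩
      · exact Or.inr ⟨s, hs, rfl⟩
      · exact Or.inl rfl
    · rintro (rfl | ⟨s, hs, rfl⟩)
      · exact ⟨t, Or.inr rfl, rfl⟩
      · exact ⟨s, Or.inl hs, rfl⟩

lemma comap_history_succ (t : ℕ) :
    MeasurableSpace.comap (B.history ψ (t + 1)) inferInstance = MeasurableSpace.comap
      (fun ω => (B.history ψ t ω, (B.action ψ t ω, B.reward ψ t ω))) inferInstance := by
  apply le_antisymm
  · have h : B.history ψ (t + 1) = (fun p : (Fin t → ℕ × ℝ) × (ℕ × ℝ) =>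
        (Fin.snoc (α := fun _ => ℕ × ℝ) p.1 p.2 : Fin (t + 1) → ℕ × ℝ)) ∘
        fun ω => (B.history ψ t ω, (B.action ψ t ω, B.reward ψ t ω)) := rfl
    rw [h, ← MeasurableSpace.comap_comp]
    exact MeasurableSpace.comap_mono (measurable_snoc t).comap_le
  · have h : (fun ω => (B.history ψ t ω, (B.action ψ t ω, B.reward ψ t ω))) =
        (fun h : Fin (t + 1) → ℕ × ℝ => ((fun i : Fin t => h i.castSucc), h (Fin.last t))) ∘
          B.history ψ (t + 1) := by
      funext ω
      simp [history_succ]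
    have hm : Measurable fun h : Fin (t + 1) → ℕ × ℝ =>
        ((fun i : Fin t => h i.castSucc), h (Fin.last t)) := by fun_prop
    rw [h, ← MeasurableSpace.comap_comp]
    exact MeasurableSpace.comap_mono hm.comap_le

/-- The history does not depend on later disturbances, nor on the means of untested arms. -/
lemma histFun_congr {t : ℕ} {x x' : ℕ → ℝ} {w w' : ℕ → 𝒲} {z : Ξ}
    (hw : ∀ s < t, w s = w' s) (hx : ∀ a ∈ histArms (B.histFun ψ t x w z), x a = x' a) :
    B.histFun ψ t x w z = B.histFun ψ t x' w' z := by
  induction t with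
  | zero => rfl
  | succ t ih =>
    simp only [histFun, histArms_snoc] at hx ⊢
    have h := ih (fun s hs => hw s (by omega)) fun a ha => hx a (Finset.mem_insert_of_mem ha)
    have h1 := hx _ (Finset.mem_insert_self _ _)
    rw [h] at h1 ⊢
    rw [h1, hw t (by omega)]

lemma histFun_update_noise (t : ℕ) (x : ℕ → ℝ) (w : ℕ → 𝒲) (z : Ξ) (c : 𝒲) :
    B.histFun ψ t x (Function.update w t c) z = B.histFun ψ t x w z :=
  B.histFun_congr ψ (fun _ hs => Function.update_of_ne hs.ne _ _) fun _ _ => rfl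

lemma histFun_update_means {t : ℕ} {x : ℕ → ℝ} {w : ℕ → 𝒲} {z : Ξ} {a : ℕ} (c : ℝ)
    (h : a ∉ histArms (B.histFun ψ t x w z)) :
    B.histFun ψ t (Function.update x a c) w z = B.histFun ψ t x w z := by
  refine (B.histFun_congr ψ (fun _ _ => rfl) fun b hb => ?_).symm
  rw [Function.update_of_ne]
  rintro rfl
  exact h hb

/-- As long as `a` is untested the history cannot see its mean, and an overwritten mean can be
restored by a second update; so one implication gives the other. -/
lemma notMem_histArms_update_means {t : ℕ} {x : ℕ → ℝ} {w : ℕ → 𝒲} {z : Ξ} {a : ℕ} (c : ℝ) :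
    a ∉ histArms (B.histFun ψ t (Function.update x a c) w z)
      ↔ a ∉ histArms (B.histFun ψ t x w z) := by
  constructor
  · intro h
    have := B.histFun_update_means ψ (x a) h
    rw [Function.update_idem, Function.update_eq_self] at this
    rwa [this]
  · intro h
    rwa [B.histFun_update_means ψ c h]

lemma histFun_apply {t : ℕ} (x : ℕ → ℝ) (w : ℕ → 𝒲) (z : Ξ) (i : Fin t) :
    B.histFun ψ t x w z i =
      (ψ.act i (fun j : Fin i => B.histFun ψ t x w z (Fin.castLE i.2.le j)) z,
        B.g (B.histFun ψ t x w z i).1 (x (B.histFun ψ t x w z i).1) (w i)) := by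
  induction t with
  | zero => exact i.elim0
  | succ t ih =>
    have hpre : ∀ (n : ℕ) (hn : n ≤ t), (fun j : Fin n => B.histFun ψ (t + 1) x w z
        (Fin.castLE (hn.trans t.le_succ) j)) = fun j => B.histFun ψ t x w z (Fin.castLE hn j) := by
      intro n hn
      funext j
      have : (Fin.castLE (hn.trans t.le_succ) j) = (Fin.castLE hn j).castSucc := rfl
      rw [this]
      simp only [histFun, Fin.snoc_castSucc]
    refine Fin.lastCases ?_ (fun i => ?_) i
    · have h1 := hpre t le_rfl
      have h2 : B.histFun ψ (t + 1) x w z (Fin.last t)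
        = (ψ.act t (B.histFun ψ t x w z) z, B.g (ψ.act t (B.histFun ψ t x w z) z)
        (x (ψ.act t (B.histFun ψ t x w z) z)) (w t)) := by simp [histFun]
      rw [h2]
      exact congrArg₂ Prod.mk (congrArg (fun h => ψ.act t h z) h1.symm) rfl
    · have h1 := hpre i i.2.le
      have h2 : B.histFun ψ (t + 1) x w z i.castSucc = B.histFun ψ t x w z i := by simp [histFun]
      rw [h2]
      refine (ih i).trans ?_
      exact congrArg₂ Prod.mk (congrArg (fun h => ψ.act i h z) h1.symm) rfl

/-- The history that results from playing a fixed sequence of arms. -/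
def replay {t : ℕ} (s : Fin t → ℕ) (x : ℕ → ℝ) (w : ℕ → 𝒲) : Fin t → ℕ × ℝ :=
  fun i => (s i, B.g (s i) (x (s i)) (w i))

lemma measurable_replay {t : ℕ} (s : Fin t → ℕ) :
    Measurable fun p : (ℕ → ℝ) × (ℕ → 𝒲) => B.replay s p.1 p.2 := by
  refine measurable_pi_iff.2 fun i => measurable_const.prodMk ?_
  exact (B.measurable_g (s i)).comp
    (by fun_prop : Measurable fun q : (ℕ → ℝ) × (ℕ → 𝒲) => (q.1 (s i), q.2 i))

lemma histFun_eq_replay {t : ℕ} {s : Fin t → ℕ} {x : ℕ → ℝ} {w : ℕ → 𝒲} {z : Ξ}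
    (h : ∀ i, (B.histFun ψ t x w z i).1 = s i) : B.histFun ψ t x w z = B.replay s x w := by
  funext i
  refine Prod.ext (h i) ?_
  rw [histFun_apply]
  simp only [replay, h i]

/-- This separates `ξ` from the bandit. The replayed history involves only means and disturbances,
so on fixing the action sequence `s`, the variable `z` enters only through a membership condition.
In the forward direction, strong induction on the period shows that the true and the replayed
prefixes agree, so the policy chooses the same next arm. -/
lemma consistent_replay_iff {t : ℕ} {s : Fin t → ℕ} {x : ℕ → ℝ} {w : ℕ → 𝒲} {z : Ξ} :
    ψ.Consistent (B.replay s x w) z ↔ ∀ i, (B.histFun ψ t x w z i).1 = s i := by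
  constructor
  · intro h
    have key : ∀ n, ∀ i : Fin t, (i : ℕ) = n → (B.histFun ψ t x w z i).1 = s i := by
      intro n
      induction n using Nat.strong_induction_on with
      | _ n ih =>
        rintro i rfl
        have hpre : (fun j : Fin i => B.histFun ψ t x w z (Fin.castLE i.2.le j))
            = fun j : Fin i => B.replay s x w (Fin.castLE i.2.le j) := by
          funext j
          have h1 := ih j j.2 (Fin.castLE i.2.le j) rfl
          refine Prod.ext h1 ?_
          rw [histFun_apply]
          simp only [replay, h1]
        rw [histFun_apply, hpre]
        exact h i
    exact fun i => key i i rfl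
  · intro h i
    rw [← B.histFun_eq_replay ψ h]
    have := congrArg Prod.fst (B.histFun_apply ψ x w z i)
    exact this.symm

end NoisyBandit

/-! ### Independence given the history -/

namespace NoisyBandit

variable {Ω : Type u} {𝒲 : Type v} {Ξ : Type w} [MeasurableSpace Ω]
  [MeasurableSpace 𝒲] [MeasurableSpace Ξ] {P : Measure Ω}
  (B : NoisyBandit Ω 𝒲 Ξ P) (ψ : Policy Ξ)

lemma measurable_update_means (a : ℕ) (c : ℝ) :
    Measurable fun ω => Function.update (B.means ω) a c := by
  have : Measurable fun x : ℕ → ℝ => Function.update x a c := by fun_prop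
  exact this.comp B.measurable_means

lemma measurable_update_noise (t : ℕ) (c : 𝒲) :
    Measurable fun ω => Function.update (B.noise ω) t c := by
  have : Measurable fun x : ℕ → 𝒲 => Function.update x t c := by fun_prop
  exact this.comp B.measurable_noise

/-- The mean reward of an arm is independent of all the other primitives. -/
lemma indepFun_mean [IsProbabilityMeasure P] (a : ℕ) (c : ℝ) :
    IndepFun (fun ω => (B.ξ ω, (B.noise ω, Function.update (B.means ω) a c))) (B.θ a) P := by
  have hu := B.measurable_update_means a c
  have h1 : IndepFun B.noise (fun ω => (Function.update (B.means ω) a c, B.θ a ω)) P :=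
    B.indep_θ_W.symm.comp measurable_id
      (by fun_prop : Measurable fun x : ℕ → ℝ => (Function.update x a c, x a))
  have h2 := indepFun_prodMk_of_indepFun B.measurable_noise hu (B.measurable_θ a) h1
    (indepFun_update B.measurable_θ B.indep_θ a c)
  have h3 : IndepFun B.ξ
      (fun ω => ((B.noise ω, Function.update (B.means ω) a c), B.θ a ω)) P :=
    B.indep_ξ.comp measurable_id (by fun_prop : Measurable fun p : (ℕ → ℝ) × (ℕ → 𝒲) =>
      ((p.2, Function.update p.1 a c), p.1 a))
  exact indepFun_prodMk_of_indepFun B.measurable_ξ (B.measurable_noise.prodMk hu)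
    (B.measurable_θ a) h3 h2

/-- A disturbance is independent of all the other primitives. -/
lemma indepFun_noise [IsProbabilityMeasure P] (t : ℕ) (c : 𝒲) :
    IndepFun (fun ω => (B.ξ ω, (B.means ω, Function.update (B.noise ω) t c))) (B.W t) P := by
  have hu := B.measurable_update_noise t c
  have h1 : IndepFun B.means (fun ω => (Function.update (B.noise ω) t c, B.W t ω)) P :=
    B.indep_θ_W.comp measurable_id
      (by fun_prop : Measurable fun x : ℕ → 𝒲 => (Function.update x t c, x t))
  have h2 := indepFun_prodMk_of_indepFun B.measurable_means hu (B.measurable_W t) h1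
    (indepFun_update B.measurable_W B.indep_W t c)
  have h3 : IndepFun B.ξ
      (fun ω => ((B.means ω, Function.update (B.noise ω) t c), B.W t ω)) P :=
    B.indep_ξ.comp measurable_id (by fun_prop : Measurable fun p : (ℕ → ℝ) × (ℕ → 𝒲) =>
      ((p.1, Function.update p.2 t c), p.2 t))
  exact indepFun_prodMk_of_indepFun B.measurable_ξ (B.measurable_means.prodMk hu)
    (B.measurable_W t) h3 h2

/-- The mean of an untested arm is independent of the history and the other means. -/
lemma lintegral_untested [IsProbabilityMeasure P] {t : ℕ} (a : ℕ) {f : ℝ → ℝ≥0∞} (hf : Measurable f)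
    {k : (Fin t → ℕ × ℝ) × (ℕ → ℝ) → ℝ≥0∞} (hk : Measurable k)
    (hk0 : ∀ p, a ∈ histArms p.1 → k p = 0) :
    ∫⁻ ω, f (B.θ a ω) * k (B.history ψ t ω, Function.update (B.means ω) a 0) ∂P
      = (∫⁻ x, f x ∂B.prior)
        * ∫⁻ ω, k (B.history ψ t ω, Function.update (B.means ω) a 0) ∂P := by
  have hm : Measurable fun q : Ξ × ((ℕ → 𝒲) × (ℕ → ℝ)) =>
      k (B.histFun ψ t q.2.2 q.2.1 q.1, q.2.2) := by
    refine hk.comp (Measurable.prodMk ?_ (by fun_prop))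
    exact (B.measurable_histFun ψ t).comp (by fun_prop :
      Measurable fun q : Ξ × ((ℕ → 𝒲) × (ℕ → ℝ)) => ((q.2.2, q.2.1), q.1))
  -- Once `a` has been tested `k` vanishes, and before that the history ignores the mean of `a`.
  -- Hence that mean may be overwritten inside the history too, which turns the whole factor into a
  -- function of primitives independent of `B.θ a`.
  have heq : ∀ ω, k (B.history ψ t ω, Function.update (B.means ω) a 0)
      = k (B.histFun ψ t (Function.update (B.means ω) a 0) (B.noise ω) (B.ξ ω),
          Function.update (B.means ω) a 0) := by
    intro ω
    rw [history_eq_histFun]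
    by_cases h : a ∈ histArms (B.histFun ψ t (B.means ω) (B.noise ω) (B.ξ ω))
    · rw [hk0 _ h, hk0]
      by_contra h'
      exact (B.notMem_histArms_update_means ψ 0).1 h' h
    · rw [B.histFun_update_means ψ 0 h]
  simp_rw [heq]
  rw [← B.law_θ a, lintegral_map hf (B.measurable_θ a)]
  have hv : Measurable fun ω => (B.ξ ω, (B.noise ω, Function.update (B.means ω) a 0)) :=
    B.measurable_ξ.prodMk (B.measurable_noise.prodMk (B.measurable_update_means a 0))
  exact lintegral_mul_eq_lintegral_mul_lintegral_of_indepFun (hf.comp (B.measurable_θ a))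
    (hm.comp hv) ((B.indepFun_mean a 0).symm.comp hf hm)

/-- Given the history, the action is independent of the mean rewards. -/
lemma exists_action_probability [IsProbabilityMeasure P] (t a : ℕ) :
    ∃ π : (Fin t → ℕ × ℝ) → ℝ≥0∞, Measurable π ∧
      ∀ F : (Fin t → ℕ × ℝ) × (ℕ → ℝ) → ℝ≥0∞, Measurable F →
        ∫⁻ ω in {ω | B.action ψ t ω = a}, F (B.history ψ t ω, B.means ω) ∂P
          = ∫⁻ ω, π (B.history ψ t ω) * F (B.history ψ t ω, B.means ω) ∂P := by
  set C : Set ((Fin t → ℕ × ℝ) × Ξ) := {p | ψ.Consistent p.1 p.2} with hC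
  have hCm : MeasurableSet C := ψ.measurableSet_consistent
  set D : Set ((Fin t → ℕ × ℝ) × Ξ) := {p | ψ.act t p.1 p.2 = a} with hD
  have hDm : MeasurableSet D := (ψ.measurable_act t) (measurableSet_singleton a)
  have : IsProbabilityMeasure (P.map B.ξ) :=
    Measure.isProbabilityMeasure_map B.measurable_ξ.aemeasurable
  -- All that a history reveals about `ξ` is that `ξ` is consistent with the recorded actions. The
  -- conditional probability of playing `a` is thus `Qa / Q`, the prior mass of the consistent
  -- values that prescribe `a` relative to that of all consistent values.
  set Q : (Fin t → ℕ × ℝ) → ℝ≥0∞ := fun h => P.map B.ξ (Prod.mk h ⁻¹' C) with hQ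
  set Qa : (Fin t → ℕ × ℝ) → ℝ≥0∞ := fun h => P.map B.ξ (Prod.mk h ⁻¹' (C ∩ D)) with hQa
  have hQm : Measurable Q := measurable_measure_prodMk_left hCm
  have hQam : Measurable Qa := measurable_measure_prodMk_left (hCm.inter hDm)
  have hle : ∀ h, Qa h ≤ Q h := fun h =>
    measure_mono (Set.preimage_mono Set.inter_subset_left)
  have hdiv : ∀ h, Qa h / Q h * Q h = Qa h := by
    intro h
    by_cases h0 : Q h = 0
    · have := hle h
      rw [h0] at this ⊢
      simp [le_antisymm this bot_le]
    · exact ENNReal.div_mul_cancel h0 (measure_ne_top _ _)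
  refine ⟨fun h => Qa h / Q h, hQam.div hQm, fun F hF => ?_⟩
  have hHm := B.measurable_history ψ t
  have hsm : ∀ s : Fin t → ℕ, MeasurableSet {ω | ∀ i, (B.history ψ t ω i).1 = s i} := by
    intro s
    simp only [Set.ofPred_forall]
    exact MeasurableSet.iInter fun i => measurableSet_eq_fun (by fun_prop) measurable_const
  -- The integral is cut up by the countably many action sequences. On each piece the history is a
  -- replay, a function of the bandit alone, and `ξ` can be integrated out independently.
  have hsplit : ∀ f : Ω → ℝ≥0∞, Measurable f → ∫⁻ ω, f ω ∂P
      = ∑' s : Fin t → ℕ, ∫⁻ ω, {ω | ∀ i, (B.history ψ t ω i).1 = s i}.indicator f ω ∂P := by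
    intro f hf
    rw [← lintegral_tsum fun s => (hf.indicator (hsm s)).aemeasurable]
    refine lintegral_congr fun ω => ?_
    rw [tsum_eq_single (fun i => (B.history ψ t ω i).1)]
    · rw [Set.indicator_of_mem]
      exact fun i => rfl
    · intro s hs
      refine Set.indicator_of_notMem (fun h => hs ?_) _
      exact (funext h).symm
  have hAm : MeasurableSet {ω | B.action ψ t ω = a} :=
    B.measurable_action ψ t (measurableSet_singleton a)
  have hFm : Measurable fun ω => F (B.history ψ t ω, B.means ω) :=
    hF.comp (hHm.prodMk B.measurable_means)
  have hVm : Measurable fun ω => (B.means ω, B.noise ω) :=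
    B.measurable_means.prodMk B.measurable_noise
  rw [← lintegral_indicator hAm, hsplit _ (hFm.indicator hAm)]
  refine Eq.trans ?_ (hsplit (fun ω => Qa (B.history ψ t ω) / Q (B.history ψ t ω)
    * F (B.history ψ t ω, B.means ω)) (((hQam.div hQm).comp hHm).mul hFm)).symm
  refine tsum_congr fun s => ?_
  have hYm := B.measurable_replay s
  have key : ∀ (E : Set ((Fin t → ℕ × ℝ) × Ξ)) (G : (Fin t → ℕ × ℝ) × (ℕ → ℝ) → ℝ≥0∞),
      MeasurableSet E → Measurable G →
      ∫⁻ ω, ((Prod.mk (B.replay s (B.means ω) (B.noise ω)) ⁻¹' E).indicator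
          (fun _ => G (B.replay s (B.means ω) (B.noise ω), B.means ω)) (B.ξ ω)) ∂P
        = ∫⁻ ω, G (B.replay s (B.means ω) (B.noise ω), B.means ω)
          * P.map B.ξ (Prod.mk (B.replay s (B.means ω) (B.noise ω)) ⁻¹' E) ∂P := by
    intro E G hE hG
    have hGm : Measurable fun q : Ξ × ((ℕ → ℝ) × (ℕ → 𝒲)) =>
        G (B.replay s q.2.1 q.2.2, q.2.1) :=
      hG.comp ((hYm.comp measurable_snd).prodMk (by fun_prop))
    have hEm : MeasurableSet {q : Ξ × ((ℕ → ℝ) × (ℕ → 𝒲)) | (B.replay s q.2.1 q.2.2, q.1) ∈ E} :=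
      ((hYm.comp measurable_snd).prodMk measurable_fst) hE
    have := lintegral_comp_prodMk_of_indepFun B.measurable_ξ hVm B.indep_ξ (hGm.indicator hEm)
    refine Eq.trans (lintegral_congr fun ω => ?_) (this.trans (lintegral_congr fun ω => ?_))
    · rfl
    · have hE' : MeasurableSet (Prod.mk (B.replay s (B.means ω) (B.noise ω)) ⁻¹' E) :=
        measurable_prodMk_left hE
      rw [← lintegral_indicator_const hE']
      rfl
  have hrep : ∀ ω, (∀ i, (B.history ψ t ω i).1 = s i) ↔
      (B.replay s (B.means ω) (B.noise ω), B.ξ ω) ∈ C := by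
    intro ω
    rw [history_eq_histFun]
    exact (B.consistent_replay_iff ψ).symm
  have hrep' : ∀ ω, (∀ i, (B.history ψ t ω i).1 = s i) →
      B.history ψ t ω = B.replay s (B.means ω) (B.noise ω) := by
    intro ω h
    rw [history_eq_histFun] at h ⊢
    exact B.histFun_eq_replay ψ h
  have h1 := key (C ∩ D) F (hCm.inter hDm) hF
  have h2 := key C (fun p => Qa p.1 / Q p.1 * F p) hCm
    (((hQam.div hQm).comp measurable_fst).mul hF)
  refine Eq.trans (lintegral_congr fun ω => ?_) (h1.trans (Eq.trans ?_
    (h2.symm.trans (lintegral_congr fun ω => ?_))))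
  · by_cases hω : ∀ i, (B.history ψ t ω i).1 = s i
    · have hC' := (hrep ω).1 hω
      rw [Set.indicator_of_mem (show ω ∈ {ω | ∀ i, (B.history ψ t ω i).1 = s i} from hω)]
      by_cases ha : B.action ψ t ω = a
      · rw [Set.indicator_of_mem (show ω ∈ {ω | B.action ψ t ω = a} from ha),
          Set.indicator_of_mem, hrep' ω hω]
        refine ⟨hC', ?_⟩
        rw [← hrep' ω hω]
        exact ha
      · rw [Set.indicator_of_notMem (show ω ∉ {ω | B.action ψ t ω = a} from ha),
          Set.indicator_of_notMem]
        rintro ⟨-, h⟩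
        rw [← hrep' ω hω] at h
        exact ha h
    · rw [Set.indicator_of_notMem (show ω ∉ {ω | ∀ i, (B.history ψ t ω i).1 = s i} from hω),
        Set.indicator_of_notMem]
      exact fun h => hω ((hrep ω).2 h.1)
  · refine lintegral_congr fun ω => ?_
    have e := hdiv (B.replay s (B.means ω) (B.noise ω))
    change F _ * Qa _ = Qa _ / Q _ * F _ * Q _
    rw [mul_right_comm, e, mul_comm]
  · by_cases hω : ∀ i, (B.history ψ t ω i).1 = s i
    · rw [Set.indicator_of_mem (show ω ∈ {ω | ∀ i, (B.history ψ t ω i).1 = s i} from hω),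
        Set.indicator_of_mem (by exact (hrep ω).1 hω), hrep' ω hω]
    · rw [Set.indicator_of_notMem (show ω ∉ {ω | ∀ i, (B.history ψ t ω i).1 = s i} from hω),
        Set.indicator_of_notMem]
      exact fun h => hω ((hrep ω).2 h)

lemma ae_mean_mem (a : ℕ) : ∀ᵐ ω ∂P, B.θ a ω ∈ Set.Icc (0 : ℝ) 1 := by
  have h := B.prior_mem
  rw [← B.law_θ a] at h
  exact ae_of_ae_map (B.measurable_θ a).aemeasurable h

/-- The average of the reward of an arm over the disturbance is the mean reward. -/
lemma ae_lintegral_reward_eq [IsProbabilityMeasure P] (a t : ℕ) :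
    ∀ᵐ ω ∂P, ∫⁻ w, ENNReal.ofReal (B.g a (B.θ a ω) w) ∂(P.map (B.W t))
      = ENNReal.ofReal (B.θ a ω) := by
  have : IsProbabilityMeasure (P.map (B.W t)) :=
    Measure.isProbabilityMeasure_map (B.measurable_W t).aemeasurable
  have : IsProbabilityMeasure (P.map (B.θ a)) :=
    Measure.isProbabilityMeasure_map (B.measurable_θ a).aemeasurable
  have hgm : Measurable fun p : ℝ × 𝒲 => ENNReal.ofReal (B.g a p.1 p.2) :=
    (B.measurable_g a).ennreal_ofReal
  have hind : IndepFun (B.W t) (B.θ a) P :=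
    B.indep_θ_W.symm.comp (measurable_pi_apply t) (measurable_pi_apply a)
  have hrm : Measurable fun ω => B.g a (B.θ a ω) (B.W t ω) :=
    (B.measurable_g a).comp ((B.measurable_θ a).prodMk (B.measurable_W t))
  have hri : Integrable (fun ω => B.g a (B.θ a ω) (B.W t ω)) P := by
    refine Integrable.of_bound hrm.aestronglyMeasurable 1 ?_
    filter_upwards [B.reward_mem a t] with ω h
    rw [Real.norm_of_nonneg h.1]
    exact h.2
  have hθi : Integrable (B.θ a) P := by
    refine Integrable.of_bound (B.measurable_θ a).aestronglyMeasurable 1 ?_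
    filter_upwards [B.ae_mean_mem a] with ω h
    rw [Real.norm_of_nonneg h.1]
    exact h.2
  -- Two functions of the mean reward are compared by integrating over sets `s` of values of it:
  -- independence handles the left side, the conditional-mean hypothesis on the rewards the right
  -- side.
  have hfun : (fun x => ∫⁻ w, ENNReal.ofReal (B.g a x w) ∂(P.map (B.W t)))
      =ᵐ[P.map (B.θ a)] fun x => ENNReal.ofReal x := by
    refine ae_eq_of_forall_setLIntegral_eq_of_sigmaFinite hgm.lintegral_prod_right'
      ENNReal.measurable_ofReal fun s hs _ => ?_
    have h1 := lintegral_comp_prodMk_of_indepFun (B.measurable_W t) (B.measurable_θ a) hind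
      (f := fun p => (Prod.snd ⁻¹' s).indicator (fun p => ENNReal.ofReal (B.g a p.2 p.1)) p)
      ((hgm.comp measurable_swap).indicator (measurable_snd hs))
    have h2 : ∫⁻ ω in B.θ a ⁻¹' s, ENNReal.ofReal (B.g a (B.θ a ω) (B.W t ω)) ∂P
        = ∫⁻ ω in B.θ a ⁻¹' s, ENNReal.ofReal (B.θ a ω) ∂P := by
      rw [← ofReal_integral_eq_lintegral_ofReal hri.integrableOn
        (ae_restrict_of_ae ((B.reward_mem a t).mono fun ω h => h.1)),
        ← ofReal_integral_eq_lintegral_ofReal hθi.integrableOn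
        (ae_restrict_of_ae ((B.ae_mean_mem a).mono fun ω h => h.1))]
      congr 1
      have hs' : MeasurableSet[MeasurableSpace.comap B.means inferInstance] (B.θ a ⁻¹' s) :=
        ⟨(fun x : ℕ → ℝ => x a) ⁻¹' s, measurable_pi_apply a hs, rfl⟩
      rw [← setIntegral_condExp B.measurable_means.comap_le hri hs']
      exact integral_congr_ae (ae_restrict_of_ae (B.reward_mean a t))
    rw [setLIntegral_map hs hgm.lintegral_prod_right' (B.measurable_θ a),
      setLIntegral_map hs ENNReal.measurable_ofReal (B.measurable_θ a), ← h2,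
      ← lintegral_indicator (B.measurable_θ a hs), ← lintegral_indicator (B.measurable_θ a hs)]
    refine Eq.trans (lintegral_congr fun ω => ?_) (h1.symm.trans (lintegral_congr fun ω => ?_))
    · by_cases h : B.θ a ω ∈ s <;> simp [Set.indicator, h]
    · rfl
  exact ae_of_ae_map (B.measurable_θ a).aemeasurable hfun

/-- In integrals against functions of the past, a reward may be replaced by its mean. -/
lemma lintegral_reward_mul [IsProbabilityMeasure P] (t a : ℕ) {K : ((Fin t → ℕ × ℝ) × (ℕ → ℝ)) × Ξ → ℝ≥0∞}
    (hK : Measurable K) :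
    ∫⁻ ω, ENNReal.ofReal (B.g a (B.θ a ω) (B.W t ω))
        * K ((B.history ψ t ω, B.means ω), B.ξ ω) ∂P
      = ∫⁻ ω, ENNReal.ofReal (B.θ a ω) * K ((B.history ψ t ω, B.means ω), B.ξ ω) ∂P := by
  obtain ⟨ω₀⟩ : Nonempty Ω := nonempty_of_isProbabilityMeasure P
  set c := B.W t ω₀
  have hm : Measurable fun q : Ξ × ((ℕ → ℝ) × (ℕ → 𝒲)) =>
      K ((B.histFun ψ t q.2.1 q.2.2 q.1, q.2.1), q.1) := by
    refine hK.comp ((Measurable.prodMk ?_ (by fun_prop)).prodMk measurable_fst)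
    exact (B.measurable_histFun ψ t).comp measurable_swap
  have hgm : Measurable fun p : 𝒲 × (Ξ × ((ℕ → ℝ) × (ℕ → 𝒲))) =>
      ENNReal.ofReal (B.g a (p.2.2.1 a) p.1) :=
    ((B.measurable_g a).comp (by fun_prop : Measurable
      fun p : 𝒲 × (Ξ × ((ℕ → ℝ) × (ℕ → 𝒲))) => (p.2.2.1 a, p.1))).ennreal_ofReal
  -- The history before period `t` does not involve `W t`, so that coordinate may be frozen at `c`,
  -- leaving `K` a function of variables independent of `W t`.
  have heq : ∀ ω, K ((B.history ψ t ω, B.means ω), B.ξ ω) = K ((B.histFun ψ t (B.means ω)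
      (Function.update (B.noise ω) t c) (B.ξ ω), B.means ω), B.ξ ω) := by
    intro ω
    rw [B.histFun_update_noise, history_eq_histFun]
  simp_rw [heq]
  have hv : Measurable fun ω => (B.ξ ω, (B.means ω, Function.update (B.noise ω) t c)) :=
    B.measurable_ξ.prodMk (B.measurable_means.prodMk (B.measurable_update_noise t c))
  refine (lintegral_comp_prodMk_of_indepFun (B.measurable_W t) hv (B.indepFun_noise t c).symm
    (hgm.mul (hm.comp measurable_snd))).trans (lintegral_congr_ae ?_)
  filter_upwards [B.ae_lintegral_reward_eq a t] with ω hω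
  simp only [Pi.mul_apply, Function.comp_apply]
  rw [lintegral_mul_const]
  · congr 1
  · exact ((B.measurable_g a).comp (by fun_prop : Measurable
      fun w : 𝒲 => (B.means ω a, w))).ennreal_ofReal

end NoisyBandit

/-! ### Conditional laws and their integrals -/

section ConditionalLaws

variable {Ω : Type*} [MeasurableSpace Ω] {P : Measure Ω} [IsProbabilityMeasure P]
  {U : Type*} [MeasurableSpace U] {H : Ω → U}
  {S T : Type*} [MeasurableSpace S] [StandardBorelSpace S] [Nonempty S] [MeasurableSpace T]
  [StandardBorelSpace T] [Nonempty T]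

lemma lintegral_condDistrib_map {Y : Ω → S} (hH : Measurable H) (hY : Measurable Y)
    {F : U × S → ℝ≥0∞} (hF : Measurable F) :
    ∫⁻ h, ∫⁻ y, F (h, y) ∂(condDistrib Y H P h) ∂(P.map H) = ∫⁻ ω, F (H ω, Y ω) ∂P := by
  rw [← Measure.lintegral_compProd hF, compProd_map_condDistrib hY.aemeasurable,
    lintegral_map hF (hH.prodMk hY)]

lemma setLIntegral_mul_condDistrib {Y : Ω → S} (hH : Measurable H) (hY : Measurable Y)
    {f : S → ℝ≥0∞} {u : U → ℝ≥0∞} (hf : Measurable f) (hu : Measurable u) {s : Set U}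
    (hs : MeasurableSet s) :
    ∫⁻ a in s, u a * ∫⁻ y, f y ∂(condDistrib Y H P a) ∂(P.map H)
      = ∫⁻ ω, s.indicator u (H ω) * f (Y ω) ∂P := by
  rw [← lintegral_condDistrib_map hH hY (F := fun p => s.indicator u p.1 * f p.2)
    (((hu.indicator hs).comp measurable_fst).mul (hf.comp measurable_snd)),
    ← lintegral_indicator hs]
  refine lintegral_congr fun a => ?_
  simp only
  rw [lintegral_const_mul _ hf]
  by_cases ha : a ∈ s <;> simp [ha]

/-- Conditional integrals are determined by integrals against functions of the condition. -/
lemma ae_lintegral_condDistrib_eq {Y : Ω → S} {Z : Ω → T} (hH : Measurable H) (hY : Measurable Y)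
    (hZ : Measurable Z) {f : S → ℝ≥0∞} {g : T → ℝ≥0∞} {u v : U → ℝ≥0∞} (hf : Measurable f)
    (hg : Measurable g) (hu : Measurable u) (hv : Measurable v)
    (h : ∀ s : Set U, MeasurableSet s → ∫⁻ ω, s.indicator u (H ω) * f (Y ω) ∂P
      = ∫⁻ ω, s.indicator v (H ω) * g (Z ω) ∂P) :
    ∀ᵐ a ∂(P.map H), u a * ∫⁻ y, f y ∂(condDistrib Y H P a)
      = v a * ∫⁻ z, g z ∂(condDistrib Z H P a) := by
  have : IsProbabilityMeasure (P.map H) := Measure.isProbabilityMeasure_map hH.aemeasurable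
  refine ae_eq_of_forall_setLIntegral_eq_of_sigmaFinite (hu.mul hf.lintegral_kernel)
    (hv.mul hg.lintegral_kernel) fun s hs _ => ?_
  refine (setLIntegral_mul_condDistrib hH hY hf hu hs).trans ((h s hs).trans ?_)
  exact (setLIntegral_mul_condDistrib hH hZ hg hv hs).symm

lemma ae_ae_condDistrib {Y : Ω → S} (hH : Measurable H) (hY : Measurable Y)
    {p : U × S → Prop} (hp : MeasurableSet {q | p q}) (h : ∀ᵐ ω ∂P, p (H ω, Y ω)) :
    ∀ᵐ a ∂(P.map H), ∀ᵐ y ∂(condDistrib Y H P a), p (a, y) := by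
  refine Measure.ae_ae_of_ae_compProd ?_
  rw [compProd_map_condDistrib hY.aemeasurable]
  exact (ae_map_iff (hH.prodMk hY).aemeasurable hp).2 h

end ConditionalLaws

/-! ### The satisficing arm as a function of the means -/

/-- The first coordinate that is at least `c`. -/
def satArm (c : ℝ) (x : ℕ → ℝ) : ℕ := sInf {a | c ≤ x a}

lemma satArm_eq_iff {c : ℝ} {x : ℕ → ℝ} (hx : ∃ a, c ≤ x a) (a : ℕ) :
    satArm c x = a ↔ c ≤ x a ∧ ∀ b < a, x b < c := by
  constructor
  · rintro rfl
    exact ⟨Nat.sInf_mem (s := {a | c ≤ x a}) hx,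
      fun b hb => not_le.1 fun h => Nat.notMem_of_lt_sInf hb h⟩
  · rintro ⟨h1, h2⟩
    refine le_antisymm (Nat.sInf_le h1) (le_csInf hx fun b hb => ?_)
    by_contra h
    exact absurd (h2 b (not_le.1 h)) (not_lt.2 hb)

/-- The tail event at `a` does not involve coordinate `a`. Compared with `satArm_eq_iff`, this shows
that the atom at `a` is the tail event intersected with the single condition `c ≤ x a`, the source
of every geometric factor. -/
lemma le_satArm_iff {c : ℝ} {x : ℕ → ℝ} (hx : ∃ a, c ≤ x a) (a : ℕ) :
    a ≤ satArm c x ↔ ∀ b < a, x b < c := by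
  constructor
  · intro h b hb
    exact not_le.1 fun h' => absurd (Nat.sInf_le (s := {a | c ≤ x a}) h') (not_le.2 (hb.trans_le h))
  · intro h
    refine le_csInf hx fun b hb => ?_
    by_contra h'
    exact absurd (h b (not_le.1 h')) (not_lt.2 hb)

lemma measurableSet_exists_le (c : ℝ) : MeasurableSet {x : ℕ → ℝ | ∃ a, c ≤ x a} := by
  have : {x : ℕ → ℝ | ∃ a, c ≤ x a} = ⋃ a, {x | c ≤ x a} := by
    ext x
    simp
  rw [this]
  exact MeasurableSet.iUnion fun a => measurableSet_le measurable_const (measurable_pi_apply a)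

lemma measurableSet_forall_lt (c : ℝ) (n : ℕ) :
    MeasurableSet {x : ℕ → ℝ | ∀ b < n, x b < c} := by
  simp only [Set.ofPred_forall]
  exact MeasurableSet.iInter fun b => MeasurableSet.iInter fun _ =>
    measurableSet_lt (measurable_pi_apply b) measurable_const

lemma measurable_satArm (c : ℝ) : Measurable (satArm c) := by
  refine measurable_to_countable' fun a => ?_
  have hE := measurableSet_exists_le c
  have hA : MeasurableSet {x : ℕ → ℝ | c ≤ x a ∧ ∀ b < a, x b < c} :=
    (measurableSet_le measurable_const (measurable_pi_apply a)).inter (measurableSet_forall_lt c a)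
  -- The second piece accounts for `sInf ∅ = 0`, the value when no coordinate reaches `c`.
  have h : satArm c ⁻¹' {a} = ({x : ℕ → ℝ | ∃ a, c ≤ x a} ∩ {x | c ≤ x a ∧ ∀ b < a, x b < c})
      ∪ ({x : ℕ → ℝ | ∃ a, c ≤ x a}ᶜ ∩ {_x | a = 0}) := by
    ext x
    by_cases hx : ∃ a, c ≤ x a
    · simp [hx, satArm_eq_iff hx]
    · have h0 : satArm c x = 0 := by
        have : {a | c ≤ x a} = ∅ := by
          ext a; simp only [Set.mem_ofPred_eq, Set.mem_empty_iff_false, iff_false]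
          exact fun h => hx ⟨a, h⟩
        simp [satArm, this]
      simp [hx, h0, eq_comm]
  rw [h]
  exact (hE.inter hA).union (hE.compl.inter (MeasurableSet.const _))

/-! ### Conditional laws given the history -/

namespace NoisyBandit

variable {Ω : Type u} {𝒲 : Type v} {Ξ : Type w} [MeasurableSpace Ω]
  [MeasurableSpace 𝒲] [MeasurableSpace Ξ] {P : Measure Ω}
  (B : NoisyBandit Ω 𝒲 Ξ P) (ψ : Policy Ξ)

lemma satAction_eq (D : ℝ) (ω : Ω) : B.satAction D ω = satArm (B.Rstar - D) (B.means ω) := rfl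

lemma measurable_satAction (D : ℝ) : Measurable (B.satAction D) :=
  (measurable_satArm _).comp B.measurable_means

lemma reward_eq (t : ℕ) (ω : Ω) (a : ℕ) (h : B.action ψ t ω = a) :
    B.reward ψ t ω = B.g a (B.θ a ω) (B.W t ω) := by
  rw [reward, h]

lemma ae_reward_mem (t : ℕ) : ∀ᵐ ω ∂P, B.reward ψ t ω ∈ Set.Icc (0 : ℝ) 1 := by
  filter_upwards [ae_all_iff.2 fun a => B.reward_mem a t] with ω h
  exact h _

lemma ae_means_mem : ∀ᵐ ω ∂P, ∀ a, B.means ω a ∈ Set.Icc (0 : ℝ) 1 :=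
  ae_all_iff.2 fun a => B.ae_mean_mem a

variable [IsProbabilityMeasure P]

lemma isProbabilityMeasure_prior : IsProbabilityMeasure B.prior := by
  rw [← B.law_θ 0]
  exact Measure.isProbabilityMeasure_map (B.measurable_θ 0).aemeasurable

/-- The mean reward of an untested arm has its prior law given the history and the other means. -/
lemma ae_untested {t : ℕ} (a : ℕ) {f : ℝ → ℝ≥0∞} (hf : Measurable f) {k : (ℕ → ℝ) → ℝ≥0∞}
    (hk : Measurable k) (hka : ∀ x, k (Function.update x a 0) = k x) :
    ∀ᵐ h ∂(P.map (B.history ψ t)), a ∉ histArms h →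
      ∫⁻ x, f (x a) * k x ∂(condDistrib B.means (B.history ψ t) P h)
        = (∫⁻ x, f x ∂B.prior) * ∫⁻ x, k x ∂(condDistrib B.means (B.history ψ t) P h) := by
  have hH := B.measurable_history ψ t
  have hT : MeasurableSet {h : Fin t → ℕ × ℝ | a ∉ histArms h} :=
    measurableSet_histArms' fun s => a ∉ s
  have hu : Measurable ({h : Fin t → ℕ × ℝ | a ∉ histArms h}.indicator fun _ => (1 : ℝ≥0∞)) :=
    measurable_const.indicator hT
  have hfa : Measurable fun x : ℕ → ℝ => f (x a) := hf.comp (measurable_pi_apply a)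
  have key := ae_lintegral_condDistrib_eq (P := P) hH B.measurable_means B.measurable_means
    (f := fun x => f (x a) * k x) (g := fun x => (∫⁻ x, f x ∂B.prior) * k x)
    (hfa.mul hk) (hk.const_mul _) hu hu ?_
  · filter_upwards [key] with h hh ha
    rw [Set.indicator_of_mem (by exact ha), one_mul, one_mul, lintegral_const_mul _ hk] at hh
    exact hh
  · intro s hs
    -- The indicator of histories in which `a` is untested supplies the vanishing that
    -- `lintegral_untested` requires; hence the conclusion only for such histories.
    have h1 := B.lintegral_untested ψ (t := t) a hf (k := fun p => s.indicator
      ({h : Fin t → ℕ × ℝ | a ∉ histArms h}.indicator fun _ => (1 : ℝ≥0∞)) p.1 * k p.2)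
      (((hu.indicator hs).comp measurable_fst).mul (hk.comp measurable_snd)) (by
        intro p hp
        have : p.1 ∉ {h : Fin t → ℕ × ℝ | a ∉ histArms h} := fun h => h hp
        by_cases hps : p.1 ∈ s <;> simp [hps, this])
    rw [← lintegral_const_mul] at h1
    · simp only [hka] at h1
      refine Eq.trans (lintegral_congr fun ω => ?_) (h1.trans (lintegral_congr fun ω => ?_))
      · rw [mul_left_comm]; rfl
      · rw [mul_left_comm]
    · exact (((hu.indicator hs).comp hH).mul (hk.comp (B.measurable_update_means a 0)))

-- The weight `π` produced by `exists_action_probability` is only some function of the history.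
-- Testing it on `F` that depend on the history alone forces it to be the conditional law of the
-- action.
variable {B} in
lemma exists_action_probability' (t a : ℕ) :
    ∀ F : (Fin t → ℕ × ℝ) × (ℕ → ℝ) → ℝ≥0∞, Measurable F →
        ∫⁻ ω in {ω | B.action ψ t ω = a}, F (B.history ψ t ω, B.means ω) ∂P
          = ∫⁻ ω, condDistrib (B.action ψ t) (B.history ψ t) P (B.history ψ t ω) {a}
            * F (B.history ψ t ω, B.means ω) ∂P := by
  obtain ⟨π, hπ, h⟩ := B.exists_action_probability ψ t a
  have hH := B.measurable_history ψ t
  have hA := B.measurable_action ψ t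
  have hAm : MeasurableSet {ω | B.action ψ t ω = a} := hA (measurableSet_singleton a)
  have key := ae_lintegral_condDistrib_eq (P := P) hH hA hA
    (f := ({a} : Set ℕ).indicator fun _ => 1) (g := fun _ => 1) (u := fun _ => 1) (v := π)
    (measurable_of_countable _) measurable_const measurable_const hπ ?_
  · intro F hF
    rw [h F hF]
    refine lintegral_congr_ae ?_
    filter_upwards [ae_of_ae_map hH.aemeasurable key] with ω hω
    rw [lintegral_indicator_const (measurableSet_singleton a)] at hω
    simp only [one_mul, lintegral_const, measure_univ, mul_one] at hω
    rw [hω]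
  · intro s hs
    have h1 := h (fun p => s.indicator (fun _ => 1) p.1)
      ((measurable_const.indicator hs).comp measurable_fst)
    rw [← lintegral_indicator hAm] at h1
    refine Eq.trans (lintegral_congr fun ω => ?_) (h1.trans (lintegral_congr fun ω => ?_))
    · by_cases h1 : B.action ψ t ω = a <;> simp [h1, Set.indicator]
    · by_cases h2 : B.history ψ t ω ∈ s <;> simp [h2]

/-- Given the history, the action is independent of the satisficing action. -/
lemma ae_lintegral_action (t a : ℕ) (D : ℝ) (j : ℕ → ℝ≥0∞) :
    ∀ᵐ h ∂(P.map (B.history ψ t)),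
      ∫⁻ y, {y : ℕ × (ℕ × ℝ) | y.2.1 = a}.indicator (fun y => j y.1) y
        ∂(condDistrib (fun ω => (B.satAction D ω, (B.action ψ t ω, B.reward ψ t ω)))
          (B.history ψ t) P h)
      = condDistrib (B.action ψ t) (B.history ψ t) P h {a}
        * ∫⁻ x, j (satArm (B.Rstar - D) x) ∂(condDistrib B.means (B.history ψ t) P h) := by
  have hH := B.measurable_history ψ t
  have hA := B.measurable_action ψ t
  have hAm : MeasurableSet {ω | B.action ψ t ω = a} := hA (measurableSet_singleton a)
  have hY := (B.measurable_satAction D).prodMk (hA.prodMk (B.measurable_reward ψ t))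
  have hj : Measurable j := measurable_of_countable _
  have hjs : Measurable fun x => j (satArm (B.Rstar - D) x) := hj.comp (measurable_satArm _)
  have hS : MeasurableSet {y : ℕ × (ℕ × ℝ) | y.2.1 = a} :=
    measurable_snd.fst (measurableSet_singleton a)
  have key := ae_lintegral_condDistrib_eq (P := P) hH hY B.measurable_means
    (f := {y : ℕ × (ℕ × ℝ) | y.2.1 = a}.indicator fun y => j y.1)
    (g := fun x => j (satArm (B.Rstar - D) x)) (u := fun _ => 1)
    (v := fun h => condDistrib (B.action ψ t) (B.history ψ t) P h {a})
    ((hj.comp measurable_fst).indicator hS) hjs measurable_const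
    (Kernel.measurable_coe _ (measurableSet_singleton a)) ?_
  · simpa using key
  · intro s hs
    have h1 := exists_action_probability' (B := B) ψ t a
      (fun p => s.indicator (fun _ => 1) p.1 * j (satArm (B.Rstar - D) p.2))
      (((measurable_const.indicator hs).comp measurable_fst).mul (hjs.comp measurable_snd))
    rw [← lintegral_indicator hAm] at h1
    refine Eq.trans (lintegral_congr fun ω => ?_) (h1.trans (lintegral_congr fun ω => ?_))
    · by_cases h1 : B.action ψ t ω = a <;> simp [h1, Set.indicator, satAction_eq]
    · by_cases h2 : B.history ψ t ω ∈ s <;> simp [h2]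

/-- Given the history and the action, the conditional mean of the reward is that of the mean reward
of the arm played. -/
lemma ae_lintegral_action_reward (t a : ℕ) (D : ℝ) (j : ℕ → ℝ≥0∞) :
    ∀ᵐ h ∂(P.map (B.history ψ t)),
      ∫⁻ y, {y : ℕ × (ℕ × ℝ) | y.2.1 = a}.indicator (fun y => ENNReal.ofReal y.2.2 * j y.1) y
        ∂(condDistrib (fun ω => (B.satAction D ω, (B.action ψ t ω, B.reward ψ t ω)))
          (B.history ψ t) P h)
      = condDistrib (B.action ψ t) (B.history ψ t) P h {a}
        * ∫⁻ x, ENNReal.ofReal (x a) * j (satArm (B.Rstar - D) x)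
          ∂(condDistrib B.means (B.history ψ t) P h) := by
  have hH := B.measurable_history ψ t
  have hA := B.measurable_action ψ t
  have hAm : MeasurableSet {ω | B.action ψ t ω = a} := hA (measurableSet_singleton a)
  have hY := (B.measurable_satAction D).prodMk (hA.prodMk (B.measurable_reward ψ t))
  have hj : Measurable j := measurable_of_countable _
  have hjs : Measurable fun x => j (satArm (B.Rstar - D) x) := hj.comp (measurable_satArm _)
  have hjs' : Measurable fun x : ℕ → ℝ => ENNReal.ofReal (x a) * j (satArm (B.Rstar - D) x) :=
    (measurable_pi_apply a).ennreal_ofReal.mul hjs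
  have hS : MeasurableSet {y : ℕ × (ℕ × ℝ) | y.2.1 = a} :=
    measurable_snd.fst (measurableSet_singleton a)
  have hf : Measurable fun y : ℕ × (ℕ × ℝ) => ENNReal.ofReal y.2.2 * j y.1 :=
    measurable_snd.snd.ennreal_ofReal.mul (hj.comp measurable_fst)
  have key := ae_lintegral_condDistrib_eq (P := P) hH hY B.measurable_means
    (f := {y : ℕ × (ℕ × ℝ) | y.2.1 = a}.indicator fun y => ENNReal.ofReal y.2.2 * j y.1)
    (g := fun x => ENNReal.ofReal (x a) * j (satArm (B.Rstar - D) x)) (u := fun _ => 1)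
    (v := fun h => condDistrib (B.action ψ t) (B.history ψ t) P h {a})
    (hf.indicator hS) hjs' measurable_const
    (Kernel.measurable_coe _ (measurableSet_singleton a)) ?_
  · simpa using key
  · intro s hs
    have h1 := exists_action_probability' (B := B) ψ t a
      (fun p => s.indicator (fun _ => 1) p.1
        * (ENNReal.ofReal (p.2 a) * j (satArm (B.Rstar - D) p.2)))
      (((measurable_const.indicator hs).comp measurable_fst).mul (hjs'.comp measurable_snd))
    rw [← lintegral_indicator hAm] at h1
    have hE : MeasurableSet {p : ((Fin t → ℕ × ℝ) × (ℕ → ℝ)) × Ξ | ψ.act t p.1.1 p.2 = a} :=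
      ((ψ.measurable_act t).comp (by fun_prop : Measurable
        fun p : ((Fin t → ℕ × ℝ) × (ℕ → ℝ)) × Ξ => (p.1.1, p.2))) (measurableSet_singleton a)
    have h2 := B.lintegral_reward_mul ψ t a
      (K := {p : ((Fin t → ℕ × ℝ) × (ℕ → ℝ)) × Ξ | ψ.act t p.1.1 p.2 = a}.indicator
        fun p => s.indicator (fun _ => 1) p.1.1 * j (satArm (B.Rstar - D) p.1.2))
      (((((measurable_const.indicator hs).comp measurable_fst).mul
        (hjs.comp measurable_snd)).comp measurable_fst).indicator hE)
    refine Eq.trans (lintegral_congr fun ω => ?_) (h2.trans (Eq.trans (lintegral_congr fun ω => ?_)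
      (h1.trans (lintegral_congr fun ω => ?_))))
    · by_cases h3 : B.action ψ t ω = a
      · have h4 : ψ.act t (B.history ψ t ω) (B.ξ ω) = a := h3
        simp only [Set.indicator, Set.mem_ofPred_eq, h3, h4, if_true, satAction_eq,
          B.reward_eq ψ t ω a h3]
        ring
      · have h4 : ψ.act t (B.history ψ t ω) (B.ξ ω) ≠ a := h3
        simp [Set.indicator, h3, h4]
    · by_cases h3 : B.action ψ t ω = a
      · have h4 : ψ.act t (B.history ψ t ω) (B.ξ ω) = a := h3
        simp only [Set.indicator, Set.mem_ofPred_eq, h3, h4, if_true, means]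
        ring
      · have h4 : ψ.act t (B.history ψ t ω) (B.ξ ω) ≠ a := h3
        simp [Set.indicator, h3, h4]
    · by_cases h2 : B.history ψ t ω ∈ s <;> simp [h2]

lemma prior_Iio (c : ℝ) : B.prior (Set.Iio c) = 1 - B.prior (Set.Ici c) := by
  have := B.isProbabilityMeasure_prior
  rw [← Set.compl_Ici, prob_compl_eq_one_sub measurableSet_Ici]

/-- The probability that none of the first `n` arms is satisficing. -/
lemma measure_forall_lt (c : ℝ) (n : ℕ) :
    P {ω | ∀ b < n, B.θ b ω < c} = (1 - B.prior (Set.Ici c)) ^ n := by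
  induction n with
  | zero => simp
  | succ n ih =>
    have hF := measurableSet_forall_lt c n
    have h := (B.indepFun_mean n 0).symm.measure_inter_preimage_eq_mul (s := Set.Iio c)
      (t := {q | q.2.2 ∈ {x : ℕ → ℝ | ∀ b < n, x b < c}}) measurableSet_Iio
      (measurable_snd.snd hF)
    have e1 : B.θ n ⁻¹' Set.Iio c ∩ (fun ω => (B.ξ ω, (B.noise ω,
        Function.update (B.means ω) n 0))) ⁻¹' {q | q.2.2 ∈ {x : ℕ → ℝ | ∀ b < n, x b < c}}
        = {ω | ∀ b < n + 1, B.θ b ω < c} := by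
      ext ω
      simp only [Set.mem_inter_iff, Set.mem_preimage, Set.mem_Iio, Set.mem_ofPred_eq]
      constructor
      · rintro ⟨h1, h2⟩ b hb
        rcases Nat.lt_succ_iff_lt_or_eq.1 hb with h | rfl
        · have := h2 b h
          rwa [Function.update_of_ne h.ne] at this
        · exact h1
      · intro h1
        refine ⟨h1 n (Nat.lt_succ_self n), fun b hb => ?_⟩
        rw [Function.update_of_ne hb.ne]
        exact h1 b (by omega)
    have e2 : (fun ω => (B.ξ ω, (B.noise ω,
        Function.update (B.means ω) n 0))) ⁻¹' {q | q.2.2 ∈ {x : ℕ → ℝ | ∀ b < n, x b < c}}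
        = {ω | ∀ b < n, B.θ b ω < c} := by
      ext ω
      simp only [Set.mem_preimage, Set.mem_ofPred_eq]
      refine forall₂_congr fun b hb => ?_
      rw [Function.update_of_ne hb.ne]
      rfl
    rw [e1, e2, ih, ← Measure.map_apply (B.measurable_θ n) measurableSet_Iio, B.law_θ,
      prior_Iio] at h
    rw [h, pow_succ, mul_comm]

/-- The probability that the first `n` arms all fail decays geometrically. -/
lemma ae_exists_satisficing {c : ℝ} (hc : B.prior (Set.Ici c) ≠ 0) :
    ∀ᵐ ω ∂P, ∃ a, c ≤ B.means ω a := by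
  rw [ae_iff]
  have h1 : (1 - B.prior (Set.Ici c)) < 1 :=
    ENNReal.sub_lt_self ENNReal.one_ne_top one_ne_zero hc
  refine le_antisymm (ge_of_tendsto' (ENNReal.tendsto_pow_atTop_nhds_zero_of_lt_one h1)
    fun n => ?_) bot_le
  rw [← B.measure_forall_lt c n]
  refine measure_mono fun ω hω b _ => ?_
  exact not_le.1 fun h => hω ⟨b, h⟩

lemma ae_ae_means {t : ℕ} {c : ℝ} (hc : B.prior (Set.Ici c) ≠ 0) :
    ∀ᵐ h ∂(P.map (B.history ψ t)), ∀ᵐ x ∂(condDistrib B.means (B.history ψ t) P h),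
      (∀ a, x a ∈ Set.Icc (0 : ℝ) 1) ∧ ∃ a, c ≤ x a := by
  refine ae_ae_condDistrib (B.measurable_history ψ t) B.measurable_means
    (p := fun q => (∀ a, q.2 a ∈ Set.Icc (0 : ℝ) 1) ∧ ∃ a, c ≤ q.2 a) ?_ ?_
  · have h1 : MeasurableSet {x : ℕ → ℝ | ∀ a, x a ∈ Set.Icc (0 : ℝ) 1} := by
      simp only [Set.ofPred_forall]
      exact MeasurableSet.iInter fun a => (measurable_pi_apply a) measurableSet_Icc
    exact measurable_snd (h1.inter (measurableSet_exists_le c))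
  · filter_upwards [B.ae_means_mem, B.ae_exists_satisficing hc] with ω h1 h2
    exact ⟨h1, h2⟩

lemma ae_ae_reward_mem (t : ℕ) (D : ℝ) :
    ∀ᵐ h ∂(P.map (B.history ψ t)), ∀ᵐ y ∂(condDistrib
      (fun ω => (B.satAction D ω, (B.action ψ t ω, B.reward ψ t ω))) (B.history ψ t) P h),
      y.2.2 ∈ Set.Icc (0 : ℝ) 1 := by
  refine ae_ae_condDistrib (B.measurable_history ψ t) ((B.measurable_satAction D).prodMk
    ((B.measurable_action ψ t).prodMk (B.measurable_reward ψ t)))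
    (p := fun q => q.2.2.2 ∈ Set.Icc (0 : ℝ) 1) ?_ (B.ae_reward_mem ψ t)
  exact measurable_snd.snd.snd measurableSet_Icc

end NoisyBandit

/-! ### Regret against information in a single period -/

section SingleStep

/-- The part of the sample space on which the two discrete coordinates both equal `a`. -/
def diagFiber (a : ℕ) : Set (ℕ × (ℕ × ℝ)) := {a} ×ˢ {y : ℕ × ℝ | y.1 = a}

lemma mem_diagFiber {a : ℕ} {y : ℕ × (ℕ × ℝ)} : y ∈ diagFiber a ↔ y.1 = a ∧ y.2.1 = a := by
  simp [diagFiber]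

lemma measurableSet_fst_eq (a : ℕ) : MeasurableSet {y : ℕ × ℝ | y.1 = a} :=
  measurable_fst (measurableSet_singleton a)

lemma measurableSet_diagFiber (a : ℕ) : MeasurableSet (diagFiber a) :=
  (measurableSet_singleton a).prod (measurableSet_fst_eq a)

/-- The integrand vanishes off the diagonal, and the diagonal is the disjoint union of its countably
many fibres. -/
lemma hasSum_setIntegral_diagFiber {ρ : Measure (ℕ × (ℕ × ℝ))} [IsFiniteMeasure ρ]
    {G : ℕ → ℝ → ℝ} (hG : ∀ a, Measurable (G a)) {C : ℝ} (hC : ∀ a r, |G a r| ≤ C) :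
    HasSum (fun a => ∫ y in diagFiber a, G a y.2.2 ∂ρ)
      (∫ y, (if y.1 = y.2.1 then G y.1 y.2.2 else 0) ∂ρ) := by
  have hGm : Measurable fun y : ℕ × (ℕ × ℝ) => G y.1 y.2.2 := by
    refine measurable_from_prod_countable_right fun a => ?_
    exact (hG a).comp measurable_snd
  have hm : Measurable fun y : ℕ × (ℕ × ℝ) => if y.1 = y.2.1 then G y.1 y.2.2 else 0 :=
    Measurable.ite (measurableSet_eq_fun measurable_fst measurable_snd.fst) hGm measurable_const
  have hC0 : 0 ≤ C := (abs_nonneg _).trans (hC 0 0)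
  have hi : Integrable (fun y : ℕ × (ℕ × ℝ) => if y.1 = y.2.1 then G y.1 y.2.2 else 0) ρ := by
    refine Integrable.of_bound hm.aestronglyMeasurable C (Filter.Eventually.of_forall fun y => ?_)
    split_ifs
    · exact hC _ _
    · simpa using hC0
  have hd : Pairwise (Function.onFun Disjoint diagFiber) := by
    intro a b hab
    refine Set.disjoint_left.2 fun y h1 h2 => hab ?_
    rw [mem_diagFiber] at h1 h2
    exact h1.1.symm.trans h2.1
  have h := hasSum_integral_iUnion measurableSet_diagFiber hd hi.integrableOn
  rw [setIntegral_eq_integral_of_forall_compl_eq_zero] at h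
  · refine h.congr_fun ?_
    intro a
    refine setIntegral_congr_fun (measurableSet_diagFiber a) fun y hy => ?_
    rw [mem_diagFiber] at hy
    simp only [hy.1, hy.2, if_true]
  · intro y hy
    refine if_neg fun h => hy ?_
    exact Set.mem_iUnion.2 ⟨y.1, mem_diagFiber.2 ⟨rfl, h.symm⟩⟩

lemma setIntegral_diagFiber_prod {κ : Measure ℕ} {ζ : Measure (ℕ × ℝ)} [IsProbabilityMeasure κ]
    [IsProbabilityMeasure ζ] (a : ℕ) (g : ℝ → ℝ) :
    ∫ y in diagFiber a, g y.2.2 ∂(κ.prod ζ) = κ.real {a} * ∫ y in {y | y.1 = a}, g y.2 ∂ζ := by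
  have := setIntegral_prod_mul (μ := κ) (ν := ζ) (fun _ => (1 : ℝ)) (fun y => g y.2) {a}
    {y | y.1 = a}
  simp only [one_mul, integral_const, smul_eq_mul, mul_one, measureReal_restrict_apply_univ]
    at this
  exact this

/-- The clipped and centred reward. -/
def centred (r : ℝ) : ℝ := max 0 (min 1 r) - 1 / 2

lemma measurable_centred : Measurable centred := by unfold centred; fun_prop

lemma abs_centred_le (r : ℝ) : |centred r| ≤ 1 / 2 := by
  have h1 : 0 ≤ max 0 (min 1 r) := le_max_left _ _
  have h2 : max 0 (min 1 r) ≤ 1 := max_le zero_le_one (min_le_left _ _)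
  rw [centred, abs_le]
  constructor <;> linarith

lemma centred_eq {r : ℝ} (h : r ∈ Set.Icc (0 : ℝ) 1) : centred r = r - 1 / 2 := by
  rw [centred, min_eq_right h.2, max_eq_right h.1]

/-- Clipping is invisible to values that lie in the unit interval almost surely; it only makes the
test function bounded everywhere, as `sq_integral_sub_integral_le_klDiv` demands. -/
lemma setIntegral_centred {X : Type*} [MeasurableSpace X] {ρ : Measure X} [IsFiniteMeasure ρ]
    {R : X → ℝ} (hR : Measurable R) (h : ∀ᵐ y ∂ρ, R y ∈ Set.Icc (0 : ℝ) 1) (s : Set X) :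
    ∫ y in s, centred (R y) ∂ρ = ∫ y in s, R y ∂ρ - ρ.real s / 2 := by
  have hi : Integrable R ρ := by
    refine Integrable.of_bound hR.aestronglyMeasurable 1 ?_
    filter_upwards [h] with y hy
    rw [Real.norm_of_nonneg hy.1]
    exact hy.2
  rw [integral_congr_ae (g := fun y => R y - 1 / 2)
    (ae_restrict_of_ae (h.mono fun y hy => centred_eq hy)),
    integral_sub hi.integrableOn (integrable_const _)]
  simp
  ring

/-- The mean of the reward lost in one step is controlled by the information gained. -/
lemma sq_le_mul_klDiv_of_matching {ν : Measure (ℕ × (ℕ × ℝ))} [IsProbabilityMeasure ν]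
    {κ : Measure ℕ} [IsProbabilityMeasure κ] {ζ : Measure (ℕ × ℝ)} [IsProbabilityMeasure ζ]
    (T : Finset ℕ) {p π M m : ℕ → ℝ} {δ μ₁ μ₀ mθ : ℝ} (hδ : 0 < δ)
    (hp : HasSum p 1) (hπ : HasSum π 1) (hp0 : ∀ a, 0 ≤ p a) (hπ0 : ∀ a, 0 ≤ π a)
    (hκ : ∀ a, κ.real {a} = p a) (hν : ∀ᵐ y ∂ν, y.2.2 ∈ Set.Icc (0 : ℝ) 1)
    (hζ : ∀ᵐ y ∂ζ, y.2 ∈ Set.Icc (0 : ℝ) 1)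
    (hνd : ∀ a, ν.real (diagFiber a) = π a * p a)
    (hνr : ∀ a, ∫ y in diagFiber a, y.2.2 ∂ν = π a * M a)
    (hζd : ∀ a, ζ.real {y | y.1 = a} = π a)
    (hζr : ∀ a, ∫ y in {y | y.1 = a}, y.2 ∂ζ = π a * m a)
    (hT : ∀ a ∈ T, π a = p a) (hM0 : ∀ a, 0 ≤ M a) (hMp : ∀ a, M a ≤ p a)
    (hM : HasSum M mθ) (hMU : ∀ a ∉ T, M a = p a * μ₁) (hmU : ∀ a ∉ T, m a = μ₀)
    (hV : δ / 2 * (∑' a, if a ∈ T then 0 else p a) ^ 2 ≤ ∑' a, if a ∈ T then 0 else π a * p a)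
    (hfin : InformationTheory.klDiv ν (κ.prod ζ) ≠ ∞) :
    (mθ - ∫ y, y.2 ∂ζ) ^ 2
      ≤ (T.card + 2 / δ) * (InformationTheory.klDiv ν (κ.prod ζ)).toReal := by
  set Z := ∑' a, if a ∈ T then 0 else p a with hZ
  set V := ∑' a, if a ∈ T then 0 else π a * p a with hVdef
  have hp1 : ∀ a, p a ≤ 1 := fun a => le_hasSum hp a fun b _ => hp0 b
  have hps : HasSum (fun a => if a ∈ T then 0 else p a) Z :=
    (Summable.of_nonneg_of_le (fun a => by split_ifs; exacts [le_rfl, hp0 a])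
      (fun a => by split_ifs; exacts [hp0 a, le_rfl]) hp.summable).hasSum
  have hvs : HasSum (fun a => if a ∈ T then 0 else π a * p a) V :=
    (Summable.of_nonneg_of_le
      (fun a => by split_ifs; exacts [le_rfl, mul_nonneg (hπ0 a) (hp0 a)])
      (fun a => by
        split_ifs
        exacts [hπ0 a, mul_le_of_le_one_right (hπ0 a) (hp1 a)]) hπ.summable).hasSum
  -- Both laws have total mass one and agree on `T`, so they give the complement of `T` the same
  -- mass `Z`.
  have hπs : HasSum (fun a => if a ∈ T then 0 else π a) Z := by
    have := (hπ.sub hp).add hps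
    rw [sub_self, zero_add] at this
    refine this.congr_fun fun a => ?_
    by_cases ha : a ∈ T
    · simp [ha, hT a ha]
    · simp [ha]
  have hZ0 : 0 ≤ Z := hps.nonneg fun a => by split_ifs; exacts [le_rfl, hp0 a]
  have hV0 : 0 ≤ V := hvs.nonneg fun a => by
    split_ifs; exacts [le_rfl, mul_nonneg (hπ0 a) (hp0 a)]
  -- If `V = 0` then `hV` forces `Z = 0`, so the convention `Z / 0 = 0` is consistent.
  have hZV : Z / V * V = Z := by
    rcases eq_or_ne V 0 with h | h
    · have h1 : Z ^ 2 ≤ 0 := by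
        rw [h] at hV
        by_contra h2
        have := mul_pos (half_pos hδ) (not_le.1 h2)
        linarith
      have h2 : Z = 0 := by nlinarith
      simp [h2]
    · exact div_mul_cancel₀ _ h
  have hZV2 : (Z / V) ^ 2 * V ≤ 2 / δ := by
    rcases eq_or_ne V 0 with h | h
    · rw [h, mul_zero]; positivity
    · have hVpos : 0 < V := lt_of_le_of_ne hV0 h.symm
      rw [div_pow, div_mul_eq_mul_div, div_le_div_iff₀ (by positivity) hδ]
      nlinarith
  -- The weighted arm `a` contributes `wt a * π a * (M a - p a * m a)` to the difference of
  -- integrals, while its regret is `M a - π a * m a`. On `T` the weight `1 / p a` equates the two.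
  -- Off `T` the bracket is `p a * (μ₁ - μ₀)`, and the constant weight `Z / V` makes the total equal
  -- to `Z * (μ₁ - μ₀)`.
  set wt : ℕ → ℝ := fun a => if a ∈ T then (p a)⁻¹ else Z / V with hwt
  set W : ℝ := ∑ a ∈ T, (p a)⁻¹ + Z / V with hW
  have hinv : 0 ≤ ∑ a ∈ T, (p a)⁻¹ := Finset.sum_nonneg fun a _ => inv_nonneg.2 (hp0 a)
  have hZV0 : 0 ≤ Z / V := div_nonneg hZ0 hV0
  have hW0 : 0 ≤ W := add_nonneg hinv hZV0
  have hwt0 : ∀ a, 0 ≤ wt a := fun a => by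
    simp only [hwt]; split_ifs; exacts [inv_nonneg.2 (hp0 a), hZV0]
  have hwtW : ∀ a, wt a ≤ W := fun a => by
    simp only [hwt]
    split_ifs with h
    · have := Finset.single_le_sum (f := fun a => (p a)⁻¹) (fun a _ => inv_nonneg.2 (hp0 a)) h
      linarith
    · linarith
  set f : ℕ × (ℕ × ℝ) → ℝ := fun y => if y.1 = y.2.1 then wt y.1 * centred y.2.2 else 0 with hf
  have hGm : ∀ a, Measurable fun r => wt a * centred r := fun a =>
    measurable_const.mul measurable_centred
  have hGb : ∀ a r, |wt a * centred r| ≤ W := fun a r => by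
    rw [abs_mul, abs_of_nonneg (hwt0 a)]
    have h1 := abs_centred_le r
    have h2 := abs_nonneg (centred r)
    nlinarith [hwt0 a, hwtW a]
  have hfm : Measurable f := by
    refine Measurable.ite (measurableSet_eq_fun measurable_fst measurable_snd.fst) ?_
      measurable_const
    exact ((measurable_of_countable wt).comp measurable_fst).mul
      (measurable_centred.comp measurable_snd.snd)
  have hfb : ∀ y, |f y| ≤ W := fun y => by
    simp only [hf]
    split_ifs
    · exact hGb _ _
    · simpa using hW0
  have key := sq_integral_sub_integral_le_klDiv (μ := ν) (ν := κ.prod ζ) hfm hfb hfin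
  have s1 : HasSum (fun a => wt a * (π a * M a - π a * p a / 2)) (∫ y, f y ∂ν) := by
    refine (hasSum_setIntegral_diagFiber hGm hGb).congr_fun fun a => ?_
    rw [integral_const_mul, setIntegral_centred measurable_snd.snd hν, hνr, hνd]
  have s2 : HasSum (fun a => wt a * (p a * (π a * m a - π a / 2))) (∫ y, f y ∂(κ.prod ζ)) := by
    refine (hasSum_setIntegral_diagFiber hGm hGb).congr_fun fun a => ?_
    rw [integral_const_mul, setIntegral_diagFiber_prod, setIntegral_centred measurable_snd hζ,
      hζr, hζd, hκ]
  have hζi : Integrable (fun y : ℕ × ℝ => y.2) ζ := by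
    refine Integrable.of_bound measurable_snd.aestronglyMeasurable 1 ?_
    filter_upwards [hζ] with y hy
    rw [Real.norm_of_nonneg hy.1]
    exact hy.2
  have s3 : HasSum (fun a => π a * m a) (∫ y, y.2 ∂ζ) := by
    have hd : Pairwise (Function.onFun Disjoint fun a => {y : ℕ × ℝ | y.1 = a}) := by
      intro a b hab
      exact Set.disjoint_left.2 fun y h1 h2 => hab (h1.symm.trans h2)
    have h := hasSum_integral_iUnion (μ := ζ) (f := fun y : ℕ × ℝ => y.2)
      measurableSet_fst_eq hd hζi.integrableOn
    have hu : (⋃ a, {y : ℕ × ℝ | y.1 = a}) = Set.univ := by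
      ext y; simp
    rw [hu, setIntegral_univ] at h
    simpa only [hζr] using h
  have hdiff : mθ - ∫ y, y.2 ∂ζ = ∫ y, f y ∂ν - ∫ y, f y ∂(κ.prod ζ) := by
    have h1 := (hM.sub s3).sub (s1.sub s2)
    have h2 := ((hps.mul_right μ₁).sub (hπs.mul_right μ₀)).sub
      (hvs.mul_left (Z / V * (μ₁ - μ₀)))
    have h3 := h1.unique (h2.congr_fun fun a => ?_)
    · have : Z * μ₁ - Z * μ₀ - Z / V * (μ₁ - μ₀) * V = 0 := by
        linear_combination (μ₀ - μ₁) * hZV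
      linarith
    · by_cases ha : a ∈ T
      · simp only [ha, if_true, hwt, hT a ha]
        rcases eq_or_ne (p a) 0 with h0 | h0
        · have : M a = 0 := le_antisymm ((hMp a).trans h0.le) (hM0 a)
          simp [h0, this]
        · field_simp
          ring
      · simp only [ha, if_false, hwt, hMU a ha, hmU a ha]
        ring
  have s4 : HasSum (fun a => wt a ^ 2 * (π a * p a))
      (∑ a ∈ T, wt a ^ 2 * (π a * p a) + (Z / V) ^ 2 * V) := by
    have h1 : HasSum (fun a => if a ∈ T then wt a ^ 2 * (π a * p a) else 0)
        (∑ a ∈ T, wt a ^ 2 * (π a * p a)) := by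
      have : HasSum (fun a => if a ∈ T then wt a ^ 2 * (π a * p a) else 0)
          (∑ a ∈ T, if a ∈ T then wt a ^ 2 * (π a * p a) else 0) :=
        hasSum_sum_of_ne_finset_zero fun a ha => if_neg ha
      rwa [Finset.sum_congr rfl fun a ha => if_pos ha] at this
    refine (h1.add (hvs.mul_left ((Z / V) ^ 2))).congr_fun fun a => ?_
    by_cases ha : a ∈ T
    · simp [ha]
    · simp [ha, hwt]
  have hQ : ∑ a ∈ T, wt a ^ 2 * (π a * p a) + (Z / V) ^ 2 * V ≤ T.card + 2 / δ := by
    refine add_le_add ?_ hZV2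
    rw [Finset.card_eq_sum_ones, Nat.cast_sum]
    refine Finset.sum_le_sum fun a ha => ?_
    simp only [hwt, ha, if_true, hT a ha]
    rcases eq_or_ne (p a) 0 with h0 | h0
    · simp [h0]
    · field_simp
      simp
  have hG2m : ∀ a, Measurable fun r => (wt a * centred r) ^ 2 := fun a => (hGm a).pow_const 2
  have hG2b : ∀ a r, |(wt a * centred r) ^ 2| ≤ W ^ 2 := fun a r => by
    rw [abs_pow]
    exact pow_le_pow_left₀ (abs_nonneg _) (hGb a r) 2
  have hf2 : ∀ y, f y ^ 2 = if y.1 = y.2.1 then (wt y.1 * centred y.2.2) ^ 2 else 0 := fun y => by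
    simp only [hf]; split_ifs <;> simp
  -- Joint and product law give each diagonal fibre the same mass `π a * p a`, so one bound serves
  -- both. Centring supplies the factor `1 / 4`, which absorbs the constants of the divergence
  -- inequality.
  have sq_bound : ∀ (ρ : Measure (ℕ × (ℕ × ℝ))) [IsProbabilityMeasure ρ],
      (∀ a, ρ.real (diagFiber a) = π a * p a) →
      ∫ y, f y ^ 2 ∂ρ ≤ (T.card + 2 / δ) / 4 := by
    intro ρ _ hρ
    simp_rw [hf2]
    refine (hasSum_le (fun a => ?_) (hasSum_setIntegral_diagFiber hG2m hG2b)
      (s4.div_const 4)).trans (by linarith)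
    have hc : ∀ y ∈ diagFiber a, (wt a * centred y.2.2) ^ 2 ≤ wt a ^ 2 / 4 := fun y _ => by
      have h1 := abs_centred_le y.2.2
      have h2 : centred y.2.2 ^ 2 ≤ (1 / 2) ^ 2 := by
        rw [← sq_abs]; exact pow_le_pow_left₀ (abs_nonneg _) h1 2
      rw [mul_pow]
      nlinarith [sq_nonneg (wt a)]
    refine (setIntegral_mono_on ?_ (integrable_const (wt a ^ 2 / 4)).integrableOn
      (measurableSet_diagFiber a) hc).trans_eq ?_
    · refine (Integrable.of_bound
        ((hG2m a).comp measurable_snd.snd).aestronglyMeasurable (W ^ 2)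
        (Filter.Eventually.of_forall fun y => hG2b a _)).integrableOn
    · rw [setIntegral_const, hρ, smul_eq_mul]
      ring
  have q1 := sq_bound ν hνd
  have q2 := sq_bound (κ.prod ζ) fun a => by
    rw [diagFiber, measureReal_prod_prod, hκ, hζd, mul_comm]
  rw [hdiff]
  have hk0 : 0 ≤ (InformationTheory.klDiv ν (κ.prod ζ)).toReal := ENNReal.toReal_nonneg
  refine key.trans ?_
  calc _ ≤ 2 * (InformationTheory.klDiv ν (κ.prod ζ)).toReal * ((T.card + 2 / δ) / 2) :=
        mul_le_mul_of_nonneg_left (by linarith) (by positivity)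
    _ = _ := by ring

end SingleStep

/-! ### How often an untested satisficing arm is hit -/

section Matching

lemma tsum_ite_mem_eq_measure_compl (κ : Measure ℕ) (T : Finset ℕ) :
    ∑' a, (if a ∈ T then 0 else κ {a}) = κ (T : Set ℕ)ᶜ := by
  rw [← Measure.tsum_indicator_apply_singleton κ _ (T.measurableSet.compl)]
  refine tsum_congr fun a => ?_
  by_cases h : a ∈ T <;> simp [h]

/-- If the atoms off `T` carry a fixed proportion of their tails, then the sum of their squares is
comparable with the square of their sum. -/
lemma mul_sq_le_tsum_sq {κ : Measure ℕ} {T : Finset ℕ} {d : ℝ≥0∞}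
    (h : ∀ a ∉ T, κ {a} = d * κ (Set.Ici a)) :
    d * κ (T : Set ℕ)ᶜ ^ 2 ≤ 2 * ∑' a, (if a ∈ T then 0 else κ {a} * κ {a}) := by
  set u : ℕ → ℝ≥0∞ := fun a => if a ∈ T then 0 else κ {a} with hu
  have htail : ∀ a, ∑' b, (if a ≤ b then u b else 0) ≤ κ (Set.Ici a) := by
    intro a
    rw [← Measure.tsum_indicator_apply_singleton κ _ measurableSet_Ici]
    refine ENNReal.tsum_le_tsum fun b => ?_
    by_cases hb : a ≤ b
    · rw [if_pos hb, Set.indicator_of_mem (Set.mem_Ici.2 hb)]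
      simp only [hu]
      split_ifs
      exacts [zero_le, le_rfl]
    · rw [if_neg hb]
      exact zero_le
  -- Expand the square as a double sum and fold it along `a ≤ b`; the diagonal is counted twice,
  -- hence the inequality. Each inner sum is at most the tail from `a`, and `d` times that tail is
  -- the atom itself.
  have hsq : κ (T : Set ℕ)ᶜ ^ 2 ≤ 2 * ∑' a, u a * ∑' b, (if a ≤ b then u b else 0) := by
    rw [← tsum_ite_mem_eq_measure_compl, sq, ← ENNReal.tsum_mul_right]
    simp_rw [← ENNReal.tsum_mul_left]
    have h1 : ∑' a, ∑' b, u a * u b ≤ ∑' a, ∑' b, (u a * (if a ≤ b then u b else 0)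
        + u b * (if b ≤ a then u a else 0)) := by
      refine ENNReal.tsum_le_tsum fun a => ENNReal.tsum_le_tsum fun b => ?_
      rcases le_total a b with hab | hab
      · rw [if_pos hab]; exact le_self_add
      · rw [if_pos hab, mul_comm (u b)]; exact le_add_self
    refine h1.trans_eq ?_
    simp_rw [ENNReal.tsum_add]
    rw [ENNReal.tsum_comm (f := fun a b => u b * (if b ≤ a then u a else 0)), ← two_mul]
    simp_rw [ENNReal.tsum_mul_left]
  calc d * κ (T : Set ℕ)ᶜ ^ 2
      ≤ d * (2 * ∑' a, u a * ∑' b, (if a ≤ b then u b else 0)) := mul_le_mul_right hsq _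
    _ = 2 * ∑' a, d * (u a * ∑' b, (if a ≤ b then u b else 0)) := by
        rw [mul_left_comm, ENNReal.tsum_mul_left]
    _ ≤ _ := by
        refine mul_le_mul_right (ENNReal.tsum_le_tsum fun a => ?_) _
        by_cases ha : a ∈ T
        · simp [hu, ha]
        · simp only [hu, ha, if_false]
          rw [mul_left_comm]
          refine mul_le_mul_right ?_ _
          refine (mul_le_mul_right (htail a) _).trans_eq (h a ha).symm

/-- One term of the sum suffices. All of the mass of `π` off `T` sits at the first arm `n` outside
`T`, and there the atom of `κ` is `d` times a tail that contains the whole complement of `T`. The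
factor `2` is slack, present only to agree with `mul_sq_le_tsum_sq`. -/
lemma mul_sq_le_tsum_of_first {κ π : Measure ℕ} [IsProbabilityMeasure κ] [IsProbabilityMeasure π]
    {T : Finset ℕ} {d : ℝ≥0∞} (h : ∀ a ∉ T, κ {a} = d * κ (Set.Ici a))
    (hT : ∀ a ∈ T, π {a} = κ {a})
    (hπ : ∀ᵐ a ∂π, a ∉ T → a = sInf {b | b ∉ T}) :
    d * κ (T : Set ℕ)ᶜ ^ 2 ≤ 2 * ∑' a, (if a ∈ T then 0 else π {a} * κ {a}) := by
  set n := sInf {b | b ∉ T} with hn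
  have hnT : n ∉ T := Nat.sInf_mem (s := {b | b ∉ T}) T.exists_notMem
  have hTm : π (T : Set ℕ) = κ (T : Set ℕ) := by
    rw [← sum_measure_singleton, ← sum_measure_singleton]
    exact Finset.sum_congr rfl hT
  have hc : π (T : Set ℕ)ᶜ = κ (T : Set ℕ)ᶜ := by
    rw [prob_compl_eq_one_sub T.measurableSet, prob_compl_eq_one_sub T.measurableSet, hTm]
  have h1 : κ (T : Set ℕ)ᶜ ≤ π {n} := by
    rw [← hc]
    refine measure_mono_ae ?_
    filter_upwards [hπ] with a ha hmem
    exact ha hmem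
  have h2 : κ (T : Set ℕ)ᶜ ≤ κ (Set.Ici n) :=
    measure_mono fun a ha => Nat.sInf_le (s := {b | b ∉ T}) ha
  calc d * κ (T : Set ℕ)ᶜ ^ 2 = κ (T : Set ℕ)ᶜ * (d * κ (T : Set ℕ)ᶜ) := by ring
    _ ≤ π {n} * (d * κ (Set.Ici n)) := by gcongr
    _ = if n ∈ T then 0 else π {n} * κ {n} := by rw [if_neg hnT, h n hnT]
    _ ≤ ∑' a, (if a ∈ T then 0 else π {a} * κ {a}) := ENNReal.le_tsum n
    _ ≤ _ := by
        rw [two_mul]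
        exact le_self_add

end Matching

/-! ### Satisficing Thompson sampling given the history -/

namespace NoisyBandit

variable {Ω : Type u} {𝒲 : Type v} {Ξ : Type w} [MeasurableSpace Ω]
  [MeasurableSpace 𝒲] [MeasurableSpace Ξ] {P : Measure Ω}
  (B : NoisyBandit Ω 𝒲 Ξ P) (ψ : Policy Ξ) [IsProbabilityMeasure P]

lemma ae_satAction_law (t : ℕ) (D : ℝ) :
    condDistrib (B.satAction D) (B.history ψ t) P =ᵐ[P.map (B.history ψ t)]
      (condDistrib B.means (B.history ψ t) P).map (satArm (B.Rstar - D)) :=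
  condDistrib_comp _ B.measurable_means.aemeasurable (measurable_satArm _)

/-- Given the history, the means of untested arms behave as under the prior. -/
lemma ae_untested_satAction (t : ℕ) {D : ℝ} (hD : B.prior (Set.Ici (B.Rstar - D)) ≠ 0) :
    ∀ᵐ h ∂(P.map (B.history ψ t)), ∀ a, a ∉ histArms h →
      condDistrib (B.satAction D) (B.history ψ t) P h {a} = B.prior (Set.Ici (B.Rstar - D))
        * condDistrib (B.satAction D) (B.history ψ t) P h (Set.Ici a) ∧
      ∫⁻ x, ENNReal.ofReal (x a) * (if satArm (B.Rstar - D) x = a then 1 else 0)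
        ∂(condDistrib B.means (B.history ψ t) P h)
          = (∫⁻ r in Set.Ici (B.Rstar - D), ENNReal.ofReal r ∂B.prior)
            * condDistrib (B.satAction D) (B.history ψ t) P h (Set.Ici a) ∧
      ∫⁻ x, ENNReal.ofReal (x a) ∂(condDistrib B.means (B.history ψ t) P h)
        = ∫⁻ r, ENNReal.ofReal r ∂B.prior := by
  set c := B.Rstar - D with hc
  have hkm : ∀ a, Measurable ({x : ℕ → ℝ | ∀ b < a, x b < c}.indicator fun _ => (1 : ℝ≥0∞)) :=
    fun a => measurable_const.indicator (measurableSet_forall_lt c a)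
  have hka : ∀ a (x : ℕ → ℝ), {x : ℕ → ℝ | ∀ b < a, x b < c}.indicator (fun _ => (1 : ℝ≥0∞))
      (Function.update x a 0) = {x : ℕ → ℝ | ∀ b < a, x b < c}.indicator (fun _ => 1) x := by
    intro a x
    have : Function.update x a 0 ∈ {x : ℕ → ℝ | ∀ b < a, x b < c}
        ↔ x ∈ {x : ℕ → ℝ | ∀ b < a, x b < c} := by
      simp only [Set.mem_ofPred_eq]
      refine forall₂_congr fun b hb => ?_
      rw [Function.update_of_ne hb.ne]
    simp only [Set.indicator, this]
  have h1m : Measurable ((Set.Ici c).indicator fun _ : ℝ => (1 : ℝ≥0∞)) :=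
    measurable_const.indicator measurableSet_Ici
  have h2m : Measurable ((Set.Ici c).indicator fun r : ℝ => ENNReal.ofReal r) :=
    ENNReal.measurable_ofReal.indicator measurableSet_Ici
  -- The tail event at `a` concerns only arms before `a`, so it is an admissible `k`. The three
  -- choices of `f` give the mass, the truncated mean and the mean of the prior.
  have f1 := ae_all_iff.2 fun a => B.ae_untested ψ (t := t) a h1m (hkm a) (hka a)
  have f2 := ae_all_iff.2 fun a => B.ae_untested ψ (t := t) a h2m (hkm a) (hka a)
  have f3 := ae_all_iff.2 fun a => B.ae_untested ψ (t := t) a ENNReal.measurable_ofReal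
    (k := fun _ => 1) measurable_const fun _ => rfl
  filter_upwards [f1, f2, f3, B.ae_ae_means ψ (t := t) hD, B.ae_satAction_law ψ t D]
    with h g1 g2 g3 g4 g5 a ha
  have e1 : condDistrib (B.satAction D) (B.history ψ t) P h (Set.Ici a)
      = ∫⁻ x, {x : ℕ → ℝ | ∀ b < a, x b < c}.indicator (fun _ => 1) x
        ∂(condDistrib B.means (B.history ψ t) P h) := by
    rw [g5, Kernel.map_apply' _ (measurable_satArm c) _ measurableSet_Ici,
      lintegral_indicator_const (measurableSet_forall_lt c a), one_mul]
    refine measure_congr ?_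
    filter_upwards [g4] with x hx
    exact propext (le_satArm_iff hx.2 a)
  have e2 : condDistrib (B.satAction D) (B.history ψ t) P h {a}
      = ∫⁻ x, (Set.Ici c).indicator (fun _ => 1) (x a)
        * {x : ℕ → ℝ | ∀ b < a, x b < c}.indicator (fun _ => 1) x
        ∂(condDistrib B.means (B.history ψ t) P h) := by
    rw [g5, Kernel.map_apply' _ (measurable_satArm c) _ (measurableSet_singleton a),
      ← lintegral_indicator_one ((measurable_satArm c) (measurableSet_singleton a))]
    refine lintegral_congr_ae ?_
    filter_upwards [g4] with x hx
    have := satArm_eq_iff hx.2 a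
    by_cases h1 : c ≤ x a <;> by_cases h2 : ∀ b < a, x b < c <;>
      simp [Set.indicator, this, h1, h2]
  refine ⟨?_, ?_, ?_⟩
  · rw [e1, e2, g1 a ha, lintegral_indicator_const measurableSet_Ici, one_mul]
  · rw [e1, ← lintegral_indicator measurableSet_Ici, ← g2 a ha]
    refine lintegral_congr_ae ?_
    filter_upwards [g4] with x hx
    have := satArm_eq_iff hx.2 a
    by_cases h1 : c ≤ x a <;> by_cases h2 : ∀ b < a, x b < c <;>
      simp [Set.indicator, this, h1, h2]
  · simpa using g3 a ha

/-- Being tested is decided by the history, so its indicator factors out of the conditional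
expectation and can be cancelled on histories that contain `a`. -/
lemma ae_condDistrib_real_eq_of_condExp {X Y : Ω → ℕ} (hX : Measurable X) (hY : Measurable Y)
    (t a : ℕ) (h : P⟦{ω | X ω = a ∧ a ∈ B.tested ψ t ω} | B.histSigma ψ t⟧
      =ᵐ[P] P⟦{ω | Y ω = a ∧ a ∈ B.tested ψ t ω} | B.histSigma ψ t⟧) :
    ∀ᵐ h ∂(P.map (B.history ψ t)), a ∈ histArms h →
      condDistrib X (B.history ψ t) P h {a} = condDistrib Y (B.history ψ t) P h {a} := by
  have hH := B.measurable_history ψ t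
  have hE : MeasurableSet {p : (Fin t → ℕ × ℝ) × ℕ | p.2 = a ∧ a ∈ histArms p.1} :=
    measurableSet_histArms fun s b => b = a ∧ a ∈ s
  have key : ∀ {X : Ω → ℕ}, Measurable X →
      P⟦{ω | X ω = a ∧ a ∈ B.tested ψ t ω} | B.histSigma ψ t⟧ =ᵐ[P] fun ω =>
        if a ∈ histArms (B.history ψ t ω) then
          (condDistrib X (B.history ψ t) P (B.history ψ t ω)).real {a} else 0 := by
    intro X hX
    have h1 := condExp_prod_ae_eq_integral_condDistrib (μ := P) hH hX.aemeasurable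
      (f := {p : (Fin t → ℕ × ℝ) × ℕ | p.2 = a ∧ a ∈ histArms p.1}.indicator fun _ => (1 : ℝ))
      (stronglyMeasurable_const.indicator hE)
      ((integrable_const (1 : ℝ)).indicator ((hH.prodMk hX) hE))
    have h2 : (fun ω => {p : (Fin t → ℕ × ℝ) × ℕ | p.2 = a ∧ a ∈ histArms p.1}.indicator
        (fun _ => (1 : ℝ)) (B.history ψ t ω, X ω))
        = {ω | X ω = a ∧ a ∈ B.tested ψ t ω}.indicator fun _ => (1 : ℝ) := by
      funext ω
      simp only [Set.indicator, Set.mem_ofPred_eq, mem_tested_iff]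
    rw [h2] at h1
    refine h1.trans (Filter.Eventually.of_forall fun ω => ?_)
    by_cases ha : a ∈ histArms (B.history ψ t ω)
    · simp only [ha, if_true]
      have h3 : ∀ y : ℕ, {p : (Fin t → ℕ × ℝ) × ℕ | p.2 = a ∧ a ∈ histArms p.1}.indicator
          (fun _ => (1 : ℝ)) (B.history ψ t ω, y) = ({a} : Set ℕ).indicator (fun _ => 1) y := by
        intro y
        simp [Set.indicator, ha]
      simp_rw [h3]
      rw [integral_indicator_const _ (measurableSet_singleton a)]
      simp
    · simp [ha]
  have h1 := ((key hX).symm.trans h).trans (key hY)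
  rw [ae_map_iff hH.aemeasurable]
  · filter_upwards [h1] with ω hω ha
    simp only [ha, if_true] at hω
    exact (measureReal_eq_measureReal_iff).1 hω
  · refine MeasurableSet.imp (measurableSet_histArms' fun s => a ∈ s) ?_
    exact measurableSet_eq_fun (Kernel.measurable_coe _ (measurableSet_singleton a))
      (Kernel.measurable_coe _ (measurableSet_singleton a))

lemma ae_condDistrib_eq_of_condExp {X Y : Ω → ℕ} (hX : Measurable X) (hY : Measurable Y)
    (t a : ℕ) (h : P⟦{ω | X ω = a} | B.histSigma ψ t⟧
      =ᵐ[P] P⟦{ω | Y ω = a} | B.histSigma ψ t⟧) :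
    ∀ᵐ h ∂(P.map (B.history ψ t)),
      condDistrib X (B.history ψ t) P h {a} = condDistrib Y (B.history ψ t) P h {a} := by
  have hH := B.measurable_history ψ t
  have h1 := ((condDistrib_ae_eq_condExp (μ := P) hH hX (measurableSet_singleton a)).trans h).trans
    (condDistrib_ae_eq_condExp (μ := P) hH hY (measurableSet_singleton a)).symm
  rw [ae_map_iff hH.aemeasurable]
  · filter_upwards [h1] with ω hω
    exact (measureReal_eq_measureReal_iff).1 hω
  · exact measurableSet_eq_fun (Kernel.measurable_coe _ (measurableSet_singleton a))
      (Kernel.measurable_coe _ (measurableSet_singleton a))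

/-- What the two forms of satisficing Thompson sampling have in common. -/
lemma ae_matching_of_isSTS {D : ℝ} (hD : B.prior (Set.Ici (B.Rstar - D)) ≠ 0)
    (hψ : B.IsSTS ψ D) (t : ℕ) :
    ∀ᵐ h ∂(P.map (B.history ψ t)),
      (∀ a ∈ histArms h, condDistrib (B.action ψ t) (B.history ψ t) P h {a}
        = condDistrib (B.satAction D) (B.history ψ t) P h {a}) ∧
      B.prior (Set.Ici (B.Rstar - D))
        * condDistrib (B.satAction D) (B.history ψ t) P h (histArms h : Set ℕ)ᶜ ^ 2
        ≤ 2 * ∑' a, (if a ∈ histArms h then 0 else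
          condDistrib (B.action ψ t) (B.history ψ t) P h {a}
            * condDistrib (B.satAction D) (B.history ψ t) P h {a}) := by
  have hA := B.measurable_action ψ t
  have hS := B.measurable_satAction D
  rcases hψ with hψ | ⟨hψ1, hψ2⟩
  · have h1 := ae_all_iff.2 fun a => B.ae_condDistrib_eq_of_condExp ψ hA hS t a (hψ t a)
    filter_upwards [h1, B.ae_untested_satAction ψ t hD] with h g1 g2
    refine ⟨fun a _ => g1 a, ?_⟩
    simp_rw [g1]
    exact mul_sq_le_tsum_sq fun a ha => (g2 a ha).1
  · have h1 := ae_all_iff.2 fun a =>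
      B.ae_condDistrib_real_eq_of_condExp ψ hA hS t a (hψ1 t a)
    have h2 := ae_ae_condDistrib (P := P) (B.measurable_history ψ t) hA
      (p := fun q => q.2 ∉ histArms q.1 → q.2 = sInf {b | b ∉ histArms q.1})
      (measurableSet_histArms fun s b => b ∉ s → b = sInf {b | b ∉ s}) (by
        filter_upwards [hψ2 t] with ω hω
        simpa only [mem_tested_iff] using hω)
    filter_upwards [h1, h2, B.ae_untested_satAction ψ t hD] with h g1 g2 g3
    exact ⟨g1, mul_sq_le_tsum_of_first (fun a ha => (g3 a ha).1) g1 g2⟩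

end NoisyBandit

lemma hasSum_measureReal_singleton_nat (κ : Measure ℕ) [IsProbabilityMeasure κ] :
    HasSum (fun a => κ.real {a}) 1 := by
  have h := tsum_ite_mem_eq_measure_compl κ ∅
  simp only [Finset.notMem_empty, if_false, Finset.coe_empty, Set.compl_empty, measure_univ] at h
  have h1 := ENNReal.hasSum_toReal (f := fun a => κ {a}) (by rw [h]; exact ENNReal.one_ne_top)
  rwa [← ENNReal.tsum_toReal_eq fun a => measure_ne_top _ _, h, ENNReal.toReal_one] at h1

lemma integral_integral_condDistrib {Ω U S : Type*} [MeasurableSpace Ω] [MeasurableSpace U]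
    [MeasurableSpace S] [StandardBorelSpace S] [Nonempty S] {P : Measure Ω}
    [IsProbabilityMeasure P] {H : Ω → U} {Y : Ω → S} (hH : Measurable H) (hY : Measurable Y)
    {f : S → ℝ} (hf : Measurable f) (hi : Integrable (fun ω => f (Y ω)) P) :
    Integrable (fun h => ∫ y, f y ∂(condDistrib Y H P h)) (P.map H) ∧
      ∫ h, ∫ y, f y ∂(condDistrib Y H P h) ∂(P.map H) = ∫ ω, f (Y ω) ∂P := by
  have hfm : Measurable fun p : U × S => f p.2 := hf.comp measurable_snd
  have hi' : Integrable (fun p : U × S => f p.2) (P.map fun ω => (H ω, Y ω)) :=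
    (integrable_map_measure hfm.aestronglyMeasurable (hH.prodMk hY).aemeasurable).2 hi
  refine ⟨hi'.integral_condDistrib_map hY.aemeasurable, ?_⟩
  have h1 := hi'
  rw [← compProd_map_condDistrib hY.aemeasurable] at h1
  rw [← Measure.integral_compProd h1, compProd_map_condDistrib hY.aemeasurable,
    integral_map (hH.prodMk hY).aemeasurable hfm.aestronglyMeasurable]

namespace NoisyBandit

variable {Ω : Type u} {𝒲 : Type v} {Ξ : Type w} [MeasurableSpace Ω]
  [MeasurableSpace 𝒲] [MeasurableSpace Ξ] {P : Measure Ω}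
  (B : NoisyBandit Ω 𝒲 Ξ P) (ψ : Policy Ξ) [IsProbabilityMeasure P]

lemma ofReal_delta (D : ℝ) : ENNReal.ofReal (B.delta D) = B.prior (Set.Ici (B.Rstar - D)) := by
  have := B.isProbabilityMeasure_prior
  exact ofReal_measureReal (measure_ne_top _ _)

lemma prior_Ici_ne_zero {D : ℝ} (hδ : 0 < B.delta D) :
    B.prior (Set.Ici (B.Rstar - D)) ≠ 0 := by
  rw [← ofReal_delta]
  exact (ENNReal.ofReal_pos.2 hδ).ne'

/-- Given the history, the squared one-step regret is controlled by the information gained. -/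
lemma ae_sq_le_mul_klDiv {D : ℝ} (hδ : 0 < B.delta D) (hψ : B.IsSTS ψ D) (t : ℕ) :
    ∀ᵐ h ∂(P.map (B.history ψ t)),
      InformationTheory.klDiv
        (condDistrib (fun ω => (B.satAction D ω, (B.action ψ t ω, B.reward ψ t ω)))
          (B.history ψ t) P h)
        ((condDistrib (B.satAction D) (B.history ψ t) P h).prod
          (condDistrib (fun ω => (B.action ψ t ω, B.reward ψ t ω)) (B.history ψ t) P h)) ≠ ∞ →
      (∫ x, x (satArm (B.Rstar - D) x) ∂(condDistrib B.means (B.history ψ t) P h)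
        - ∫ y, y.2
          ∂(condDistrib (fun ω => (B.action ψ t ω, B.reward ψ t ω)) (B.history ψ t) P h)) ^ 2
      ≤ ((histArms h).card + 2 / B.delta D) * (InformationTheory.klDiv
        (condDistrib (fun ω => (B.satAction D ω, (B.action ψ t ω, B.reward ψ t ω)))
          (B.history ψ t) P h)
        ((condDistrib (B.satAction D) (B.history ψ t) P h).prod
          (condDistrib (fun ω => (B.action ψ t ω, B.reward ψ t ω))
            (B.history ψ t) P h))).toReal := by
  have hD := B.prior_Ici_ne_zero hδ
  have := B.isProbabilityMeasure_prior
  have hH := B.measurable_history ψ t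
  have hA := B.measurable_action ψ t
  have hAR := hA.prodMk (B.measurable_reward ψ t)
  have hS := B.measurable_satAction D
  have hfst : condDistrib (B.action ψ t) (B.history ψ t) P =ᵐ[P.map (B.history ψ t)]
      (condDistrib (fun ω => (B.action ψ t ω, B.reward ψ t ω)) (B.history ψ t) P).map Prod.fst :=
    condDistrib_comp _ hAR.aemeasurable measurable_fst
  have hsnd : condDistrib (fun ω => (B.action ψ t ω, B.reward ψ t ω)) (B.history ψ t) P
      =ᵐ[P.map (B.history ψ t)]
      (condDistrib (fun ω => (B.satAction D ω, (B.action ψ t ω, B.reward ψ t ω)))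
        (B.history ψ t) P).map Prod.snd :=
    condDistrib_comp _ (hS.prodMk hAR).aemeasurable measurable_snd
  have k1 := ae_all_iff.2 fun a => B.ae_lintegral_action ψ t a D fun b => if b = a then 1 else 0
  have k2 := ae_all_iff.2 fun a =>
    B.ae_lintegral_action_reward ψ t a D fun b => if b = a then 1 else 0
  have k3 := ae_all_iff.2 fun a => B.ae_lintegral_action_reward ψ t a D fun _ => 1
  filter_upwards [hfst, hsnd, k1, k2, k3, B.ae_satAction_law ψ t D, B.ae_ae_means ψ (t := t) hD,
    B.ae_ae_reward_mem ψ t D, B.ae_untested_satAction ψ t hD, B.ae_matching_of_isSTS ψ hD hψ t]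
    with h hfst hsnd k1 k2 k3 hlaw hmeans hrew hunt hmatch hfin
  set c := B.Rstar - D with hc
  set κ := condDistrib (B.satAction D) (B.history ψ t) P h with hκ
  set lam := condDistrib (B.action ψ t) (B.history ψ t) P h with hlam
  set τ := condDistrib B.means (B.history ψ t) P h with hτ
  set ζ := condDistrib (fun ω => (B.action ψ t ω, B.reward ψ t ω)) (B.history ψ t) P h with hζ
  set ν := condDistrib (fun ω => (B.satAction D ω, (B.action ψ t ω, B.reward ψ t ω)))
    (B.history ψ t) P h with hν
  rw [Kernel.map_apply _ measurable_fst] at hfst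
  rw [Kernel.map_apply _ measurable_snd] at hsnd
  rw [Kernel.map_apply _ (measurable_satArm c)] at hlaw
  obtain ⟨hT, hV⟩ := hmatch
  have hκτ : ∀ a, κ {a} = ∫⁻ x, (if satArm c x = a then 1 else 0) ∂τ := by
    intro a
    rw [hlaw, Measure.map_apply (measurable_satArm c) (measurableSet_singleton a),
      ← lintegral_indicator_one ((measurable_satArm c) (measurableSet_singleton a))]
    exact lintegral_congr fun x => by simp [Set.indicator]
  have hM_le : ∀ a, ∫⁻ x, ENNReal.ofReal (x a) * (if satArm c x = a then 1 else 0) ∂τ ≤ κ {a} := by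
    intro a
    rw [hκτ]
    refine lintegral_mono_ae ?_
    filter_upwards [hmeans] with x hx
    have h1 : ENNReal.ofReal (x a) ≤ 1 := ENNReal.ofReal_le_one.2 (hx.1 a).2
    exact mul_le_of_le_one_left zero_le h1
  have hM_ne : ∀ a, ∫⁻ x, ENNReal.ofReal (x a) * (if satArm c x = a then 1 else 0) ∂τ ≠ ∞ :=
    fun a => ((hM_le a).trans_lt (measure_lt_top _ _)).ne
  have hζm : ∀ᵐ y ∂ζ, y.2 ∈ Set.Icc (0 : ℝ) 1 := by
    rw [hsnd]
    exact (ae_map_iff measurable_snd.aemeasurable (measurable_snd measurableSet_Icc)).2 hrew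
  have hsatm : Measurable fun x : ℕ → ℝ => x (satArm c x) := by
    have h1 : Measurable fun q : ℕ × (ℕ → ℝ) => q.2 q.1 :=
      measurable_from_prod_countable_right fun a => measurable_pi_apply a
    exact h1.comp ((measurable_satArm c).prodMk measurable_id)
  have hind : ∀ a, ∀ y, (diagFiber a).indicator (fun y => ENNReal.ofReal y.2.2) y
      = {y : ℕ × (ℕ × ℝ) | y.2.1 = a}.indicator
        (fun y => ENNReal.ofReal y.2.2 * (if y.1 = a then 1 else 0)) y := by
    intro a y
    by_cases h1 : y.1 = a <;> by_cases h2 : y.2.1 = a <;>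
      simp [Set.indicator, mem_diagFiber, h1, h2]
  have hind1 : ∀ a, ∀ y, (diagFiber a).indicator (fun _ => (1 : ℝ≥0∞)) y
      = {y : ℕ × (ℕ × ℝ) | y.2.1 = a}.indicator (fun y => (if y.1 = a then 1 else 0)) y := by
    intro a y
    by_cases h1 : y.1 = a <;> by_cases h2 : y.2.1 = a <;>
      simp [Set.indicator, mem_diagFiber, h1, h2]
  have hνd : ∀ a, ν (diagFiber a) = lam {a} * κ {a} := by
    intro a
    rw [hκτ, ← k1 a, ← lintegral_indicator_one (measurableSet_diagFiber a)]
    exact lintegral_congr fun y => hind1 a y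
  have hd0 : (B.prior (Set.Ici c)).toReal = B.delta D := rfl
  refine sq_le_mul_klDiv_of_matching (histArms h) (p := fun a => κ.real {a})
    (π := fun a => lam.real {a})
    (M := fun a => (∫⁻ x, ENNReal.ofReal (x a) * (if satArm c x = a then 1 else 0) ∂τ).toReal)
    (m := fun a => (∫⁻ x, ENNReal.ofReal (x a) ∂τ).toReal)
    -- `μ₁` is the prior mean conditioned on being satisficing and `μ₀` the plain prior mean;
    -- neither depends on the untested arm.
    (μ₁ := (∫⁻ r in Set.Ici c, ENNReal.ofReal r ∂B.prior).toReal / B.delta D)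
    (μ₀ := (∫⁻ r, ENNReal.ofReal r ∂B.prior).toReal) hδ
    (hasSum_measureReal_singleton_nat κ) (hasSum_measureReal_singleton_nat lam)
    (fun a => measureReal_nonneg) (fun a => measureReal_nonneg) (fun a => rfl) hrew hζm
    ?_ ?_ ?_ ?_ ?_ (fun a => ENNReal.toReal_nonneg) ?_ ?_ ?_ ?_ ?_ hfin
  · intro a
    rw [measureReal_def, hνd, ENNReal.toReal_mul]
    rfl
  · intro a
    rw [integral_eq_lintegral_of_nonneg_ae
      (ae_restrict_of_ae (hrew.mono fun y hy => hy.1)) measurable_snd.snd.aestronglyMeasurable,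
      ← lintegral_indicator (measurableSet_diagFiber a), measureReal_def, ← ENNReal.toReal_mul,
      ← k2 a, lintegral_congr (hind a)]
  · intro a
    rw [hfst, map_measureReal_apply measurable_fst (measurableSet_singleton a)]
    rfl
  · intro a
    rw [integral_eq_lintegral_of_nonneg_ae
      (ae_restrict_of_ae (hζm.mono fun y hy => hy.1)) measurable_snd.aestronglyMeasurable, hsnd,
      setLIntegral_map (measurableSet_fst_eq a) measurable_snd.ennreal_ofReal measurable_snd,
      measureReal_def, ← ENNReal.toReal_mul]
    have := k3 a
    simp only [mul_one] at this
    rw [← this, ← lintegral_indicator (measurable_snd (measurableSet_fst_eq a))]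
    rfl
  · intro a ha
    exact congrArg ENNReal.toReal (hT a ha)
  · intro a
    exact ENNReal.toReal_mono (measure_ne_top _ _) (hM_le a)
  · have h1 : ∫ x, x (satArm c x) ∂τ = (∑' a, ∫⁻ x, ENNReal.ofReal (x a)
        * (if satArm c x = a then 1 else 0) ∂τ).toReal := by
      rw [integral_eq_lintegral_of_nonneg_ae (hmeans.mono fun x hx => (hx.1 _).1)
        hsatm.aestronglyMeasurable, ← lintegral_tsum]
      · congr 1
        refine lintegral_congr fun x => ?_
        rw [tsum_eq_single (satArm c x)]
        · simp
        · intro a ha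
          simp [ha.symm]
      · intro a
        exact ((measurable_pi_apply a).ennreal_ofReal.mul (Measurable.ite
          ((measurable_satArm c) (measurableSet_singleton a)) measurable_const
          measurable_const)).aemeasurable
    have h2 : ∑' a, ∫⁻ x, ENNReal.ofReal (x a) * (if satArm c x = a then 1 else 0) ∂τ ≠ ∞ := by
      have h3 := tsum_ite_mem_eq_measure_compl κ ∅
      simp only [Finset.notMem_empty, if_false, Finset.coe_empty, Set.compl_empty] at h3
      exact ((ENNReal.tsum_le_tsum hM_le).trans_lt (h3 ▸ measure_lt_top κ _)).ne
    rw [h1, ENNReal.tsum_toReal_eq hM_ne]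
    exact ENNReal.hasSum_toReal h2
  · intro a ha
    obtain ⟨h1, h2, -⟩ := hunt a ha
    have e1 : κ.real {a} = B.delta D * κ.real (Set.Ici a) := by
      rw [measureReal_def, h1, ENNReal.toReal_mul, hd0]
      rfl
    simp only [h2, ENNReal.toReal_mul, e1, ← measureReal_def]
    field_simp
  · intro a ha
    exact congrArg ENNReal.toReal (hunt a ha).2.2
  · have hle1 : ∀ a, (if a ∈ histArms h then 0 else lam {a} * κ {a}) ≤ lam {a} := fun a => by
      split_ifs
      · exact zero_le
      · exact mul_le_of_le_one_right zero_le prob_le_one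
    have hfinV : ∑' a, (if a ∈ histArms h then 0 else lam {a} * κ {a}) ≠ ∞ := by
      have h3 := tsum_ite_mem_eq_measure_compl lam ∅
      simp only [Finset.notMem_empty, if_false, Finset.coe_empty, Set.compl_empty] at h3
      exact ((ENNReal.tsum_le_tsum hle1).trans_lt (h3 ▸ measure_lt_top lam _)).ne
    have h4 := ENNReal.toReal_mono (ENNReal.mul_ne_top (by simp) hfinV) hV
    rw [ENNReal.toReal_mul, ENNReal.toReal_mul, ENNReal.toReal_pow, hd0,
      ← tsum_ite_mem_eq_measure_compl, ENNReal.tsum_toReal_eq, ENNReal.tsum_toReal_eq] at h4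
    · have e1 : ∀ a, (if a ∈ histArms h then (0 : ℝ≥0∞) else κ {a}).toReal
          = if a ∈ histArms h then 0 else κ.real {a} := fun a => by
        split_ifs <;> simp [measureReal_def]
      have e2 : ∀ a, (if a ∈ histArms h then (0 : ℝ≥0∞) else lam {a} * κ {a}).toReal
          = if a ∈ histArms h then 0 else lam.real {a} * κ.real {a} := fun a => by
        split_ifs <;> simp [measureReal_def]
      simp only [e1, e2, ENNReal.toReal_ofNat] at h4
      linarith
    · intro a
      exact ((hle1 a).trans_lt (measure_lt_top _ _)).ne
    · intro a
      split_ifs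
      · simp
      · exact measure_ne_top _ _

end NoisyBandit

/-! ### Expected regret and the number of tested arms -/

namespace NoisyBandit

variable {Ω : Type u} {𝒲 : Type v} {Ξ : Type w} [MeasurableSpace Ω]
  [MeasurableSpace 𝒲] [MeasurableSpace Ξ] {P : Measure Ω}
  (B : NoisyBandit Ω 𝒲 Ξ P) (ψ : Policy Ξ)

lemma measurable_satMean (c : ℝ) : Measurable fun x : ℕ → ℝ => x (satArm c x) := by
  have h1 : Measurable fun q : ℕ × (ℕ → ℝ) => q.2 q.1 :=
    measurable_from_prod_countable_right fun a => measurable_pi_apply a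
  exact h1.comp ((measurable_satArm c).prodMk measurable_id)

/-- The expected number of arms tested before period `t`. -/
def expectedTested (t : ℕ) : ℝ := ∫ ω, ((histArms (B.history ψ t ω)).card : ℝ) ∂P

/-- The probability that the satisficing action is untested before period `t`. -/
def untestedProb (D : ℝ) (t : ℕ) : ℝ :=
  P.real {ω | B.satAction D ω ∉ histArms (B.history ψ t ω)}

lemma measurable_card_histArms (t : ℕ) :
    Measurable fun h : Fin t → ℕ × ℝ => ((histArms h).card : ℝ) := by
  have h1 : Measurable fun h : Fin t → ℕ × ℝ => (fun i => (h i).1 : Fin t → ℕ) := by fun_prop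
  exact (measurable_of_countable fun s : Fin t → ℕ => ((Finset.univ.image s).card : ℝ)).comp h1

lemma card_histArms_le {t : ℕ} (h : Fin t → ℕ × ℝ) : (histArms h).card ≤ t := by
  simpa [histArms] using Finset.card_image_le (s := Finset.univ) (f := fun i : Fin t => (h i).1)

lemma integrable_card_histArms [IsProbabilityMeasure P] (t : ℕ) :
    Integrable (fun ω => ((histArms (B.history ψ t ω)).card : ℝ)) P := by
  refine Integrable.of_bound ((measurable_card_histArms t).comp
    (B.measurable_history ψ t)).aestronglyMeasurable t (Filter.Eventually.of_forall fun ω => ?_)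
  rw [Real.norm_of_nonneg (Nat.cast_nonneg _)]
  exact_mod_cast card_histArms_le _

lemma integrable_satMean [IsProbabilityMeasure P] (D : ℝ) :
    Integrable (fun ω => B.θ (B.satAction D ω) ω) P := by
  refine Integrable.of_bound ((measurable_satMean (B.Rstar - D)).comp
    B.measurable_means).aestronglyMeasurable 1 ?_
  filter_upwards [B.ae_means_mem] with ω h
  have := h (satArm (B.Rstar - D) (B.means ω))
  change ‖B.means ω (satArm (B.Rstar - D) (B.means ω))‖ ≤ 1
  rw [Real.norm_of_nonneg this.1]
  exact this.2

lemma integrable_reward [IsProbabilityMeasure P] (t : ℕ) : Integrable (B.reward ψ t) P := by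
  refine Integrable.of_bound (B.measurable_reward ψ t).aestronglyMeasurable 1 ?_
  filter_upwards [B.ae_reward_mem ψ t] with ω h
  rw [Real.norm_of_nonneg h.1]
  exact h.2

/-- The squared expected one-step regret is controlled by the information gained. -/
lemma ofReal_sq_le_mul_condMutualInfo [IsProbabilityMeasure P] {D : ℝ} (hδ : 0 < B.delta D)
    (hψ : B.IsSTS ψ D) (t : ℕ) :
    ENNReal.ofReal ((∫ ω, (B.θ (B.satAction D ω) ω - B.reward ψ t ω) ∂P) ^ 2)
      ≤ ENNReal.ofReal (B.expectedTested ψ t + 2 / B.delta D) *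
        condMutualInfo P (B.satAction D) (fun ω => (B.action ψ t ω, B.reward ψ t ω))
          (B.history ψ t) := by
  have hH := B.measurable_history ψ t
  have hAR := (B.measurable_action ψ t).prodMk (B.measurable_reward ψ t)
  have : IsProbabilityMeasure (P.map (B.history ψ t)) :=
    Measure.isProbabilityMeasure_map hH.aemeasurable
  set I := condMutualInfo P (B.satAction D) (fun ω => (B.action ψ t ω, B.reward ψ t ω))
    (B.history ψ t) with hI
  obtain ⟨i1, e1⟩ := integral_integral_condDistrib hH B.measurable_means
    (measurable_satMean (B.Rstar - D)) (B.integrable_satMean D)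
  obtain ⟨i2, e2⟩ := integral_integral_condDistrib hH hAR measurable_snd
    (B.integrable_reward ψ t)
  set d : (Fin t → ℕ × ℝ) → ℝ := fun h =>
    ∫ x, x (satArm (B.Rstar - D) x) ∂(condDistrib B.means (B.history ψ t) P h)
      - ∫ y, y.2
        ∂(condDistrib (fun ω => (B.action ψ t ω, B.reward ψ t ω)) (B.history ψ t) P h) with hd
  have hdi : Integrable d (P.map (B.history ψ t)) := i1.sub i2
  have hdE : ∫ h, d h ∂(P.map (B.history ψ t))
      = ∫ ω, (B.θ (B.satAction D ω) ω - B.reward ψ t ω) ∂P := by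
    rw [integral_sub i1 i2, e1, e2, integral_sub (B.integrable_satMean D) (B.integrable_reward ψ t)]
    rfl
  set c : (Fin t → ℕ × ℝ) → ℝ := fun h => (histArms h).card + 2 / B.delta D with hc
  have hc0 : ∀ h, 0 < c h := fun h => add_pos_of_nonneg_of_pos (Nat.cast_nonneg _) (by positivity)
  have hcm : Measurable c := (measurable_card_histArms t).add_const _
  have hci' : Integrable (fun ω => c (B.history ψ t ω)) P :=
    (B.integrable_card_histArms ψ t).add (integrable_const _)
  have hci : Integrable c (P.map (B.history ψ t)) :=
    (integrable_map_measure hcm.aestronglyMeasurable hH.aemeasurable).2 hci'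
  have hcE : ∫ h, c h ∂(P.map (B.history ψ t)) = B.expectedTested ψ t + 2 / B.delta D := by
    rw [integral_map hH.aemeasurable hcm.aestronglyMeasurable]
    simp only [hc]
    rw [integral_add (B.integrable_card_histArms ψ t) (integrable_const _)]
    simp [expectedTested]
  have hcEpos : 0 < B.expectedTested ψ t + 2 / B.delta D :=
    add_pos_of_nonneg_of_pos (integral_nonneg fun ω => Nat.cast_nonneg _) (by positivity)
  by_cases htop : I = ∞
  · rw [htop, ENNReal.mul_top (ENNReal.ofReal_pos.2 hcEpos).ne']
    exact le_top
  have hle : ∫⁻ h, ENNReal.ofReal (d h ^ 2 / c h) ∂(P.map (B.history ψ t)) ≤ I := by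
    refine lintegral_mono_ae ?_
    filter_upwards [B.ae_sq_le_mul_klDiv ψ hδ hψ t] with h hh
    by_cases hk : InformationTheory.klDiv
        (condDistrib (fun ω => (B.satAction D ω, (B.action ψ t ω, B.reward ψ t ω)))
          (B.history ψ t) P h)
        ((condDistrib (B.satAction D) (B.history ψ t) P h).prod
          (condDistrib (fun ω => (B.action ψ t ω, B.reward ψ t ω)) (B.history ψ t) P h)) = ∞
    · rw [hk]; exact le_top
    · rw [← ENNReal.ofReal_toReal hk]
      refine ENNReal.ofReal_le_ofReal ?_
      rw [div_le_iff₀ (hc0 h), mul_comm]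
      exact hh hk
  have hqm : AEStronglyMeasurable (fun h => d h ^ 2 / c h) (P.map (B.history ψ t)) :=
    ((hdi.1.aemeasurable.pow_const 2).div hcm.aemeasurable).aestronglyMeasurable
  have hq0 : ∀ h, 0 ≤ d h ^ 2 / c h := fun h => div_nonneg (sq_nonneg _) (hc0 h).le
  have hqi : Integrable (fun h => d h ^ 2 / c h) (P.map (B.history ψ t)) :=
    (lintegral_ofReal_ne_top_iff_integrable hqm (Filter.Eventually.of_forall hq0)).1
      (hle.trans_lt (lt_top_iff_ne_top.2 htop)).ne
  have hs : ∀ h, √(c h) ^ 2 = c h := fun h => Real.sq_sqrt (hc0 h).le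
  have a1 : ∀ h, (d h / √(c h)) ^ 2 = d h ^ 2 / c h := fun h => by rw [div_pow, hs]
  have a2 : ∀ h, d h / √(c h) * √(c h) = d h := fun h =>
    div_mul_cancel₀ _ (Real.sqrt_pos.2 (hc0 h)).ne'
  -- The coefficient `c` varies with the history. Splitting `d = (d / √c) * √c` pulls it out as its
  -- mean, leaving `d² / c`, which is dominated pointwise by the divergence.
  have hcs := sq_integral_mul_le (μ := P.map (B.history ψ t)) (f := fun h => d h / √(c h))
    (g := fun h => √(c h)) (by simpa only [a1] using hqi) (by simpa only [hs] using hci)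
    (by simpa only [a2] using hdi)
  simp only [a1, a2, hs, hdE, hcE] at hcs
  refine (ENNReal.ofReal_le_ofReal hcs).trans ?_
  rw [ENNReal.ofReal_mul (integral_nonneg hq0), mul_comm,
    ofReal_integral_eq_lintegral_ofReal hqi (Filter.Eventually.of_forall hq0)]
  exact mul_le_mul_right hle _

lemma measurableSet_action_notMem (t : ℕ) :
    MeasurableSet {ω | B.action ψ t ω ∉ histArms (B.history ψ t ω)} :=
  ((B.measurable_history ψ t).prodMk (B.measurable_action ψ t))
    (measurableSet_histArms fun s b => b ∉ s)

lemma measurableSet_satAction_notMem (D : ℝ) (t : ℕ) :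
    MeasurableSet {ω | B.satAction D ω ∉ histArms (B.history ψ t ω)} :=
  ((B.measurable_history ψ t).prodMk (B.measurable_satAction D))
    (measurableSet_histArms fun s b => b ∉ s)

lemma measure_notMem_histArms [IsProbabilityMeasure P] {t : ℕ} {X : Ω → ℕ} (hX : Measurable X) :
    P {ω | X ω ∉ histArms (B.history ψ t ω)} = ∫⁻ h,
      condDistrib X (B.history ψ t) P h (histArms h : Set ℕ)ᶜ ∂(P.map (B.history ψ t)) := by
  have hH := B.measurable_history ψ t
  have hE : MeasurableSet {p : (Fin t → ℕ × ℝ) × ℕ | p.2 ∉ histArms p.1} :=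
    measurableSet_histArms fun s b => b ∉ s
  have h := lintegral_condDistrib_map (P := P) hH hX
    (F := {p : (Fin t → ℕ × ℝ) × ℕ | p.2 ∉ histArms p.1}.indicator 1)
    (measurable_one.indicator hE)
  have hm : MeasurableSet {ω | X ω ∉ histArms (B.history ψ t ω)} := (hH.prodMk hX) hE
  rw [← lintegral_indicator_one hm]
  refine Eq.trans (lintegral_congr fun ω => ?_) (h.symm.trans (lintegral_congr fun a => ?_))
  · rfl
  · rw [← lintegral_indicator_one (histArms a).measurableSet.compl]
    refine lintegral_congr fun y => ?_
    simp [Set.indicator]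

/-- A new arm is tested exactly as often as the satisficing action is untested. -/
lemma measure_action_notMem [IsProbabilityMeasure P] {D : ℝ} (hδ : 0 < B.delta D)
    (hψ : B.IsSTS ψ D) (t : ℕ) :
    P {ω | B.action ψ t ω ∉ histArms (B.history ψ t ω)}
      = P {ω | B.satAction D ω ∉ histArms (B.history ψ t ω)} := by
  rw [B.measure_notMem_histArms ψ (B.measurable_action ψ t),
    B.measure_notMem_histArms ψ (B.measurable_satAction D)]
  refine lintegral_congr_ae ?_
  filter_upwards [B.ae_matching_of_isSTS ψ (B.prior_Ici_ne_zero hδ) hψ t] with h hh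
  rw [prob_compl_eq_one_sub (histArms h).measurableSet,
    prob_compl_eq_one_sub (histArms h).measurableSet, ← sum_measure_singleton,
    ← sum_measure_singleton, Finset.sum_congr rfl hh.1]

lemma expectedTested_zero : B.expectedTested ψ 0 = 0 := by
  simp [expectedTested, histArms]

lemma expectedTested_succ [IsProbabilityMeasure P] {D : ℝ} (hδ : 0 < B.delta D)
    (hψ : B.IsSTS ψ D) (t : ℕ) :
    B.expectedTested ψ (t + 1) = B.expectedTested ψ t + B.untestedProb ψ D t := by
  have hE := B.measurableSet_action_notMem ψ t
  have h1 : ∀ ω, ((histArms (B.history ψ (t + 1) ω)).card : ℝ)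
      = (histArms (B.history ψ t ω)).card
        + {ω | B.action ψ t ω ∉ histArms (B.history ψ t ω)}.indicator (fun _ => (1 : ℝ)) ω := by
    intro ω
    rw [histArms_history_succ]
    by_cases h : B.action ψ t ω ∈ histArms (B.history ψ t ω)
    · simp [Finset.insert_eq_of_mem h, h]
    · simp [Finset.card_insert_of_notMem h, h]
  simp only [expectedTested, h1]
  rw [integral_add (B.integrable_card_histArms ψ t) ((integrable_const _).indicator hE),
    integral_indicator_const _ hE, smul_eq_mul, mul_one, untestedProb, measureReal_def,
    measureReal_def, B.measure_action_notMem ψ hδ hψ t]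

/-- The satisficing action is found at a rate proportional to the square of the probability that it
is untested. -/
lemma mul_sq_le_measure_found [IsProbabilityMeasure P] {D : ℝ} (hδ : 0 < B.delta D)
    (hψ : B.IsSTS ψ D) (t : ℕ) :
    B.delta D * B.untestedProb ψ D t ^ 2 ≤ 2 * P.real {ω | B.satAction D ω
      ∉ histArms (B.history ψ t ω) ∧ B.action ψ t ω = B.satAction D ω} := by
  have hH := B.measurable_history ψ t
  have hS := B.measurable_satAction D
  have hAR := (B.measurable_action ψ t).prodMk (B.measurable_reward ψ t)
  have : IsProbabilityMeasure (P.map (B.history ψ t)) :=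
    Measure.isProbabilityMeasure_map hH.aemeasurable
  set K : (Fin t → ℕ × ℝ) → ℝ≥0∞ := fun h =>
    condDistrib (B.satAction D) (B.history ψ t) P h (histArms h : Set ℕ)ᶜ with hK
  have hE : MeasurableSet {p : (Fin t → ℕ × ℝ) × ℕ | p.2 ∉ histArms p.1} :=
    measurableSet_histArms fun s b => b ∉ s
  have hKm : Measurable K := Kernel.measurable_kernel_prodMk_left hE
  have hK1 : ∀ h, K h ≤ 1 := fun h => prob_le_one
  have hu : B.untestedProb ψ D t = ∫ h, (K h).toReal ∂(P.map (B.history ψ t)) := by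
    rw [untestedProb, measureReal_def, B.measure_notMem_histArms ψ hS,
      integral_toReal hKm.aemeasurable
        (Filter.Eventually.of_forall fun h => (hK1 h).trans_lt ENNReal.one_lt_top)]
  have hb : ∀ h, ‖(K h).toReal‖ ≤ 1 := fun h => by
    rw [Real.norm_of_nonneg ENNReal.toReal_nonneg]
    exact ENNReal.toReal_mono ENNReal.one_ne_top (hK1 h)
  have hK2i : Integrable (fun h => (K h).toReal ^ 2) (P.map (B.history ψ t)) := by
    refine Integrable.of_bound (hKm.ennreal_toReal.pow_const 2).aestronglyMeasurable 1
      (Filter.Eventually.of_forall fun h => ?_)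
    rw [norm_pow]
    exact pow_le_one₀ (norm_nonneg _) (hb h)
  have hKi : Integrable (fun h => (K h).toReal) (P.map (B.history ψ t)) :=
    Integrable.of_bound hKm.ennreal_toReal.aestronglyMeasurable 1
      (Filter.Eventually.of_forall hb)
  have hcs : B.untestedProb ψ D t ^ 2 ≤ ∫ h, (K h).toReal ^ 2 ∂(P.map (B.history ψ t)) := by
    have := sq_integral_mul_le (μ := P.map (B.history ψ t)) (f := fun h => (K h).toReal)
      (g := fun _ => 1) hK2i (by simp) (by simpa using hKi)
    simpa [← hu] using this
  have hfound : ∫⁻ h, B.prior (Set.Ici (B.Rstar - D)) * K h ^ 2 ∂(P.map (B.history ψ t))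
      ≤ 2 * P {ω | B.satAction D ω
        ∉ histArms (B.history ψ t ω) ∧ B.action ψ t ω = B.satAction D ω} := by
    have hF : MeasurableSet {p : (Fin t → ℕ × ℝ) × (ℕ × (ℕ × ℝ)) |
        p.2.1 ∉ histArms p.1 ∧ p.2.2.1 = p.2.1} := by
      have h1 : Measurable fun p : (Fin t → ℕ × ℝ) × (ℕ × (ℕ × ℝ)) =>
          (p.1, (p.2.1, p.2.2.1)) := by fun_prop
      exact h1 (measurableSet_histArms (S := ℕ × ℕ) fun s b => b.1 ∉ s ∧ b.2 = b.1)
    have h2 := lintegral_condDistrib_map (P := P) hH (hS.prodMk hAR)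
      (F := {p : (Fin t → ℕ × ℝ) × (ℕ × (ℕ × ℝ)) |
        p.2.1 ∉ histArms p.1 ∧ p.2.2.1 = p.2.1}.indicator 1) (measurable_one.indicator hF)
    have h3 : P {ω | B.satAction D ω
        ∉ histArms (B.history ψ t ω) ∧ B.action ψ t ω = B.satAction D ω}
        = ∫⁻ h, ∫⁻ y, {p : (Fin t → ℕ × ℝ) × (ℕ × (ℕ × ℝ)) |
        p.2.1 ∉ histArms p.1 ∧ p.2.2.1 = p.2.1}.indicator 1 (h, y)
          ∂(condDistrib (fun ω => (B.satAction D ω, (B.action ψ t ω, B.reward ψ t ω)))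
          (B.history ψ t) P h) ∂(P.map (B.history ψ t)) := by
      have hm : MeasurableSet {ω | B.satAction D ω
          ∉ histArms (B.history ψ t ω) ∧ B.action ψ t ω = B.satAction D ω} :=
        (hH.prodMk (hS.prodMk hAR)) hF
      rw [h2, ← lintegral_indicator_one hm]
      rfl
    rw [h3, ← lintegral_const_mul' _ _ (by simp)]
    refine lintegral_mono_ae ?_
    have k1 := ae_all_iff.2 fun a => B.ae_lintegral_action ψ t a D fun b => if b = a then 1 else 0
    filter_upwards [B.ae_matching_of_isSTS ψ (B.prior_Ici_ne_zero hδ) hψ t, k1,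
      B.ae_satAction_law ψ t D] with h hm k1 hlaw
    refine hm.2.trans_eq ?_
    congr 1
    have e1 : ∀ y : ℕ × (ℕ × ℝ), {p : (Fin t → ℕ × ℝ) × (ℕ × (ℕ × ℝ)) |
        p.2.1 ∉ histArms p.1 ∧ p.2.2.1 = p.2.1}.indicator (1 : (Fin t → ℕ × ℝ) × (ℕ × (ℕ × ℝ)) → ℝ≥0∞) (h, y)
        = ∑' a, if a ∈ histArms h then 0 else
          {y : ℕ × (ℕ × ℝ) | y.2.1 = a}.indicator (fun y => if y.1 = a then 1 else 0) y := by
      intro y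
      rw [tsum_eq_single y.1]
      · by_cases g1 : y.1 ∈ histArms h <;> by_cases g2 : y.2.1 = y.1 <;>
          simp [Set.indicator, g1, g2]
      · intro a ha
        simp [Set.indicator, ha.symm]
    have e2 : ∀ a, Measurable
        ({y : ℕ × (ℕ × ℝ) | y.2.1 = a}.indicator fun y => if y.1 = a then (1 : ℝ≥0∞) else 0) := by
      intro a
      refine Measurable.indicator ?_ (measurable_snd.fst (measurableSet_singleton a))
      exact Measurable.ite (measurable_fst (measurableSet_singleton a)) measurable_const
        measurable_const
    rw [lintegral_congr e1, lintegral_tsum]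
    · refine tsum_congr fun a => ?_
      split_ifs with ha
      · simp
      · rw [k1 a]
        congr 1
        rw [hlaw, Kernel.map_apply' _ (measurable_satArm _) _ (measurableSet_singleton a),
          ← lintegral_indicator_one ((measurable_satArm _) (measurableSet_singleton a))]
        exact lintegral_congr fun x => by simp [Set.indicator]
    · intro a
      split_ifs
      · exact aemeasurable_const
      · exact (e2 a).aemeasurable
  have h4 := ENNReal.toReal_mono (ENNReal.mul_ne_top (by simp) (measure_ne_top _ _)) hfound
  rw [lintegral_const_mul _ (hKm.pow_const 2), ENNReal.toReal_mul, ENNReal.toReal_mul] at h4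
  have h5 : (∫⁻ h, K h ^ 2 ∂(P.map (B.history ψ t))).toReal
      = ∫ h, (K h).toReal ^ 2 ∂(P.map (B.history ψ t)) := by
    rw [← integral_toReal (hKm.pow_const 2).aemeasurable (Filter.Eventually.of_forall fun h =>
      (pow_le_one₀ (zero_le) (hK1 h)).trans_lt ENNReal.one_lt_top)]
    simp only [ENNReal.toReal_pow]
  rw [h5, ENNReal.toReal_ofNat] at h4
  calc B.delta D * B.untestedProb ψ D t ^ 2
      ≤ B.delta D * ∫ h, (K h).toReal ^ 2 ∂(P.map (B.history ψ t)) :=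
        mul_le_mul_of_nonneg_left hcs hδ.le
    _ ≤ _ := h4

/-- If the satisficing action is untested at `t` and is then played, it is no longer untested at `t
+ 1`; that event is disjoint from the next one and both lie inside the current one. -/
lemma untestedProb_succ_le [IsProbabilityMeasure P] {D : ℝ} (hδ : 0 < B.delta D)
    (hψ : B.IsSTS ψ D) (t : ℕ) : B.untestedProb ψ D (t + 1)
      ≤ B.untestedProb ψ D t - B.delta D / 2 * B.untestedProb ψ D t ^ 2 := by
  have h := B.mul_sq_le_measure_found ψ hδ hψ t
  have hm1 := B.measurableSet_satAction_notMem ψ D (t + 1)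
  have hm2 : MeasurableSet {ω | B.satAction D ω
      ∉ histArms (B.history ψ t ω) ∧ B.action ψ t ω = B.satAction D ω} :=
    (B.measurableSet_satAction_notMem ψ D t).inter
      (measurableSet_eq_fun (B.measurable_action ψ t) (B.measurable_satAction D))
  have hd : Disjoint {ω | B.satAction D ω ∉ histArms (B.history ψ (t + 1) ω)}
      {ω | B.satAction D ω
        ∉ histArms (B.history ψ t ω) ∧ B.action ψ t ω = B.satAction D ω} := by
    refine Set.disjoint_left.2 fun ω h1 h2 => h1 ?_
    rw [histArms_history_succ, ← h2.2]
    exact Finset.mem_insert_self _ _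
  have hu : {ω | B.satAction D ω ∉ histArms (B.history ψ (t + 1) ω)} ∪ {ω | B.satAction D ω
        ∉ histArms (B.history ψ t ω) ∧ B.action ψ t ω = B.satAction D ω}
      ⊆ {ω | B.satAction D ω ∉ histArms (B.history ψ t ω)} := by
    rintro ω (h1 | h1)
    · refine fun h2 => h1 ?_
      rw [histArms_history_succ]
      exact Finset.mem_insert_of_mem h2
    · exact h1.1
  have h3 := measureReal_mono (μ := P) hu
  rw [measureReal_union hd hm2] at h3
  simp only [untestedProb] at h ⊢
  linarith

/-- Discrete form of `e' ≤ -q e²` with `q = δ / 2`: the reciprocal grows by at least `q` per period.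
The induction step reduces to `(1 - q e) * (1 + q e) ≤ 1`. -/
lemma untestedProb_le [IsProbabilityMeasure P] {D : ℝ} (hδ : 0 < B.delta D)
    (hψ : B.IsSTS ψ D) (t : ℕ) : B.untestedProb ψ D t * (1 + B.delta D / 2 * t) ≤ 1 := by
  induction t with
  | zero =>
    simp [untestedProb]
  | succ t ih =>
    have h := B.untestedProb_succ_le ψ hδ hψ t
    have h0 : 0 ≤ B.untestedProb ψ D t := measureReal_nonneg
    have h0' : 0 ≤ B.untestedProb ψ D (t + 1) := measureReal_nonneg
    set e := B.untestedProb ψ D t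
    set e' := B.untestedProb ψ D (t + 1)
    set q := B.delta D / 2
    have hq : 0 < q := half_pos hδ
    have ht : (0 : ℝ) ≤ t := Nat.cast_nonneg t
    push_cast
    have h1 : (e - q * e ^ 2) * (1 + q * (t + 1)) ≤ 1 := by
      have h2 : 0 ≤ 1 - q * e + q * e := by linarith
      have h3 : 0 ≤ e - q * e ^ 2 := h0'.trans h
      rcases h0.eq_or_lt with h4 | h4
      · rw [← h4]; norm_num
      · have h5 : 0 ≤ 1 - q * e := by
          by_contra h6
          nlinarith
        have h6 : (1 - q * e) * (e * (1 + q * t) + q * e) ≤ (1 - q * e) * (1 + q * e) :=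
          mul_le_mul_of_nonneg_left (by linarith) h5
        nlinarith [sq_nonneg (q * e)]
    have h7 : 0 ≤ 1 + q * (t + 1) := by positivity
    exact (mul_le_mul_of_nonneg_right h h7).trans h1

/-- The expected number of tested arms grows at most like a harmonic sum. -/
lemma expectedTested_le [IsProbabilityMeasure P] {D : ℝ} (hδ : 0 < B.delta D)
    (hψ : B.IsSTS ψ D) (t : ℕ) :
    B.expectedTested ψ t ≤ 1 + 2 / B.delta D * ∑ i ∈ Finset.range t, 1 / ((i : ℝ) + 1) := by
  -- Period `0` is bounded by `1` and period `i + 1` by `(2 / δ) / (i + 1)`, so the sharp form is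
  -- shifted by one; the shift is given away afterwards.
  have key : ∀ t, B.expectedTested ψ (t + 1)
      ≤ 1 + 2 / B.delta D * ∑ i ∈ Finset.range t, 1 / ((i : ℝ) + 1) := by
    intro t
    induction t with
    | zero =>
      rw [B.expectedTested_succ ψ hδ hψ, B.expectedTested_zero ψ]
      have : B.untestedProb ψ D 0 ≤ 1 := measureReal_le_one
      simpa using this
    | succ t ih =>
      rw [B.expectedTested_succ ψ hδ hψ, Finset.sum_range_succ]
      have h := B.untestedProb_le ψ hδ hψ (t + 1)
      have h0 : 0 ≤ B.untestedProb ψ D (t + 1) := measureReal_nonneg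
      have h1 : B.untestedProb ψ D (t + 1) ≤ 2 / B.delta D * (1 / ((t : ℝ) + 1)) := by
        rw [div_mul_div_comm, mul_one, le_div_iff₀ (by positivity)]
        push_cast at h
        nlinarith
      linarith
  cases t with
  | zero => rw [B.expectedTested_zero ψ]; simp
  | succ t =>
    refine (key t).trans ?_
    have : (0 : ℝ) ≤ 1 / ((t : ℝ) + 1) := by positivity
    rw [Finset.sum_range_succ]
    have h2 : 0 ≤ 2 / B.delta D := by positivity
    nlinarith

end NoisyBandit

/-! ### Geometric entropy and harmonic series -/

section Series

/-- The entropy of a geometric law of success probability `d` is at most `1 + log (1 / d)`. -/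
lemma tsum_ofReal_negMulLog_geometric_le {d : ℝ} (h0 : 0 < d) (h1 : d ≤ 1) :
    ∑' a : ℕ, ENNReal.ofReal (Real.negMulLog (d * (1 - d) ^ a))
      ≤ ENNReal.ofReal (1 + Real.log (1 / d)) := by
  set r := 1 - d with hr
  have hr0 : 0 ≤ r := by linarith
  have hr1 : r < 1 := by linarith
  have hs : HasSum (fun a : ℕ => Real.negMulLog (d * r ^ a))
      (Real.negMulLog d * (1 - r)⁻¹ + d * (-Real.log r) * (r / (1 - r) ^ 2)) := by
    have e : (fun a : ℕ => Real.negMulLog (d * r ^ a))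
        = fun a : ℕ => Real.negMulLog d * r ^ a + d * (-Real.log r) * (a * r ^ a) := by
      funext a
      rw [Real.negMulLog_mul, Real.negMulLog, Real.negMulLog, Real.log_pow]
      ring
    have h : HasSum (fun a : ℕ => (a : ℝ) * r ^ a) (r / (1 - r) ^ 2) :=
      hasSum_coe_mul_geometric_of_norm_lt_one (by rwa [Real.norm_of_nonneg hr0])
    rw [e]
    exact ((hasSum_geometric_of_lt_one hr0 hr1).mul_left _).add (h.mul_left _)
  have hnn : ∀ a : ℕ, 0 ≤ Real.negMulLog (d * r ^ a) := fun a =>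
    Real.negMulLog_nonneg (by positivity) (mul_le_one₀ h1 (by positivity) (pow_le_one₀ hr0 hr1.le))
  rw [← ENNReal.ofReal_tsum_of_nonneg hnn hs.summable, hs.tsum_eq]
  refine ENNReal.ofReal_le_ofReal ?_
  -- The entropy is exactly `log (1 / d) + r * (-log r) / d`, and `-log r ≤ 1 / r - 1` bounds the
  -- last term by `1`.
  have h2 : r * (-Real.log r) ≤ d := by
    rcases hr0.eq_or_lt with h | h
    · rw [← h]; simpa using h0.le
    · have h3 := mul_le_mul_of_nonneg_left (Real.one_sub_inv_le_log_of_pos h) hr0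
      rw [mul_sub, mul_inv_cancel₀ h.ne'] at h3
      linarith
  have h3 : Real.negMulLog d * (1 - r)⁻¹ = Real.log (1 / d) := by
    have : 1 - r = d := by linarith
    rw [this, Real.negMulLog, one_div, Real.log_inv]
    field_simp
  have h4 : d * (-Real.log r) * (r / (1 - r) ^ 2) = r * (-Real.log r) / d := by
    have : 1 - r = d := by linarith
    rw [this]
    field_simp
  rw [h3, h4, add_comm]
  exact add_le_add ((div_le_one h0).2 h2) le_rfl

/-- The generating function of the harmonic numbers. -/
lemma hasSum_pow_mul_harmonic {x : ℝ} (h0 : 0 ≤ x) (h1 : x < 1) :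
    HasSum (fun t : ℕ => x ^ t * ∑ i ∈ Finset.range t, 1 / ((i : ℝ) + 1))
      (Real.log (1 / (1 - x)) / (1 - x)) := by
  have hf := Real.hasSum_pow_div_log_of_abs_lt_one (x := x) (by rwa [abs_of_nonneg h0])
  have hg := hasSum_geometric_of_lt_one h0 h1
  have h := hasSum_sum_range_mul_of_summable_norm hf.summable.norm hg.summable.norm
  rw [hf.tsum_eq, hg.tsum_eq] at h
  -- The series is the Cauchy product of the logarithmic and geometric series, up to an index shift
  -- that drops the empty harmonic sum at `t = 0`.
  rw [← hasSum_nat_add_iff' 1]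
  have e : (fun n : ℕ => x ^ (n + 1) * ∑ i ∈ Finset.range (n + 1), 1 / ((i : ℝ) + 1))
      = fun n => ∑ k ∈ Finset.range (n + 1), x ^ (k + 1) / ((k : ℝ) + 1) * x ^ (n - k) := by
    funext n
    rw [Finset.mul_sum]
    refine Finset.sum_congr rfl fun k hk => ?_
    have hk' : n + 1 = k + 1 + (n - k) := by
      have := Finset.mem_range.1 hk
      omega
    rw [hk', pow_add]
    ring
  rw [e]
  simpa [Real.log_inv, div_eq_mul_inv] using h

lemma hasSum_pow_mul_harmonic_bound {x c : ℝ} (h0 : 0 ≤ x) (h1 : x < 1) :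
    HasSum (fun t : ℕ => x ^ t * (1 + c + c * ∑ i ∈ Finset.range t, 1 / ((i : ℝ) + 1)))
      ((1 + c + c * Real.log (1 / (1 - x))) / (1 - x)) := by
  have h := ((hasSum_geometric_of_lt_one h0 h1).mul_left (1 + c)).add
    ((hasSum_pow_mul_harmonic h0 h1).mul_left c)
  have e : (fun t : ℕ => x ^ t * (1 + c + c * ∑ i ∈ Finset.range t, 1 / ((i : ℝ) + 1)))
      = fun t => (1 + c) * x ^ t + c * (x ^ t * ∑ i ∈ Finset.range t, 1 / ((i : ℝ) + 1)) := by
    funext t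
    ring
  rwa [e, add_div, mul_div_assoc, div_eq_mul_inv (1 + c)]

end Series

/-! ### Simplification of the rate -/

section Rates

lemma regretBound_le_regretRate {d α : ℝ} (h0 : 0 < d) (h1 : d ≤ 1) (hα : 0 ≤ α) (hα1 : α < 1) :
    regretBound d α ≤ 7 * regretRate d α * (1 + Real.log (regretRate d α)) ^ 1 := by
  have hv0 : 0 < 1 - α := by linarith
  have hu : 1 ≤ 1 / d := (one_le_div h0).2 h1
  have hv : 1 ≤ 1 / (1 - α) := (one_le_div hv0).2 (by linarith)
  have hα2 : 1 - α ≤ 1 - α ^ 2 := by nlinarith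
  have hw : 1 / (1 - α ^ 2) ≤ 1 / (1 - α) := one_div_le_one_div_of_le hv0 hα2
  have hw0 : 0 < 1 / (1 - α ^ 2) := one_div_pos.2 (hv0.trans_le hα2)
  have e1 : 1 / d / (1 - α) = 1 / d * (1 / (1 - α)) := by rw [mul_one_div]
  have e2 : infoRatioBound d α * (1 + Real.log (1 / d)) / (1 - α ^ 2)
      = (6 + 4 * (1 / d) + 2 * (1 / d) * Real.log (1 / (1 - α ^ 2)))
        * (1 + Real.log (1 / d)) * (1 / (1 - α ^ 2)) := by
    rw [infoRatioBound]
    ring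
  rw [regretBound, regretRate, e1, e2, pow_one]
  set u := 1 / d
  set v := 1 / (1 - α)
  set w := 1 / (1 - α ^ 2)
  have hlu : 0 ≤ Real.log u := Real.log_nonneg hu
  have hlv : 0 ≤ Real.log v := Real.log_nonneg hv
  have hlw : Real.log w ≤ Real.log v := Real.log_le_log hw0 hw
  -- For `u ≤ v` the rate is `√(u v)`, and `1 + log u` and `1 + log v` are both at most `2 L`; the
  -- radicand is then at most `40 u v L² ≤ (7 √(u v) L)²`. For `v ≤ u` the trivial bound `v` is the
  -- rate itself.
  rcases le_total u v with huv | huv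
  · have h2 : √(u * v) ≤ v := by
      refine Real.sqrt_le_iff.2 ⟨by linarith, ?_⟩
      nlinarith
    rw [min_eq_left h2]
    have h3 : Real.log √(u * v) = (Real.log u + Real.log v) / 2 := by
      rw [Real.log_sqrt (by positivity), Real.log_mul (by positivity) (by positivity)]
    have h4 : √(u * v) ^ 2 = u * v := Real.sq_sqrt (by positivity)
    refine (min_le_left _ _).trans (Real.sqrt_le_iff.2 ⟨by rw [h3]; positivity, ?_⟩)
    set L := 1 + Real.log √(u * v) with hL
    have hL0 : 0 ≤ L := by rw [hL, h3]; positivity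
    have e : (7 * √(u * v) * L) ^ 2 = 49 * (u * v) * L ^ 2 := by
      rw [mul_pow, mul_pow, h4]
      norm_num
    rw [e]
    have h5 : 6 + 4 * u + 2 * u * Real.log w ≤ 10 * u * (1 + Real.log v) := by
      nlinarith [mul_nonneg (zero_le_one.trans hu) hlv,
        mul_le_mul_of_nonneg_left hlw (zero_le_one.trans hu)]
    have h6 : 10 * u * (1 + Real.log v) ≤ 10 * u * (2 * L) := by
      refine mul_le_mul_of_nonneg_left ?_ (by positivity)
      linarith
    have h7 : 1 + Real.log u ≤ 2 * L := by linarith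
    calc (6 + 4 * u + 2 * u * Real.log w) * (1 + Real.log u) * w
        ≤ 10 * u * (2 * L) * (2 * L) * v := by
          gcongr
          exact h5.trans h6
      _ ≤ 49 * (u * v) * L ^ 2 := by
          have : 0 ≤ u * v * L ^ 2 := by positivity
          nlinarith
  · have h2 : v ≤ √(u * v) := by
      refine Real.le_sqrt_of_sq_le ?_
      nlinarith
    rw [min_eq_right h2]
    refine (min_le_right _ _).trans ?_
    nlinarith [mul_nonneg (zero_le_one.trans hv) hlv]

end Rates

/-! ### Assembly of the bounds -/

namespace NoisyBandit

variable {Ω : Type u} {𝒲 : Type v} {Ξ : Type w} [MeasurableSpace Ω]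
  [MeasurableSpace 𝒲] [MeasurableSpace Ξ] {P : Measure Ω}
  (B : NoisyBandit Ω 𝒲 Ξ P) (ψ : Policy Ξ)

lemma Rstar_le_one : B.Rstar ≤ 1 :=
  Real.sSup_le (fun _ hx => (Measure.support_subset_of_isClosed isClosed_Icc B.prior_mem hx).2)
    zero_le_one

lemma expectedTested_nonneg (t : ℕ) : 0 ≤ B.expectedTested ψ t :=
  integral_nonneg fun _ => Nat.cast_nonneg _

variable [IsProbabilityMeasure P]

lemma delta_le_one (D : ℝ) : B.delta D ≤ 1 := by
  have := B.isProbabilityMeasure_prior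
  exact measureReal_le_one

/-- The satisficing action has a geometric law. -/
lemma measureReal_satAction {D : ℝ} (hδ : 0 < B.delta D) (a : ℕ) :
    (P.map (B.satAction D)).real {a} = B.delta D * (1 - B.delta D) ^ a := by
  have hlt : ∀ n : ℕ, P.real {ω | ∀ b < n, B.θ b ω < B.Rstar - D} = (1 - B.delta D) ^ n := by
    intro n
    rw [measureReal_def, B.measure_forall_lt, ENNReal.toReal_pow, ← B.ofReal_delta,
      ← ENNReal.ofReal_one, ← ENNReal.ofReal_sub _ hδ.le,
      ENNReal.toReal_ofReal (sub_nonneg.2 (B.delta_le_one D))]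
  have hm : ∀ n : ℕ, MeasurableSet {ω | ∀ b < n, B.θ b ω < B.Rstar - D} := fun n =>
    B.measurable_means (measurableSet_forall_lt (B.Rstar - D) n)
  rw [map_measureReal_apply (B.measurable_satAction D) (measurableSet_singleton a)]
  have h : B.satAction D ⁻¹' {a} =ᵐ[P] ({ω | ∀ b < a, B.θ b ω < B.Rstar - D} \
      {ω | ∀ b < a + 1, B.θ b ω < B.Rstar - D} : Set Ω) := by
    filter_upwards [B.ae_exists_satisficing (B.prior_Ici_ne_zero hδ)] with ω hω
    refine propext ?_
    change satArm (B.Rstar - D) (B.means ω) = a ↔ (∀ b < a, B.θ b ω < B.Rstar - D) ∧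
      ¬ ∀ b < a + 1, B.θ b ω < B.Rstar - D
    rw [satArm_eq_iff hω, Nat.forall_lt_succ_right]
    change (B.Rstar - D ≤ B.θ a ω ∧ ∀ b < a, B.θ b ω < B.Rstar - D) ↔ _
    rw [← not_lt]
    tauto
  rw [measureReal_congr h, measureReal_sdiff _ (hm _), hlt, hlt, pow_succ]
  · ring
  · exact fun ω hω b hb => hω b (hb.trans (Nat.lt_succ_self a))

lemma massEntropy_satAction_le {D : ℝ} (hδ : 0 < B.delta D) :
    massEntropy (P.map (B.satAction D)) ≤ ENNReal.ofReal (1 + Real.log (1 / B.delta D)) := by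
  simp only [massEntropy, B.measureReal_satAction hδ]
  exact tsum_ofReal_negMulLog_geometric_le hδ (B.delta_le_one D)

/-- The total information gained about the satisficing action. -/
lemma tsum_condMutualInfo_satAction_le {D : ℝ} (hδ : 0 < B.delta D) :
    ∑' t, condMutualInfo P (B.satAction D) (fun ω => (B.action ψ t ω, B.reward ψ t ω))
      (B.history ψ t) ≤ ENNReal.ofReal (1 + Real.log (1 / B.delta D)) :=
  (tsum_condMutualInfo_le (B.measurable_satAction D)
    (fun t => (B.measurable_action ψ t).prodMk (B.measurable_reward ψ t))
    (B.measurable_history ψ) (B.comap_history_succ ψ)).trans (B.massEntropy_satAction_le hδ)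

lemma exists_hasSum_expectedTested {D α : ℝ} (hδ : 0 < B.delta D) (hα : 0 ≤ α) (hα1 : α < 1)
    (hψ : B.IsSTS ψ D) :
    ∃ s ≤ infoRatioBound (B.delta D) α / (1 - α ^ 2),
      HasSum (fun t : ℕ => α ^ (2 * t) * (B.expectedTested ψ t + 2 / B.delta D)) s := by
  have hx1 : α ^ 2 < 1 := by nlinarith
  have hq : 0 ≤ 2 / B.delta D := by positivity
  have h := hasSum_pow_mul_harmonic_bound (c := 2 / B.delta D) (sq_nonneg α) hx1
  have hle : ∀ t : ℕ, α ^ (2 * t) * (B.expectedTested ψ t + 2 / B.delta D)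
      ≤ (α ^ 2) ^ t * (1 + 2 / B.delta D
        + 2 / B.delta D * ∑ i ∈ Finset.range t, 1 / ((i : ℝ) + 1)) := fun t => by
    rw [pow_mul]
    refine mul_le_mul_of_nonneg_left ?_ (by positivity)
    linarith [B.expectedTested_le ψ hδ hψ t]
  have hsum : Summable fun t : ℕ => α ^ (2 * t) * (B.expectedTested ψ t + 2 / B.delta D) :=
    Summable.of_nonneg_of_le (fun t => mul_nonneg (by positivity)
      (add_nonneg (B.expectedTested_nonneg ψ t) hq)) hle h.summable
  refine ⟨_, (hasSum_le hle hsum.hasSum h).trans ?_, hsum.hasSum⟩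
  -- The argument gives `1 + 2 / δ` where the stated bound has `6 + 4 / δ`.
  refine div_le_div_of_nonneg_right ?_ (by linarith)
  have e : 4 / B.delta D = 2 / B.delta D + 2 / B.delta D := by ring
  rw [infoRatioBound, e]
  linarith

/-- The discounted information ratio of satisficing Thompson sampling. -/
lemma infoRatio_le {D α : ℝ} (hδ : 0 < B.delta D) (hα : 0 ≤ α) (hα1 : α < 1)
    (hψ : B.IsSTS ψ D) :
    B.infoRatio α ψ D ≤ ENNReal.ofReal (infoRatioBound (B.delta D) α) := by
  obtain ⟨s, hs, hsum⟩ := B.exists_hasSum_expectedTested ψ hδ hα hα1 hψ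
  have hx : 0 < 1 - α ^ 2 := by nlinarith
  have hnn : ∀ t : ℕ, 0 ≤ α ^ (2 * t) * (B.expectedTested ψ t + 2 / B.delta D) := fun t =>
    mul_nonneg (by positivity) (add_nonneg (B.expectedTested_nonneg ψ t) (by positivity))
  calc B.infoRatio α ψ D
      ≤ ENNReal.ofReal (1 - α ^ 2) * ∑' t : ℕ, ENNReal.ofReal
          (α ^ (2 * t) * (B.expectedTested ψ t + 2 / B.delta D)) := by
        refine mul_le_mul_right (ENNReal.tsum_le_tsum fun t => ?_) _
        rw [ENNReal.ofReal_mul (by positivity)]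
        -- The bound in product form forces the numerator to vanish along with the information, so
        -- the convention `0 / 0 = 0` applies and no ratio is infinite.
        exact mul_le_mul_right (ENNReal.div_le_of_le_mul
          (B.ofReal_sq_le_mul_condMutualInfo ψ hδ hψ t)) _
    _ = ENNReal.ofReal ((1 - α ^ 2) * s) := by
        rw [← ENNReal.ofReal_tsum_of_nonneg hnn hsum.summable, hsum.tsum_eq,
          ENNReal.ofReal_mul hx.le]
    _ ≤ _ := by
        refine ENNReal.ofReal_le_ofReal ?_
        rwa [le_div_iff₀ hx, mul_comm] at hs

/-- Sum and expectation may be exchanged, as the terms are dominated by a geometric series. -/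
lemma hasSum_sRegret {D α : ℝ} (hα : 0 ≤ α) (hα1 : α < 1) :
    HasSum (fun t : ℕ => α ^ t * (B.Rstar - D - ∫ ω, B.reward ψ t ω ∂P)) (B.sRegret α ψ D) := by
  have hi : ∀ t : ℕ, Integrable (fun ω => α ^ t * (B.Rstar - D - B.reward ψ t ω)) P := fun t =>
    ((integrable_const _).sub (B.integrable_reward ψ t)).const_mul _
  have hb : ∀ t : ℕ, ∫ ω, ‖α ^ t * (B.Rstar - D - B.reward ψ t ω)‖ ∂P
      ≤ α ^ t * (|B.Rstar - D| + 1) := fun t => by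
    have h : ∀ᵐ ω ∂P, ‖α ^ t * (B.Rstar - D - B.reward ψ t ω)‖
        ≤ α ^ t * (|B.Rstar - D| + 1) := by
      filter_upwards [B.ae_reward_mem ψ t] with ω hω
      rw [norm_mul, Real.norm_of_nonneg (by positivity : 0 ≤ α ^ t)]
      refine mul_le_mul_of_nonneg_left ((norm_sub_le _ _).trans (add_le_add le_rfl ?_))
        (by positivity)
      rw [Real.norm_of_nonneg hω.1]
      exact hω.2
    simpa using integral_mono_ae (hi t).norm (integrable_const _) h
  have h := hasSum_integral_of_summable_integral_norm hi
    (Summable.of_nonneg_of_le (fun t => integral_nonneg fun _ => norm_nonneg _) hb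
      ((summable_geometric_of_lt_one hα hα1).mul_right _))
  have e : ∀ t : ℕ, ∫ ω, α ^ t * (B.Rstar - D - B.reward ψ t ω) ∂P
      = α ^ t * (B.Rstar - D - ∫ ω, B.reward ψ t ω ∂P) := fun t => by
    rw [integral_const_mul, integral_sub (integrable_const _) (B.integrable_reward ψ t)]
    simp
  simp only [e] at h
  exact h

/-- The regret relative to the satisficing level is at most the regret relative to the
satisficing action. -/
lemma Rstar_sub_le {D : ℝ} (hδ : 0 < B.delta D) (t : ℕ) :
    B.Rstar - D - ∫ ω, B.reward ψ t ω ∂P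
      ≤ ∫ ω, (B.θ (B.satAction D ω) ω - B.reward ψ t ω) ∂P := by
  rw [integral_sub (B.integrable_satMean D) (B.integrable_reward ψ t)]
  refine sub_le_sub_right ?_ _
  have h : ∀ᵐ ω ∂P, B.Rstar - D ≤ B.θ (B.satAction D ω) ω := by
    filter_upwards [B.ae_exists_satisficing (B.prior_Ici_ne_zero hδ)] with ω hω
    exact ((satArm_eq_iff hω _).1 rfl).1
  simpa using integral_mono_ae (integrable_const _) (B.integrable_satMean D) h

lemma sRegret_le_one_div {D α : ℝ} (hD : 0 ≤ D) (hα : 0 ≤ α) (hα1 : α < 1) :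
    B.sRegret α ψ D ≤ 1 / (1 - α) := by
  rw [one_div]
  refine hasSum_le (fun t => ?_) (B.hasSum_sRegret ψ hα hα1) (hasSum_geometric_of_lt_one hα hα1)
  have h0 : 0 ≤ ∫ ω, B.reward ψ t ω ∂P :=
    integral_nonneg_of_ae ((B.ae_reward_mem ψ t).mono fun _ h => h.1)
  exact mul_le_of_le_one_right (by positivity) (by linarith [B.Rstar_le_one])

lemma sRegret_le_sqrt {D α : ℝ} (hδ : 0 < B.delta D) (hα : 0 ≤ α) (hα1 : α < 1)
    (hψ : B.IsSTS ψ D) :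
    B.sRegret α ψ D
      ≤ √(infoRatioBound (B.delta D) α * (1 + Real.log (1 / B.delta D)) / (1 - α ^ 2)) := by
  obtain ⟨s, hs, hsum⟩ := B.exists_hasSum_expectedTested ψ hδ hα hα1 hψ
  have hq : 0 ≤ 2 / B.delta D := by positivity
  have hlog : 0 ≤ 1 + Real.log (1 / B.delta D) := by
    have := Real.log_nonneg ((one_le_div hδ).2 (B.delta_le_one D))
    linarith
  set I : ℕ → ℝ≥0∞ := fun t => condMutualInfo P (B.satAction D)
    (fun ω => (B.action ψ t ω, B.reward ψ t ω)) (B.history ψ t) with hI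
  have hIsum : ∑' t, I t ≤ ENNReal.ofReal (1 + Real.log (1 / B.delta D)) :=
    B.tsum_condMutualInfo_satAction_le ψ hδ
  have hItop : ∑' t, I t ≠ ∞ := (hIsum.trans_lt ENNReal.ofReal_lt_top).ne
  have hIt : ∀ t, I t ≠ ∞ := fun t => ENNReal.ne_top_of_tsum_ne_top hItop t
  have hIreal : ∑' t, (I t).toReal ≤ 1 + Real.log (1 / B.delta D) := by
    rw [← ENNReal.tsum_toReal_eq hIt]
    exact ENNReal.toReal_le_of_le_ofReal hlog hIsum
  have hnn : ∀ t : ℕ, 0 ≤ α ^ (2 * t) * (B.expectedTested ψ t + 2 / B.delta D) := fun t =>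
    mul_nonneg (by positivity) (add_nonneg (B.expectedTested_nonneg ψ t) hq)
  -- The per-period inequality is used directly, not through the ratio. The square of `α ^ t` gives
  -- the `α ^ (2 * t)` in the first root, and Cauchy-Schwarz over `t` separates this discounted
  -- coefficient sum from the undiscounted total information.
  have hstep : ∀ t : ℕ, α ^ t * (B.Rstar - D - ∫ ω, B.reward ψ t ω ∂P)
      ≤ √(α ^ (2 * t) * (B.expectedTested ψ t + 2 / B.delta D)) * √((I t).toReal) := fun t => by
    have h := B.ofReal_sq_le_mul_condMutualInfo ψ hδ hψ t
    change _ ≤ _ * I t at h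
    rw [← ENNReal.ofReal_toReal (hIt t), ← ENNReal.ofReal_mul
      (add_nonneg (B.expectedTested_nonneg ψ t) hq), ENNReal.ofReal_le_ofReal_iff (mul_nonneg
      (add_nonneg (B.expectedTested_nonneg ψ t) hq) ENNReal.toReal_nonneg)] at h
    rw [← Real.sqrt_mul (hnn t), mul_assoc, mul_comm 2 t, pow_mul]
    refine (mul_le_mul_of_nonneg_left (B.Rstar_sub_le ψ hδ t) (by positivity)).trans ?_
    refine Real.le_sqrt_of_sq_le ?_
    rw [mul_pow]
    exact mul_le_mul_of_nonneg_left h (by positivity)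
  refine le_of_tendsto' (B.hasSum_sRegret ψ hα hα1).tendsto_sum_nat fun n => ?_
  refine (Finset.sum_le_sum fun t _ => hstep t).trans
    ((Real.sum_sqrt_mul_sqrt_le _ hnn fun t => ENNReal.toReal_nonneg).trans ?_)
  have h1 : ∑ t ∈ Finset.range n, α ^ (2 * t) * (B.expectedTested ψ t + 2 / B.delta D)
      ≤ infoRatioBound (B.delta D) α / (1 - α ^ 2) :=
    (sum_le_hasSum _ (fun t _ => hnn t) hsum).trans hs
  have h2 : ∑ t ∈ Finset.range n, (I t).toReal ≤ 1 + Real.log (1 / B.delta D) :=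
    ((ENNReal.summable_toReal hItop).sum_le_tsum _ fun t _ => ENNReal.toReal_nonneg).trans hIreal
  have h3 : 0 ≤ ∑ t ∈ Finset.range n, α ^ (2 * t) * (B.expectedTested ψ t + 2 / B.delta D) :=
    Finset.sum_nonneg fun t _ => hnn t
  rw [← Real.sqrt_mul h3]
  refine Real.sqrt_le_sqrt ?_
  rw [mul_div_right_comm]
  exact mul_le_mul h1 h2 (Finset.sum_nonneg fun t _ => ENNReal.toReal_nonneg) (h3.trans h1)

lemma sRegret_le_regretBound {D α : ℝ} (hD : 0 ≤ D) (hδ : 0 < B.delta D) (hα : 0 ≤ α)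
    (hα1 : α < 1) (hψ : B.IsSTS ψ D) : B.sRegret α ψ D ≤ regretBound (B.delta D) α :=
  le_min (B.sRegret_le_sqrt ψ hδ hα hα1 hψ) (B.sRegret_le_one_div ψ hD hα hα1)

end NoisyBandit

end

theorem mainTheorem4 :
    ∃ C : ℝ, ∃ k : ℕ, 0 < C ∧
      ∀ (Ω : Type u) (𝒲 : Type v) (Ξ : Type w) [MeasurableSpace Ω] [MeasurableSpace 𝒲]
        [MeasurableSpace Ξ] (P : Measure Ω) [IsProbabilityMeasure P]
        (B : NoisyBandit Ω 𝒲 Ξ P) (ψ : Policy Ξ) (D α : ℝ),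
        0 ≤ D → 0 < B.delta D → 0 ≤ α → α < 1 → B.IsSTS ψ D →
        mutualInfo P (B.satAction D) (fun ω a => B.θ a ω)
            ≤ ENNReal.ofReal (1 + Real.log (1 / B.delta D)) ∧
        B.infoRatio α ψ D ≤ ENNReal.ofReal (infoRatioBound (B.delta D) α) ∧
        B.sRegret α ψ D ≤ regretBound (B.delta D) α ∧
        regretBound (B.delta D) α
            ≤ C * regretRate (B.delta D) α * (1 + Real.log (regretRate (B.delta D) α)) ^ k := by
  refine ⟨7, 1, by norm_num, ?_⟩
  intro Ω 𝒲 Ξ _ _ _ P _ B ψ D α hD hδ hα hα1 hψ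
  refine ⟨?_, B.infoRatio_le ψ hδ hα hα1 hψ, B.sRegret_le_regretBound ψ hD hδ hα hα1 hψ,
    regretBound_le_regretRate hδ (B.delta_le_one D) hα hα1⟩
  exact (mutualInfo_le_massEntropy (B.measurable_satAction D) B.measurable_means).trans
    (B.massEntropy_satAction_le hδ)
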